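/- Let $m\ge 1$ be an integer, $\mathbb H$ the upper half plane, and for $\tau\in\mathbb H$ put $y=\operatorname{Im}\tau$ and $\Lambda_\tau=\mathbb Z\tau+\mathbb Z$. For $l\in\mathbb Z$ and $u,z\in\mathbb C$ define $$\theta_{m,l}(z;\tau)=\sum_{\lambda\in\mathbb Z,\ \lambda\equiv l\,(2m)} e^{\pi i\lambda^2\tau/2m+2\pi i\lambda z},\qquad f_u(z;\tau)=\sum_{\lambda\in\mathbb Z}\frac{e^{2\pi i m\lambda^2\tau+4\pi i m\lambda z}}{1-e^{2\pi i\lambda\tau+2\pi i(z-u)}},$$ $$R_{m,l}(u;\tau)=\sum_{\lambda\in\mathbb Z,\ \lambda\equiv l\,(2m)}\Bigl\{\operatorname{sgn}\bigl(\lambda+\tfrac12\bigr)-E\bigl((\lambda+2m\operatorname{Im}(u)/y)\sqrt{y/m}\bigr)\Bigr\}e^{-\pi i\lambda^2\tau/2m-2\pi i\lambda u},\qquad E(x)=2\int_0^x e^{-\pi t^2}dt,$$ $$\tilde f_u(z;\tau)=f_u(z;\tau)-\frac12\sum_{l=0}^{2m-1}R_{m,l}(u;\tau)\,\theta_{m,l}(z;\tau).$$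 If $F$ is real-analytic near $u\in\mathbb C$ and $g$ is meromorphic with a pole of order $s\ge1$ at $u$, put $$\operatorname{Res}_{v=u}[F(v)g(v)]=\frac1{(s-1)!}\left.\frac{\partial^{s-1}}{\partial v^{s-1}}\right|_{v=u}\bigl(F(v)(v-u)^s g(v)\bigr),\qquad \frac{\partial}{\partial v}=\frac12\Bigl(\frac{\partial}{\partial \operatorname{Re}v}-i\frac{\partial}{\partial \operatorname{Im}v}\Bigr).$$ Let $\phi$ be a function of $(z,\tau)\in\mathbb C\times\mathbb H$ such that $z\mapsto\phi(z;\tau)$ is meromorphic on $\mathbb C$ for each fixed $\tau$, with set of poles $\operatorname{Sing}\phi(\cdot;\tau)$, and suppose that, as an identity of meromorphic functions of $z$, $$\text{(E)}\qquad \phi(z+\lambda\tau+\mu;\tau)=e^{-2\pi i m(\lambda^2\tau+2\lambda z)}\phi(z;\tau)\qquad(\lambda,\mu\in\mathbb Z,\ \tau\in\mathbb H).$$ **Theorem.** For $p\in\mathbb C$ let $P_p=p+(0,1)\tau+(0,1)$. For each $\tau\in\mathbb H$ there are $p\in\mathbb C$ such that $\phi(\cdot;\tau)$ has no poles on $\partial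 P_p$; for each such $p$ the set $\operatorname{Sing}\phi(\cdot;\tau)\cap P_p$ is finite, $v\mapsto R_{m,l}(v;\tau)$ is real-analytic at each of its points, and for $0\le l\le 2m-1$ the number $$h_l(\tau)=e^{-\pi i l^2\tau/2m}\int_p^{p+1}\phi(z;\tau)e^{-2\pi i l z}\,dz-\pi i\sum_{u\in\operatorname{Sing}\phi(\cdot;\tau)\cap P_p}\operatorname{Res}_{v=u}\bigl[R_{m,l}(v;\tau)\phi(v;\tau)\bigr]$$ (the integral is along the straight segment) does not depend on $p$. Any set of representatives of $\operatorname{Sing}\phi(\cdot;\tau)$ modulo $\Lambda_\tau$ is finite, and for all $\tau\in\mathbb H$ and $z\notin\operatorname{Sing}\phi(\cdot;\tau)$ the function $v\mapsto\tilde f_v(z;\tau)$ is real-analytic at each pole of $\phi(\cdot;\tau)$ and $$\phi(z;\tau)=\sum_{l=0}^{2m-1}h_l(\tau)\,\theta_{m,l}(z;\tau)-2\pi i\sum_{u\in\operatorname{Sing}\phi(\cdot;\tau)\bmod\Lambda_\tau}\operatorname{Res}_{v=u}\bigl[\tilde f_v(z;\tau)\phi(v;\tau)\bigr],$$ where the second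 sum does not depend on the choice of representatives. If moreover, for some $k\in\mathbb Z$, as an identity of meromorphic functions of $z$, $$\text{(M)}\qquad \phi\Bigl(\frac z{c\tau+d};\frac{a\tau+b}{c\tau+d}\Bigr)=(c\tau+d)^k e^{2\pi i m c z^2/(c\tau+d)}\phi(z;\tau)\qquad\Bigl(\begin{pmatrix}a&b\\c&d\end{pmatrix}\in\mathrm{SL}_2(\mathbb Z),\ \tau\in\mathbb H\Bigr),$$ then for $0\le l\le 2m-1$ and $\tau\in\mathbb H$ $$h_l(\tau+1)=e^{-\pi i l^2/2m}h_l(\tau),\qquad h_l\Bigl(-\frac1\tau\Bigr)=\frac{\tau^k}{\sqrt{-i\tau}}\,\frac1{\sqrt{2m}}\sum_{\nu=0}^{2m-1}e^{\pi i l\nu/m}h_\nu(\tau),$$ with the principal branch of the square root. -/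

import Mathlib

open scoped UpperHalfPlane

noncomputable section

namespace MeroJacobi

open Complex Topology Filter

/-- A meromorphic function on `ℂ` in the classical sense: it is holomorphic at every point
that is not a pole. (The value assigned to it at a pole is immaterial.) -/
def IsMeromorphicFun (f : ℂ → ℂ) : Prop :=
  Meromorphic f ∧ ∀ z, ¬ meromorphicOrderAt f z < 0 → AnalyticAt ℂ f z

/-- `Sing φ(·;τ)`, the set of poles of `z ↦ φ(z;τ)`. -/
def Sing (φ : ℂ → ℍ → ℂ) (τ : ℍ) : Set ℂ :=
  {u | meromorphicOrderAt (fun z => φ z τ) u < 0}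

/-- The elliptic law (E) of index `m`, as an identity of meromorphic functions: it is required
wherever neither side is evaluated at a pole. -/
def IsElliptic (m : ℕ) (φ : ℂ → ℍ → ℂ) : Prop :=
  ∀ (τ : ℍ) (l n : ℤ) (z : ℂ), z ∉ Sing φ τ → z + l * τ + n ∉ Sing φ τ →
    φ (z + l * τ + n) τ
      = exp (-2 * Real.pi * I * m * ((l : ℂ) ^ 2 * τ + 2 * l * z)) * φ z τ

/-- The modular law (M) of weight `k` and index `m`, for all of `SL₂(ℤ)`, as an identity of
meromorphic functions: it is required wherever neither side is evaluated at a pole. -/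
def IsModular (k : ℤ) (m : ℕ) (φ : ℂ → ℍ → ℂ) : Prop :=
  ∀ (γ : Matrix.SpecialLinearGroup (Fin 2) ℤ) (τ : ℍ) (z : ℂ),
    let c : ℂ := ((γ 1 0 : ℤ) : ℂ)
    let d : ℂ := ((γ 1 1 : ℤ) : ℂ)
    z ∉ Sing φ τ → z / (c * τ + d) ∉ Sing φ (γ • τ) →
    φ (z / (c * τ + d)) (γ • τ)
      = (c * τ + d) ^ k * exp (2 * Real.pi * I * m * c * z ^ 2 / (c * τ + d)) * φ z τ

/-- The theta function `θ_{m,l}(z;τ) = ∑_{λ ≡ l mod 2m} e^{πiλ²τ/2m + 2πiλz}`. -/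
def theta (m : ℕ) (l : ℤ) (z : ℂ) (τ : ℍ) : ℂ :=
  ∑' r : {r : ℤ // r ≡ l [ZMOD 2 * m]},
    exp (Real.pi * I * ((r : ℤ) : ℂ) ^ 2 * τ / (2 * m) + 2 * Real.pi * I * ((r : ℤ) : ℂ) * z)

/-- The building block
`f_u(z;τ) = ∑_{λ ∈ ℤ} e^{2πimλ²τ + 4πimλz} / (1 - e^{2πiλτ + 2πi(z-u)})`. -/
def f (m : ℕ) (u z : ℂ) (τ : ℍ) : ℂ :=
  ∑' r : ℤ,
    exp (2 * Real.pi * I * m * (r : ℂ) ^ 2 * τ + 4 * Real.pi * I * m * r * z) /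
      (1 - exp (2 * Real.pi * I * r * τ + 2 * Real.pi * I * (z - u)))

/-- `E(x) = 2 ∫₀ˣ e^{-πu²} du` (used at real arguments only). -/
def E (x : ℝ) : ℝ := 2 * ∫ u in (0 : ℝ)..x, Real.exp (-Real.pi * u ^ 2)

/-- `R_{m,l}(u;τ) = ∑_{λ ≡ l mod 2m} {sgn(λ+1/2) - E((λ + 2m Im u / y)√(y/m))}
  e^{-πiλ²τ/2m - 2πiλu}`, with `y = Im τ`. -/
def R (m : ℕ) (l : ℤ) (u : ℂ) (τ : ℍ) : ℂ :=
  ∑' r : {r : ℤ // r ≡ l [ZMOD 2 * m]},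
    ((Real.sign (((r : ℤ) : ℝ) + 1 / 2)
        - E ((((r : ℤ) : ℝ) + 2 * m * u.im / τ.im) * Real.sqrt (τ.im / m)) : ℝ) : ℂ) *
      exp (-Real.pi * I * ((r : ℤ) : ℂ) ^ 2 * τ / (2 * m)
        - 2 * Real.pi * I * ((r : ℤ) : ℂ) * u)

/-- `f̃_u(z;τ) = f_u(z;τ) - (1/2) ∑_{l mod 2m} R_{m,l}(u;τ) θ_{m,l}(z;τ)`. -/
def fTilde (m : ℕ) (u z : ℂ) (τ : ℍ) : ℂ :=
  f m u z τ - 1 / 2 * ∑ l : Fin (2 * m), R m (l : ℕ) u τ * theta m (l : ℕ) z τ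

/-- The Wirtinger derivative `∂F/∂v = (1/2)(∂F/∂x - i ∂F/∂y)`, `v = x + iy`. -/
def wirtinger (F : ℂ → ℂ) (v : ℂ) : ℂ :=
  1 / 2 * (fderiv ℝ F v 1 - I * fderiv ℝ F v I)

/-- The order `s` of the pole of `g` at `u` (`0` if there is no pole). -/
def poleOrder (g : ℂ → ℂ) (u : ℂ) : ℕ := (-(meromorphicOrderAt g u).untop₀).toNat

/-- The holomorphic function `v ↦ (v-u)^s g(v)` near a pole `u` of order `s` of `g`, with the
removable singularity at `u` filled in by the limit. -/
def clearPole (g : ℂ → ℂ) (u : ℂ) : ℂ → ℂ :=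
  Function.update (fun v => (v - u) ^ poleOrder g u * g v) u
    (limUnder (𝓝[≠] u) fun v => (v - u) ^ poleOrder g u * g v)

/-- The residue `Res_{v=u} [F(v) g(v)]` of the product of a real-analytic `F` and a meromorphic
`g` with a pole of order `s` at `u`: it is `(1/(s-1)!) ∂^{s-1}/∂v^{s-1} |_{v=u} (F(v)(v-u)^s g(v))`,
i.e. the coefficient of `(v-u)^{-1}` in the expansion of `F g` in powers of `v - u` and of the
conjugate of `v - u`. It is `0` if `g` has no pole at `u`. -/
def res (F g : ℂ → ℂ) (u : ℂ) : ℂ :=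
  if poleOrder g u = 0 then 0
  else 1 / ((poleOrder g u - 1).factorial : ℂ) *
    wirtinger^[poleOrder g u - 1] (fun v => F v * clearPole g u v) u

/-- The lattice `Λ_τ = ℤτ + ℤ`. -/
def lattice (τ : ℍ) : Set ℂ := {w | ∃ l n : ℤ, w = l * τ + n}

/-- `S` is a system of representatives of `Sing φ(·;τ)` modulo `Λ_τ`. -/
def IsPoleReps (φ : ℂ → ℍ → ℂ) (τ : ℍ) (S : Set ℂ) : Prop :=
  S ⊆ Sing φ τ ∧ ∀ u ∈ Sing φ τ, ∃! w, w ∈ S ∧ u - w ∈ lattice τ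

/-- The open parallelogram `P_p = p + (0,1)τ + (0,1)`. -/
def para (τ : ℍ) (p : ℂ) : Set ℂ :=
  {w | ∃ s ∈ Set.Ioo (0 : ℝ) 1, ∃ t ∈ Set.Ioo (0 : ℝ) 1, w = p + s * τ + t}

/-- There are no poles of `φ(·;τ)` on the boundary of `P_p`. -/
def IsGoodBase (φ : ℂ → ℍ → ℂ) (τ : ℍ) (p : ℂ) : Prop :=
  Disjoint (frontier (para τ p)) (Sing φ τ)

/-- `e^{-πil²τ/2m} ∫_p^{p+1} φ(z;τ) e^{-2πilz} dz
  - πi ∑_{u ∈ Sing φ(·;τ) ∩ P_p} Res_{v=u} [R_{m,l}(v;τ) φ(v;τ)]`,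
the integral being along the straight segment. -/
def coeff (m : ℕ) (φ : ℂ → ℍ → ℂ) (l : ℤ) (τ : ℍ) (p : ℂ) : ℂ :=
  exp (-Real.pi * I * (l : ℂ) ^ 2 * τ / (2 * m)) *
      (∫ t in (0 : ℝ)..1, φ (p + t) τ * exp (-2 * Real.pi * I * l * (p + t)))
    - Real.pi * I * ∑ᶠ u ∈ Sing φ τ ∩ para τ p, res (fun v => R m l v τ) (fun v => φ v τ) u

end MeroJacobi

end

noncomputable section

namespace MeroJacobi

open Complex Topology Filter

/-! The proof is a residue computation in the auxiliary variable `v` of `f_v(z)φ(v)`, where `f_v(z)`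
serves as a Cauchy kernel for functions with the elliptic law. As a function of `v` it has simple
poles on `z + Λ_τ`, with residue `1/(2πi)` at `z` (`tendsto_sub_mul_f`). It has period 1, but under
`v ↦ v + τ` it has the multiplier inverse to that of `φ` only up to a combination of the
`θ_{m,l}(z)` (`f_add_tau`, a geometric sum). When `f_v(z)φ(v)` is integrated around `P_p`, the
slanted sides cancel and the horizontal sides therefore leave theta functions with the Fourier
integrals of `φ` as coefficients (`paraInt_f_mul`). The residue theorem `paraInt_eq_sum_res`
expresses the same integral by `φ(z)` and the residues at the poles of `φ`.

The correction by `R` has the same defect under translation by `τ` (`R_add_tau`), so `f̃_v(z)φ(v)`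
is `Λ_τ`-periodic and its residues depend only on the pole modulo the lattice (`res_fTilde_eq`).
Replacing `f` by `f̃` in the residues moves the `R`-terms into the coefficients and gives the
decomposition (`decomposition_of_base`). Since the `θ_{m,l}` are linearly independent
(`theta_linearIndependent`), the coefficients do not depend on `p` (`coeff_eq_coeff`). The price is
that `f̃` is only real-analytic in `v`, which is why residues are taken with Wirtinger derivatives.
Real-analyticity of `R` comes from a holomorphic extension to two variables (`analyticAt_RC`).

For modularity the main point is `fTilde_S`. The `∂̄`-derivative of `f̃_u(z)` is a Gaussian times
the kernel `∑ conj θ_{m,l}(u) · θ_{m,l}(z)` (`crDefect_fTilde`), and this kernel is modular because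
the finite Fourier matrix in the inversion law of the thetas is unitary (`theta_kernel_S`). Hence
the difference of the two sides of the desired law for `f̃` is holomorphic off `z + Λ_τ`. Its simple
poles cancel, so it extends to an entire function of `u` with the multipliers of a theta function of
negative index, and such a function vanishes (`eq_zero_of_negative_index`). Thus the polar part of
`φ` transforms like `φ`, hence so does the theta part (`sum_thetaCoeff_comp_mul`). Comparing
coefficients with the transformation laws of the thetas gives those of the `h_l`. -/

/-! ### Sums over residue classes. -/

/-- The residue class of `l` modulo `n ≠ 0`, parametrized by `ℤ`. -/
def classEquiv (n : ℕ) (hn : n ≠ 0) (l : ℤ) : ℤ ≃ {r : ℤ // r ≡ l [ZMOD n]} where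
  toFun k := ⟨l + n * k, by simp [Int.ModEq]⟩
  invFun r := (r - l) / n
  left_inv k := by
    have : (n : ℤ) ≠ 0 := by exact_mod_cast hn
    simp only [add_sub_cancel_left]
    exact Int.mul_ediv_cancel_left k this
  right_inv r := by
    ext
    have h : (n : ℤ) ∣ (r : ℤ) - l := r.2.symm.dvd
    simp [Int.mul_ediv_cancel' h]

lemma tsum_class {n : ℕ} (hn : n ≠ 0) (l : ℤ) (g : ℤ → ℂ) :
    ∑' r : {r : ℤ // r ≡ l [ZMOD n]}, g r = ∑' k : ℤ, g (l + n * k) :=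
  ((classEquiv n hn l).tsum_eq (fun r => g r)).symm

lemma tsum_class_add {n : ℕ} (hn : n ≠ 0) (l : ℤ) (g : ℤ → ℂ) :
    ∑' r : {r : ℤ // r ≡ l [ZMOD n]}, g (r + n) = ∑' r : {r : ℤ // r ≡ l [ZMOD n]}, g r := by
  rw [tsum_class hn l (fun r => g (r + n)), tsum_class hn l g,
    ← (Equiv.addRight (1 : ℤ)).tsum_eq (fun k => g (l + n * k))]
  refine tsum_congr fun k => ?_
  simp only [Equiv.coe_addRight]
  congr 1; ring

/-- Summation over `ℤ` by residue classes. -/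
lemma sum_tsum_class {n : ℕ} (hn : n ≠ 0) {g : ℤ → ℂ} (hg : Summable g) :
    ∑ l : Fin n, ∑' r : {r : ℤ // r ≡ ((l : ℕ) : ℤ) [ZMOD n]}, g r = ∑' r : ℤ, g r := by
  have : NeZero n := ⟨hn⟩
  simp_rw [tsum_class hn]
  rw [← (Int.divModEquiv n).symm.tsum_eq g]
  have h2 : Summable fun c => g ((Int.divModEquiv n).symm c) :=
    (Int.divModEquiv n).symm.summable_iff.2 hg
  rw [← (Equiv.prodComm (Fin n) ℤ).tsum_eq (fun c => g ((Int.divModEquiv n).symm c)),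
    ← tsum_fintype (L := .unconditional _), Summable.tsum_prod (f := fun c => g ((Int.divModEquiv n).symm ((Equiv.prodComm _ _) c))) ((Equiv.prodComm _ _).summable_iff.2 h2)]
  refine tsum_congr fun l => tsum_congr fun k => ?_
  simp [Int.divModEquiv]
  congr 1; ring

lemma coe_two_mul_cast (m : ℕ) : ((2 * m : ℕ) : ℤ) = 2 * (m : ℤ) := by push_cast; ring

/-! ### Theta functions: holomorphy and modular transformations. -/

lemma theta_eq_tsum {m : ℕ} (hm : 0 < m) (l : ℤ) (z : ℂ) (τ : ℍ) :
    theta m l z τ = ∑' k : ℤ, exp (Real.pi * I * ((l : ℂ) + 2 * m * k) ^ 2 * τ / (2 * m)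
      + 2 * Real.pi * I * ((l : ℂ) + 2 * m * k) * z) := by
  have := tsum_class (n := 2 * m) (by omega) l (fun r => exp (Real.pi * I * (r : ℂ) ^ 2 * τ / (2 * m)
    + 2 * Real.pi * I * (r : ℂ) * z))
  rw [coe_two_mul_cast] at this
  rw [theta, this]
  simp

/-- Expanding `(l + 2mk)²` leaves a Jacobi theta series in `k` with modulus `2mτ`. Differentiability
in `z` and the inversion law are obtained through this form. -/
lemma theta_eq_jacobiTheta₂ {m : ℕ} (hm : 0 < m) (l : ℤ) (z : ℂ) (τ : ℍ) :
    theta m l z τ = exp (Real.pi * I * (l : ℂ) ^ 2 * τ / (2 * m) + 2 * Real.pi * I * l * z) *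
      jacobiTheta₂ (l * τ + 2 * m * z) (2 * m * τ) := by
  have hm' : (m : ℂ) ≠ 0 := by exact_mod_cast hm.ne'
  rw [theta_eq_tsum hm, jacobiTheta₂, ← tsum_mul_left]
  refine tsum_congr fun k => ?_
  rw [jacobiTheta₂_term, ← exp_add]
  congr 1
  field_simp
  ring

lemma im_two_mul_pos {m : ℕ} (hm : 0 < m) (τ : ℍ) : 0 < (2 * m * (τ : ℂ)).im := by
  have h : (0 : ℝ) < m := by exact_mod_cast hm
  have : (2 * m * (τ : ℂ)).im = 2 * m * τ.im := by simp [Complex.mul_im]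
  rw [this]
  have := τ.im_pos
  positivity

lemma differentiable_theta {m : ℕ} (hm : 0 < m) (l : ℤ) (τ : ℍ) :
    Differentiable ℂ (fun z => theta m l z τ) := by
  simp_rw [theta_eq_jacobiTheta₂ hm]
  intro z
  have h := differentiableAt_jacobiTheta₂_fst (l * τ + 2 * m * z) (im_two_mul_pos hm τ)
  have h2 : DifferentiableAt ℂ (fun z : ℂ => (l * τ + 2 * m * z : ℂ)) z := by fun_prop
  exact DifferentiableAt.mul (by fun_prop) (h.fun_comp' z h2)

/-- The general term of `∑ θ_{m,l}` over all integers. -/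
lemma summable_theta_term {m : ℕ} (hm : 0 < m) (z : ℂ) (τ : ℍ) :
    Summable fun r : ℤ => exp (Real.pi * I * (r : ℂ) ^ 2 * τ / (2 * m) + 2 * Real.pi * I * r * z) := by
  have h0 : (0 : ℝ) < m := by exact_mod_cast hm
  have h : 0 < ((τ : ℂ) / (2 * m)).im := by
    have : ((τ : ℂ) / (2 * m)).im = τ.im / (2 * m) := by
      have := Complex.div_ofReal_im (τ : ℂ) (2 * m)
      push_cast at this
      simpa using this
    rw [this]
    have := τ.im_pos
    positivity
  refine ((summable_jacobiTheta₂_term_iff z _).2 h).congr fun r => ?_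
  rw [jacobiTheta₂_term]
  congr 1
  ring

/-- Squares are constant modulo `4m` on a residue class modulo `2m`, so the factor `e^{πiλ²/2m}`
comes out of the sum. -/
lemma theta_T {m : ℕ} (hm : 0 < m) (l : ℤ) (z : ℂ) (τ τ' : ℍ) (h : (τ' : ℂ) = τ + 1) :
    theta m l z τ' = exp (Real.pi * I * (l : ℂ) ^ 2 / (2 * m)) * theta m l z τ := by
  have hm' : (m : ℂ) ≠ 0 := by exact_mod_cast hm.ne'
  rw [theta_eq_tsum hm, theta_eq_tsum hm, ← tsum_mul_left]
  refine tsum_congr fun k => ?_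
  rw [← exp_add, exp_eq_exp_iff_exists_int, h]
  refine ⟨l * k + m * k ^ 2, ?_⟩
  push_cast
  field_simp
  ring

/-- The functional equation of `jacobiTheta₂` at the point `z - l/2m` with modulus `τ/2m` produces a
sum over all integers. Splitting this sum into classes modulo `2m` turns the shift by `l/2m` into
the characters `e^{-πiln/m}`. -/
lemma theta_S {m : ℕ} (hm : 0 < m) (l : ℤ) (z : ℂ) (τ τ' : ℍ) (h : (τ' : ℂ) = -1 / τ) :
    theta m l (z / τ) τ' = (-I * (τ : ℂ)) ^ (1 / 2 : ℂ) / (Real.sqrt (2 * m) : ℂ) *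
      exp (2 * Real.pi * I * m * z ^ 2 / τ) *
      ∑ n : Fin (2 * m), exp (-Real.pi * I * l * ((n : ℕ) : ℂ) / m) * theta m (n : ℕ) z τ := by
  have hm' : (m : ℂ) ≠ 0 := by exact_mod_cast hm.ne'
  have hτ : (τ : ℂ) ≠ 0 := τ.ne_zero
  have hmR : (0 : ℝ) < 2 * m := by have : (0:ℝ) < m := by exact_mod_cast hm
                                   positivity
  rw [theta_eq_jacobiTheta₂ hm, h]
  have key := jacobiTheta₂_functional_equation (z - l / (2 * m)) (τ / (2 * m))
  have e1 : (z - l / (2 * m)) / ((τ : ℂ) / (2 * m)) = l * (-1 / τ) + 2 * m * (z / τ) := by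
    field_simp; ring
  have e2 : (-1 : ℂ) / ((τ : ℂ) / (2 * m)) = 2 * m * (-1 / τ) := by field_simp
  rw [e1, e2] at key
  have hne : (-I * ((τ : ℂ) / (2 * m))) ^ (1 / 2 : ℂ) ≠ 0 := by
    rw [Ne, cpow_eq_zero_iff]
    simp [hτ, hm']
  have key2 : jacobiTheta₂ (l * (-1 / τ) + 2 * m * (z / τ)) (2 * m * (-1 / τ)) =
      (-I * ((τ : ℂ) / (2 * m))) ^ (1 / 2 : ℂ) *
        exp (Real.pi * I * (z - l / (2 * m)) ^ 2 / (τ / (2 * m))) *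
        jacobiTheta₂ (z - l / (2 * m)) (τ / (2 * m)) := by
    rw [key]
    have : exp (Real.pi * I * (z - l / (2 * m)) ^ 2 / (τ / (2 * m))) *
        exp (-Real.pi * I * (z - l / (2 * m)) ^ 2 / (τ / (2 * m))) = 1 := by
      rw [← exp_add, ← exp_zero]; congr 1; ring
    generalize jacobiTheta₂ (l * (-1 / τ) + 2 * m * (z / τ)) (2 * m * (-1 / τ)) = B
    generalize (-I * ((τ : ℂ) / (2 * m))) ^ (1 / 2 : ℂ) = c at hne ⊢
    generalize exp (Real.pi * I * (z - l / (2 * m)) ^ 2 / (τ / (2 * m))) = e at this ⊢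
    generalize exp (-Real.pi * I * (z - l / (2 * m)) ^ 2 / (τ / (2 * m))) = e2 at this ⊢
    field_simp
    linear_combination (-B) * this
  -- A positive real factor can be taken out of the principal square root, since the logarithm is
  -- additive for it.
  have e3 : (-I * ((τ : ℂ) / (2 * m))) ^ (1 / 2 : ℂ)
      = (-I * (τ : ℂ)) ^ (1 / 2 : ℂ) / (Real.sqrt (2 * m) : ℂ) := by
    have : -I * ((τ : ℂ) / (2 * m)) = ((2 * m : ℝ)⁻¹ : ℝ) * (-I * τ) := by
      push_cast; field_simp
    rw [this, cpow_def_of_ne_zero (by simp [hτ, hm']), log_ofReal_mul (by positivity) (by simp [hτ]),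
      cpow_def_of_ne_zero (by simp [hτ]), add_mul, exp_add, mul_comm, div_eq_mul_inv]
    congr 1
    rw [← ofReal_inv, ← Real.sqrt_inv, Real.sqrt_eq_rpow, ofReal_cpow (by positivity),
      cpow_def_of_ne_zero (by simp [hm']), ofReal_log (by positivity)]
    norm_num
  rw [key2, e3]
  have e4 : ∑ n : Fin (2 * m), exp (-Real.pi * I * l * ((n : ℕ) : ℂ) / m) * theta m (n : ℕ) z τ
      = jacobiTheta₂ (z - l / (2 * m)) (τ / (2 * m)) := by
    have hs := summable_theta_term hm (z - l / (2 * m)) τ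
    have := sum_tsum_class (n := 2 * m) (by omega) hs
    rw [jacobiTheta₂]
    have e5 : ∑' n : ℤ, jacobiTheta₂_term n (z - l / (2 * m)) (τ / (2 * m)) = _ :=
      (tsum_congr fun r => by rw [jacobiTheta₂_term]; congr 1; ring).trans this.symm
    rw [e5]
    refine Finset.sum_congr rfl fun n _ => ?_
    rw [tsum_class (n := 2 * m) (by omega) ((n : ℕ) : ℤ) (fun r => exp (Real.pi * I * (r : ℂ) ^ 2 * τ / (2 * m) +
      2 * Real.pi * I * r * (z - l / (2 * m)))), theta_eq_tsum hm, ← tsum_mul_left]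
    refine tsum_congr fun k => ?_
    rw [← exp_add, exp_eq_exp_iff_exists_int]
    refine ⟨l * k, ?_⟩
    push_cast
    field_simp
    ring
  rw [e4]
  have e6 : exp (Real.pi * I * (l : ℂ) ^ 2 * (-1 / τ) / (2 * m) + 2 * Real.pi * I * l * (z / τ)) *
      exp (Real.pi * I * (z - l / (2 * m)) ^ 2 / (τ / (2 * m)))
      = exp (2 * Real.pi * I * m * z ^ 2 / τ) := by
    rw [← exp_add]; congr 1; field_simp; ring
  rw [← e6]; ring

/-- Orthogonality of the characters of `ℤ/2m`: for `a ≠ b` this is a geometric sum with ratio a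
nontrivial `2m`-th root of unity. -/
lemma sum_exp_root {m : ℕ} (hm : 0 < m) (a b : Fin (2 * m)) :
    ∑ l : Fin (2 * m), exp (Real.pi * I * ((l : ℕ) : ℂ) * ((a : ℕ) : ℂ) / m) *
      exp (-Real.pi * I * ((l : ℕ) : ℂ) * ((b : ℕ) : ℂ) / m) = if a = b then 2 * (m : ℂ) else 0 := by
  have hm' : (m : ℂ) ≠ 0 := by exact_mod_cast hm.ne'
  split_ifs with h
  · subst h
    rw [Finset.sum_congr rfl (g := fun _ => (1 : ℂ))]
    · simp
    · intro l _
      rw [← exp_add, ← exp_zero]; congr 1; ring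
  · set ω := exp (Real.pi * I * (((a : ℕ) : ℂ) - ((b : ℕ) : ℂ)) / m) with hω
    have h1 : ω ^ (2 * m) = 1 := by
      rw [hω, ← exp_nat_mul, exp_eq_one_iff]
      refine ⟨(a : ℕ) - (b : ℕ), ?_⟩
      push_cast
      field_simp
    have h2 : ω ≠ 1 := by
      rw [hω, Ne, exp_eq_one_iff]
      rintro ⟨n, hn⟩
      have hpi : (Real.pi : ℂ) ≠ 0 := by exact_mod_cast Real.pi_ne_zero
      have h3 : ((a : ℕ) : ℂ) - ((b : ℕ) : ℂ) = n * (2 * m) := by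
        field_simp at hn
        have : (Real.pi * I : ℂ) ≠ 0 := mul_ne_zero hpi I_ne_zero
        linear_combination hn
      have h4 : ((a : ℕ) : ℤ) - ((b : ℕ) : ℤ) = n * (2 * m) := by exact_mod_cast h3
      have ha := a.2
      have hb := b.2
      have h5 : ¬ ((a : ℕ) = (b : ℕ)) := fun h' => h (Fin.ext h')
      have h6 : n = 0 := by
        by_contra hn0
        rcases lt_or_gt_of_ne hn0 with h7 | h7
        · nlinarith
        · nlinarith
      subst h6
      omega
    have h3 := geom_sum_eq h2 (2 * m)
    rw [h1, sub_self, zero_div] at h3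
    rw [← h3, ← Fin.sum_univ_eq_sum_range (fun i => ω ^ i)]
    refine Finset.sum_congr rfl fun l _ => ?_
    rw [hω, ← exp_nat_mul, ← exp_add]
    congr 1; ring

open ComplexConjugate in
-- The matrix `e^{-πiln/m}/√(2m)` of the inversion law is unitary, so the sesquilinear kernel is
-- reproduced up to the absolute square of the automorphy factor `√(-iτ)`, which is `|τ|`, and the
-- two exponentials.
lemma theta_kernel_S {m : ℕ} (hm : 0 < m) (u z : ℂ) (τ τ' : ℍ) (h : (τ' : ℂ) = -1 / τ) :
    ∑ l : Fin (2 * m), conj (theta m (l : ℕ) (u / τ) τ') * theta m (l : ℕ) (z / τ) τ' =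
      (‖(τ : ℂ)‖ : ℂ) * conj (exp (2 * Real.pi * I * m * u ^ 2 / τ)) *
        exp (2 * Real.pi * I * m * z ^ 2 / τ) *
        ∑ l : Fin (2 * m), conj (theta m (l : ℕ) u τ) * theta m (l : ℕ) z τ := by
  have hm' : (m : ℂ) ≠ 0 := by exact_mod_cast hm.ne'
  have hmR : (0 : ℝ) < m := by exact_mod_cast hm
  set C : ℂ := (-I * (τ : ℂ)) ^ (1 / 2 : ℂ) / (Real.sqrt (2 * m) : ℂ) with hC
  have hCC : conj C * C * (2 * m) = (‖(τ : ℂ)‖ : ℂ) := by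
    have h1 : ‖C‖ ^ 2 * (2 * m) = ‖(τ : ℂ)‖ := by
      have : ‖(-I * (τ : ℂ)) ^ (1 / 2 : ℂ)‖ = ‖(τ : ℂ)‖ ^ (1 / 2 : ℝ) := by
        have := Complex.norm_cpow_real (-I * (τ : ℂ)) (1 / 2)
        push_cast at this
        rw [this]; simp
      rw [hC, norm_div, div_pow, this, ← Real.sqrt_eq_rpow, Real.sq_sqrt (norm_nonneg _), norm_real,
        Real.norm_eq_abs, sq_abs, Real.sq_sqrt (by positivity)]
      field_simp
    rw [← h1, mul_comm (conj C), mul_conj, normSq_eq_norm_sq]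
    push_cast; ring
  simp_rw [theta_S hm _ _ τ τ' h, ← hC]
  have hconj : ∀ l a : Fin (2 * m), conj (exp (-Real.pi * I * (((l : ℕ) : ℤ) : ℂ) * ((a : ℕ) : ℂ) / m))
      = exp (Real.pi * I * ((l : ℕ) : ℂ) * ((a : ℕ) : ℂ) / m) := by
    intro l a
    rw [← exp_conj]; congr 1
    simp
  simp only [map_mul, map_sum, hconj]
  calc _ = conj C * C * conj (exp (2 * Real.pi * I * m * u ^ 2 / τ)) *
        exp (2 * Real.pi * I * m * z ^ 2 / τ) * ∑ l : Fin (2 * m), ∑ a : Fin (2 * m), ∑ b : Fin (2 * m),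
          (exp (Real.pi * I * ((l : ℕ) : ℂ) * ((a : ℕ) : ℂ) / m) *
            exp (-Real.pi * I * ((l : ℕ) : ℂ) * ((b : ℕ) : ℂ) / m)) *
            (conj (theta m (a : ℕ) u τ) * theta m (b : ℕ) z τ) := by
        rw [Finset.mul_sum]
        refine Finset.sum_congr rfl fun l _ => ?_
        have := Finset.sum_mul_sum Finset.univ Finset.univ
          (fun a : Fin (2 * m) => exp (Real.pi * I * ((l : ℕ) : ℂ) * ((a : ℕ) : ℂ) / m) *
            conj (theta m (a : ℕ) u τ))
          (fun b : Fin (2 * m) => exp (-Real.pi * I * ((l : ℕ) : ℂ) * ((b : ℕ) : ℂ) / m) *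
            theta m (b : ℕ) z τ)
        have e : ∑ a : Fin (2 * m), ∑ b : Fin (2 * m),
          (exp (Real.pi * I * ((l : ℕ) : ℂ) * ((a : ℕ) : ℂ) / m) *
            exp (-Real.pi * I * ((l : ℕ) : ℂ) * ((b : ℕ) : ℂ) / m)) *
            (conj (theta m (a : ℕ) u τ) * theta m (b : ℕ) z τ) = _ :=
          (Finset.sum_congr rfl fun a _ => Finset.sum_congr rfl fun b _ => by ring).trans this.symm
        rw [e]
        push_cast
        ring
    _ = conj C * C * conj (exp (2 * Real.pi * I * m * u ^ 2 / τ)) *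
        exp (2 * Real.pi * I * m * z ^ 2 / τ) * ∑ a : Fin (2 * m), ∑ b : Fin (2 * m),
          (if a = b then 2 * (m : ℂ) else 0) *
            (conj (theta m (a : ℕ) u τ) * theta m (b : ℕ) z τ) := by
        rw [Finset.sum_comm]
        congr 1
        refine Finset.sum_congr rfl fun a _ => ?_
        rw [Finset.sum_comm]
        refine Finset.sum_congr rfl fun b _ => ?_
        rw [← Finset.sum_mul, sum_exp_root hm]
    _ = _ := by
        rw [← hCC]
        simp only [ite_mul, zero_mul, Finset.sum_ite_eq, Finset.mem_univ, if_true]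
        rw [← Finset.mul_sum]
        ring

/-! ### Linear independence of the theta functions. -/

/-- Uniqueness of the coefficients of an absolutely convergent Fourier series. -/
lemma fourier_coeff_eq_zero {a : ℤ → ℂ} (ha : Summable fun r => ‖a r‖)
    (h : ∀ x : ℝ, ∑' r : ℤ, a r * exp (2 * Real.pi * I * r * x) = 0) (n : ℤ) : a n = 0 := by
  -- The series is twisted by the inverse of the `n`-th character, so that integration over a period
  -- keeps the `n`-th coefficient only.
  let F : ℤ → C(ℝ, ℂ) := fun r => ⟨fun x => a r * exp (2 * Real.pi * I * (r - n) * x), by fun_prop⟩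
  have hnorm : ∀ (r : ℤ) (x : ℝ), ‖F r x‖ = ‖a r‖ := by
    intro r x
    have : (2 * Real.pi * I * (r - n) * x : ℂ) = ((2 * Real.pi * (r - n) * x : ℝ) : ℂ) * I := by
      push_cast; ring
    simp only [F, ContinuousMap.coe_mk, norm_mul]
    rw [this, norm_exp_ofReal_mul_I, mul_one]
  have hs : Summable fun r => ‖(F r).restrict (⟨Set.uIcc 0 1, isCompact_uIcc⟩ : TopologicalSpace.Compacts ℝ)‖ := by
    refine Summable.of_nonneg_of_le (fun _ => norm_nonneg _) (fun r => ?_) ha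
    rw [ContinuousMap.norm_le _ (norm_nonneg _)]
    intro x
    exact (hnorm r x).le
  have := intervalIntegral.hasSum_intervalIntegral_of_summable_norm (a := 0) (b := 1) (f := F) hs
  have hz : ∀ x : ℝ, ∑' r, F r x = 0 := by
    intro x
    have := h x
    have e : ∑' r, F r x = (∑' r : ℤ, a r * exp (2 * Real.pi * I * r * x)) * exp (-(2 * Real.pi * I * n * x)) := by
      rw [← tsum_mul_right]
      refine tsum_congr fun r => ?_
      simp only [F, ContinuousMap.coe_mk]
      rw [mul_assoc (a r) _ (exp (-_)), ← exp_add]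
      congr 2; ring
    rw [e, this, zero_mul]
  simp_rw [hz] at this
  simp only [intervalIntegral.integral_zero] at this
  have hint : ∀ r : ℤ, ∫ x in (0 : ℝ)..1, F r x = if r = n then a n else 0 := by
    intro r
    simp only [F, ContinuousMap.coe_mk]
    split_ifs with hr
    · subst hr
      simp
    · have hc : (2 * Real.pi * I * (r - n) : ℂ) ≠ 0 := by
        have : (r : ℂ) - n ≠ 0 := sub_ne_zero.2 (by exact_mod_cast hr)
        simp [Real.pi_ne_zero, this]
      rw [intervalIntegral.integral_const_mul, integral_exp_mul_complex hc]
      have : exp (2 * Real.pi * I * (r - n) * (1 : ℝ)) = 1 := by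
        rw [exp_eq_one_iff]; exact ⟨r - n, by push_cast; ring⟩
      rw [this]; simp
  simp_rw [hint] at this
  have h2 := hasSum_ite_eq n (a n)
  exact (this.unique (by simpa using h2)).symm

/-- The Fourier expansions of the `θ_{m,l}` in `x` are supported on disjoint residue classes, and
the Fourier coefficient of the combination at `l` is `c l` times an exponential. -/
lemma theta_linearIndependent {m : ℕ} (hm : 0 < m) (τ : ℍ) (c : Fin (2 * m) → ℂ)
    (h : ∀ x : ℝ, ∑ l : Fin (2 * m), c l * theta m (l : ℕ) x τ = 0) : c = 0 := by
  have hn : 2 * m ≠ 0 := by omega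
  have : NeZero (2 * m) := ⟨hn⟩
  let cz : ℤ → ℂ := fun r => c (Int.divModEquiv (2 * m) r).2
  have hcz : ∀ (l : Fin (2 * m)) (k : ℤ), cz (((l : ℕ) : ℤ) + (2 * m : ℕ) * k) = c l := by
    intro l k
    have : (((l : ℕ) : ℤ) + (2 * m : ℕ) * k) = (Int.divModEquiv (2 * m)).symm (k, l) := by
      simp [Int.divModEquiv]; ring
    simp only [cz]
    rw [this, Equiv.apply_symm_apply]
  obtain ⟨B, hB⟩ := (Set.finite_range c).isBounded.exists_norm_le
  have hcB : ∀ r, ‖cz r‖ ≤ B := fun r => hB _ ⟨_, rfl⟩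
  let a : ℤ → ℂ := fun r => cz r * exp (Real.pi * I * (r : ℂ) ^ 2 * τ / (2 * m))
  have hsa : Summable fun r => ‖a r‖ := by
    have := (summable_theta_term hm 0 τ).norm.mul_left B
    refine Summable.of_nonneg_of_le (fun _ => norm_nonneg _) (fun r => ?_) this
    simp only [a, norm_mul, mul_zero, add_zero]
    exact mul_le_mul_of_nonneg_right (hcB r) (norm_nonneg _)
  have hz : ∀ x : ℝ, ∑' r : ℤ, a r * exp (2 * Real.pi * I * r * x) = 0 := by
    intro x
    have hs : Summable fun r : ℤ => a r * exp (2 * Real.pi * I * r * x) := by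
      refine Summable.of_norm (hsa.congr fun r => ?_)
      have : (2 * Real.pi * I * r * x : ℂ) = ((2 * Real.pi * r * x : ℝ) : ℂ) * I := by
        push_cast; ring
      rw [this, norm_mul _ (exp (_ * I)), norm_exp_ofReal_mul_I, mul_one]
    rw [← sum_tsum_class hn hs, ← h x]
    refine Finset.sum_congr rfl fun l _ => ?_
    rw [tsum_class hn _ (fun r : ℤ => a r * exp (2 * Real.pi * I * r * x)), theta_eq_tsum hm, ← tsum_mul_left]
    refine tsum_congr fun k => ?_
    simp only [a, hcz]
    rw [mul_assoc, ← exp_add]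
    push_cast
    ring_nf
  funext l
  have h1 := fourier_coeff_eq_zero hsa hz ((l : ℕ) : ℤ)
  have h2 := hcz l 0
  simp only [mul_zero, add_zero] at h2
  simpa [a, h2, exp_ne_zero] using h1

/-! ### Separately holomorphic functions of two variables. -/

/-- Integration over the torus against a continuous density, as a continuous functional. -/
def torusFunctional (k : ℝ × ℝ → ℂ) (hk : Continuous k) : C(Circle × Circle, ℂ) →L[ℂ] ℂ :=
  LinearMap.mkContinuousOfExistsBound
    { toFun := fun g => ∫ s in (0 : ℝ)..2 * Real.pi, ∫ t in (0 : ℝ)..2 * Real.pi,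
        g (Circle.exp s, Circle.exp t) * k (s, t)
      map_add' := by
        intro g g'
        rw [← intervalIntegral.integral_add]
        · refine intervalIntegral.integral_congr fun s _ => ?_
          rw [← intervalIntegral.integral_add]
          · refine intervalIntegral.integral_congr fun t _ => ?_
            simp [add_mul]
          · exact Continuous.intervalIntegrable (by fun_prop) _ _
          · exact Continuous.intervalIntegrable (by fun_prop) _ _
        · exact Continuous.intervalIntegrable
            (intervalIntegral.continuous_parametric_intervalIntegral_of_continuous' (by fun_prop) _ _) _ _
        · exact Continuous.intervalIntegrable
            (intervalIntegral.continuous_parametric_intervalIntegral_of_continuous' (by fun_prop) _ _) _ _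
      map_smul' := by
        intro c g
        simp [mul_assoc, intervalIntegral.integral_const_mul] }
    (by
      obtain ⟨B, hB⟩ := (((isCompact_Icc (a := (0 : ℝ)) (b := 2 * Real.pi)).prod
        (isCompact_Icc (a := (0 : ℝ)) (b := 2 * Real.pi))).image hk).isBounded.exists_norm_le
      refine ⟨B * |2 * Real.pi - 0| * |2 * Real.pi - 0|, fun g => ?_⟩
      have h0 : (0 : ℝ) ≤ 2 * Real.pi := by positivity
      have h1 : ∀ s ∈ Set.uIoc 0 (2 * Real.pi), ‖∫ t in (0 : ℝ)..2 * Real.pi,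
        g (Circle.exp s, Circle.exp t) * k (s, t)‖ ≤ ‖g‖ * B * |2 * Real.pi - 0| := by
        intro s hs
        refine intervalIntegral.norm_integral_le_of_norm_le_const fun t ht => ?_
        rw [norm_mul]
        rw [Set.uIoc_of_le h0] at hs ht
        exact mul_le_mul (g.norm_coe_le_norm _)
          (hB _ ⟨(s, t), ⟨⟨hs.1.le, hs.2⟩, ⟨ht.1.le, ht.2⟩⟩, rfl⟩) (norm_nonneg _) (norm_nonneg _)
      refine (intervalIntegral.norm_integral_le_of_norm_le_const h1).trans_eq ?_
      ring)

lemma torusFunctional_apply (k : ℝ × ℝ → ℂ) (hk : Continuous k) (g : C(Circle × Circle, ℂ)) :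
    torusFunctional k hk g = ∫ s in (0 : ℝ)..2 * Real.pi, ∫ t in (0 : ℝ)..2 * Real.pi,
        g (Circle.exp s, Circle.exp t) * k (s, t) := rfl

/-- Osgood's lemma on a bidisc. -/
lemma analyticAt_of_separately_differentiable {F : ℂ × ℂ → ℂ} {c : ℂ × ℂ} {ρ : ℝ} (hρ : 0 < ρ)
    (hc : ContinuousOn F (Metric.closedBall c.1 ρ ×ˢ Metric.closedBall c.2 ρ))
    (h1 : ∀ w ∈ Metric.closedBall c.2 ρ,
      DifferentiableOn ℂ (fun v => F (v, w)) (Metric.closedBall c.1 ρ))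
    (h2 : ∀ v ∈ Metric.closedBall c.1 ρ,
      DifferentiableOn ℂ (fun w => F (v, w)) (Metric.closedBall c.2 ρ)) :
    AnalyticAt ℂ F c := by
  have hmem : ∀ (a : ℂ) (s : ℝ), circleMap a ρ s ∈ Metric.closedBall a ρ := fun a s =>
    circleMap_mem_closedBall a hρ.le s
  let k : ℝ × ℝ → ℂ := fun p => deriv (circleMap c.1 ρ) p.1 * deriv (circleMap c.2 ρ) p.2 *
    F (circleMap c.1 ρ p.1, circleMap c.2 ρ p.2)
  have hk : Continuous k := by
    have : Continuous fun p : ℝ × ℝ => F (circleMap c.1 ρ p.1, circleMap c.2 ρ p.2) :=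
      hc.comp_continuous (by fun_prop) fun p => ⟨hmem _ _, hmem _ _⟩
    simp only [k, deriv_circleMap]
    have h0 := continuous_circleMap 0 ρ
    exact (((h0.comp continuous_fst).mul continuous_const).mul
      ((h0.comp continuous_snd).mul continuous_const)).mul this
  let Z : C(Circle × Circle, ℂ) := ⟨fun p => c.1 + ρ * p.1, by fun_prop⟩
  let W : C(Circle × Circle, ℂ) := ⟨fun p => c.2 + ρ * p.2, by fun_prop⟩
  -- The denominator of the double Cauchy integral is regarded as an element of the Banach algebra
  -- of continuous functions on the torus. It depends analytically on `p`, inversion is analytic at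
  -- units, and integration against `F` is a continuous functional, so no power series has to be
  -- summed by hand.
  let Φ : ℂ × ℂ → C(Circle × Circle, ℂ) := fun p => (Z - p.1 • 1) * (W - p.2 • 1)
  have hΦ : AnalyticAt ℂ Φ c := by
    have e1 : AnalyticAt ℂ (fun p : ℂ × ℂ => Z - p.1 • (1 : C(Circle × Circle, ℂ))) c :=
      analyticAt_const.sub (analyticAt_fst.smul analyticAt_const)
    have e2 : AnalyticAt ℂ (fun p : ℂ × ℂ => W - p.2 • (1 : C(Circle × Circle, ℂ))) c :=
      analyticAt_const.sub (analyticAt_snd.smul analyticAt_const)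
    exact e1.mul e2
  let Ψ : ℂ × ℂ → C(Circle × Circle, ℂ) := fun p => Ring.inverse (Φ p)
  have key : ∀ p : ℂ × ℂ, p ∈ Metric.ball c.1 ρ ×ˢ Metric.ball c.2 ρ →
      ∀ a b : Circle, Φ p (a, b) ≠ 0 := by
    rintro p ⟨hp1, hp2⟩ a b
    have e : ∀ (x y : ℂ) (a : Circle), x ∈ Metric.ball y ρ → y + ρ * a - x ≠ 0 := by
      intro x y a hx h0
      rw [Metric.mem_ball, dist_eq_norm] at hx
      have : x - y = ρ * a := by linear_combination -h0
      rw [this, norm_mul, Circle.norm_coe, mul_one, norm_real, Real.norm_of_nonneg hρ.le] at hx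
      exact lt_irrefl _ hx
    simp only [Φ, Z, W, ContinuousMap.mul_apply, ContinuousMap.sub_apply, ContinuousMap.coe_mk,
      ContinuousMap.smul_apply, ContinuousMap.one_apply, smul_eq_mul, mul_one]
    exact mul_ne_zero (e _ _ _ hp1) (e _ _ _ hp2)
  have hunit : ∀ p : ℂ × ℂ, p ∈ Metric.ball c.1 ρ ×ˢ Metric.ball c.2 ρ → IsUnit (Φ p) := by
    intro p hp
    rw [ContinuousMap.isUnit_iff_forall_ne_zero]
    exact fun x => key p hp x.1 x.2
  have hval : ∀ p : ℂ × ℂ, p ∈ Metric.ball c.1 ρ ×ˢ Metric.ball c.2 ρ →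
      ∀ a b : Circle, Ψ p (a, b) = (Φ p (a, b))⁻¹ := by
    intro p hp a b
    have := Ring.mul_inverse_cancel _ (hunit p hp)
    have := congrArg (fun g : C(Circle × Circle, ℂ) => g (a, b)) this
    simp only [ContinuousMap.mul_apply, ContinuousMap.one_apply] at this
    exact eq_inv_of_mul_eq_one_right this
  have hcm : c ∈ Metric.ball c.1 ρ ×ˢ Metric.ball c.2 ρ :=
    ⟨Metric.mem_ball_self hρ, Metric.mem_ball_self hρ⟩
  have hΨ : AnalyticAt ℂ Ψ c := by
    obtain ⟨U, hU⟩ := hunit c hcm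
    have := analyticAt_inverse (𝕜 := ℂ) U
    rw [hU] at this
    exact this.comp hΦ
  have hL : AnalyticAt ℂ (fun p => (2 * Real.pi * I)⁻¹ * (2 * Real.pi * I)⁻¹ *
      torusFunctional k hk (Ψ p)) c :=
    analyticAt_const.mul (((torusFunctional k hk).analyticAt _).comp hΨ)
  refine hL.congr ?_
  have hnhds : Metric.ball c.1 ρ ×ˢ Metric.ball c.2 ρ ∈ 𝓝 c :=
    prod_mem_nhds (Metric.ball_mem_nhds _ hρ) (Metric.ball_mem_nhds _ hρ)
  filter_upwards [hnhds] with p hp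
  have hd : ∀ (g : ℂ → ℂ) (a w : ℂ), DifferentiableOn ℂ g (Metric.closedBall a ρ) →
      w ∈ Metric.ball a ρ → g w = (2 * Real.pi * I)⁻¹ * ∮ ζ in C(a, ρ), (ζ - w)⁻¹ * g ζ := by
    intro g a w hg hw
    have h3 := DiffContOnCl.circleIntegral_sub_inv_smul
      (DifferentiableOn.diffContOnCl (f := g) (s := Metric.ball a ρ) (𝕜 := ℂ)
        (by rwa [closure_ball a hρ.ne'])) hw
    simp only [smul_eq_mul] at h3
    rw [h3]
    have : (2 * Real.pi * I : ℂ) ≠ 0 := by simp [Real.pi_ne_zero]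
    field_simp
  have hpF : F p = (2 * Real.pi * I)⁻¹ * ∮ ζ in C(c.1, ρ), (ζ - p.1)⁻¹ *
      ((2 * Real.pi * I)⁻¹ * ∮ ξ in C(c.2, ρ), (ξ - p.2)⁻¹ * F (ζ, ξ)) := by
    refine (hd _ c.1 p.1 (h1 p.2 (Metric.ball_subset_closedBall hp.2)) hp.1).trans ?_
    congr 1
    refine circleIntegral.integral_congr hρ.le fun ζ hζ => ?_
    congr 1
    exact hd (fun w => F (ζ, w)) c.2 p.2 (h2 ζ (Metric.sphere_subset_closedBall hζ)) hp.2
  rw [hpF, torusFunctional_apply, mul_assoc, circleIntegral, ← intervalIntegral.integral_const_mul]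
  congr 1
  refine intervalIntegral.integral_congr fun s _ => ?_
  simp only [circleIntegral, smul_eq_mul]
  rw [← intervalIntegral.integral_const_mul, ← intervalIntegral.integral_const_mul,
    ← intervalIntegral.integral_const_mul, ← intervalIntegral.integral_const_mul]
  refine intervalIntegral.integral_congr fun t _ => ?_
  simp only [hval p hp]
  have e : Φ p (Circle.exp s, Circle.exp t) = (circleMap c.1 ρ s - p.1) * (circleMap c.2 ρ t - p.2) := by
    simp [Φ, Z, W, circleMap, Circle.coe_exp]
  rw [e, mul_inv (_ - _)]
  simp only [k]
  ring

/-! ### The error function and its entire continuation. -/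

lemma exists_entire_E : ∃ P : ℂ → ℂ, (∀ w, HasDerivAt P (2 * exp (-Real.pi * w ^ 2)) w) ∧
    ∀ x : ℝ, P x = E x := by
  have hd : Differentiable ℂ fun w : ℂ => 2 * exp (-Real.pi * w ^ 2) := by fun_prop
  obtain ⟨P, hP⟩ := hd.isExactOn_univ
  have hP' : ∀ w, HasDerivAt P (2 * exp (-Real.pi * w ^ 2)) w := fun w => hP w trivial
  refine ⟨fun w => P w - P 0, fun w => (hP' w).sub_const _, fun x => ?_⟩
  have h1 : ∀ t ∈ Set.uIcc 0 x, HasDerivAt (fun t : ℝ => P t)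
      (((2 * Real.exp (-Real.pi * t ^ 2) : ℝ)) : ℂ) t := by
    intro t _
    have := (hP' t).comp_ofReal
    push_cast
    exact this
  have h2 := intervalIntegral.integral_eq_sub_of_hasDerivAt h1
    (Continuous.intervalIntegrable (by fun_prop) _ _)
  rw [E, ← intervalIntegral.integral_const_mul, ← intervalIntegral.integral_ofReal, h2]
  simp

/-- The entire continuation of `E`. -/
def EC : ℂ → ℂ := exists_entire_E.choose

lemma hasDerivAt_EC (w : ℂ) : HasDerivAt EC (2 * exp (-Real.pi * w ^ 2)) w :=
  exists_entire_E.choose_spec.1 w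

lemma EC_ofReal (x : ℝ) : EC x = E x := exists_entire_E.choose_spec.2 x

/-- Mean value inequality on the vertical segment from `x` to `x + iη`, where `|e^{-πw²}| ≤ e^{πη²}
e^{-πx²}`. -/
lemma norm_EC_sub_le (x η : ℝ) :
    ‖EC (x + η * I) - E x‖ ≤ 2 * Real.exp (Real.pi * η ^ 2) * |η| * Real.exp (-Real.pi * x ^ 2) := by
  have h1 : ∀ t ∈ Set.uIcc 0 η, HasDerivWithinAt (fun t : ℝ => EC (x + t * I))
      (2 * exp (-Real.pi * (x + t * I) ^ 2) * I) (Set.uIcc 0 η) t := by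
    intro t _
    have h3 : HasDerivAt (fun t : ℂ => x + t * I) I (t : ℂ) := by
      simpa using ((hasDerivAt_id (t : ℂ)).mul_const I).const_add (x : ℂ)
    exact ((HasDerivAt.comp (t : ℂ) (hasDerivAt_EC _) h3).comp_ofReal).hasDerivWithinAt
  have h2 : ∀ t ∈ Set.uIcc 0 η, ‖2 * exp (-Real.pi * (x + t * I) ^ 2) * I‖ ≤
      2 * Real.exp (Real.pi * η ^ 2) * Real.exp (-Real.pi * x ^ 2) := by
    intro t ht
    have e : (-Real.pi * (x + t * I) ^ 2 : ℂ).re = Real.pi * t ^ 2 + -Real.pi * x ^ 2 := by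
      simp [pow_two]
      ring
    have ht2 : t ^ 2 ≤ η ^ 2 := by
      rw [sq_le_sq]
      have := Set.abs_sub_left_of_mem_uIcc ht
      simpa using this
    rw [norm_mul, norm_mul, norm_I, mul_one, norm_exp, e, Real.exp_add, ← mul_assoc]
    simp only [Complex.norm_ofNat]
    have := Real.pi_pos
    gcongr
  have := Convex.norm_image_sub_le_of_norm_hasDerivWithin_le h1 h2 (convex_uIcc 0 η)
    Set.left_mem_uIcc Set.right_mem_uIcc
  simp only [ofReal_zero, zero_mul, add_zero, EC_ofReal, sub_zero, Real.norm_eq_abs] at this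
  refine this.trans_eq ?_
  ring

lemma E_neg (x : ℝ) : E (-x) = -E x := by
  have := intervalIntegral.integral_comp_neg (a := 0) (b := x) (fun u => Real.exp (-Real.pi * u ^ 2))
  simp only [even_two, Even.neg_pow, neg_zero] at this
  rw [E, E, this, intervalIntegral.integral_symm]
  ring

/-- The difference is twice the Gaussian integral over `(x, ∞)`. After translation to `(0, ∞)` the
bound follows from `(x + u)² ≥ x² + u²`. -/
lemma one_sub_E {x : ℝ} (hx : 0 ≤ x) : 0 ≤ 1 - E x ∧ 1 - E x ≤ Real.exp (-Real.pi * x ^ 2) := by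
  have hint : MeasureTheory.Integrable (fun u : ℝ => Real.exp (-Real.pi * u ^ 2)) :=
    integrable_exp_neg_mul_sq Real.pi_pos
  have hG := integral_gaussian_Ioi Real.pi
  have hpi : √(Real.pi / Real.pi) / 2 = 1 / 2 := by
    rw [div_self Real.pi_ne_zero, Real.sqrt_one]
  rw [hpi] at hG
  have h1 := intervalIntegral.integral_interval_add_Ioi (a := 0) (b := x) hint.integrableOn hint.integrableOn
  have h2 : 1 - E x = 2 * ∫ u in Set.Ioi x, Real.exp (-Real.pi * u ^ 2) := by
    rw [E]; linarith
  rw [h2]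
  constructor
  · have : 0 ≤ ∫ u in Set.Ioi x, Real.exp (-Real.pi * u ^ 2) :=
      MeasureTheory.integral_nonneg fun _ => (Real.exp_pos _).le
    positivity
  · have h3 := (MeasureTheory.measurePreserving_add_left MeasureTheory.volume x).setIntegral_preimage_emb
      (measurableEmbedding_addLeft x) (fun u => Real.exp (-Real.pi * u ^ 2)) (Set.Ioi x)
    rw [Set.preimage_const_add_Ioi, sub_self] at h3
    have h4 : ∫ u in Set.Ioi (0 : ℝ), Real.exp (-Real.pi * (x + u) ^ 2) ≤
        ∫ u in Set.Ioi (0 : ℝ), Real.exp (-Real.pi * x ^ 2) * Real.exp (-Real.pi * u ^ 2) := by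
      refine MeasureTheory.setIntegral_mono_on ?_ (hint.const_mul _).integrableOn measurableSet_Ioi ?_
      · exact (hint.comp_add_left x).integrableOn
      · intro u hu
        rw [← Real.exp_add, Real.exp_le_exp]
        have h5 : 0 ≤ Real.pi * (x * u) :=
          mul_nonneg Real.pi_pos.le (mul_nonneg hx (le_of_lt hu))
        nlinarith
    rw [MeasureTheory.integral_const_mul, hG] at h4
    rw [← h3]
    linarith

lemma abs_E_le (x : ℝ) : |E x| ≤ 1 := by
  wlog hx : 0 ≤ x generalizing x
  · have := this (-x) (by linarith)
    rwa [E_neg, abs_neg] at this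
  have h1 := one_sub_E hx
  have h2 : Real.exp (-Real.pi * x ^ 2) ≤ 1 := by
    rw [Real.exp_le_one_iff]
    nlinarith [Real.pi_pos, mul_nonneg Real.pi_pos.le (sq_nonneg x)]
  rw [abs_le]; constructor <;> linarith

/-- A bound for `sgn - E`, where the sign is that of `x` unless `|x| ≤ b`. -/
lemma abs_sign_sub_E_le {σ x b : ℝ} (hσ : σ = 1 ∨ σ = -1) (hb : 0 ≤ σ * x ∨ |x| ≤ b) :
    |σ - E x| ≤ 2 * Real.exp (Real.pi * b ^ 2) * Real.exp (-Real.pi * x ^ 2) := by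
  have h0 : 1 ≤ Real.exp (Real.pi * b ^ 2) :=
    Real.one_le_exp (mul_nonneg Real.pi_pos.le (sq_nonneg b))
  rcases hb with hb | hb
  · have key : |σ - E x| ≤ Real.exp (-Real.pi * x ^ 2) := by
      rcases hσ with rfl | rfl
      · obtain ⟨h1, h2⟩ := one_sub_E (x := x) (by linarith)
        rwa [abs_of_nonneg h1]
      · obtain ⟨h1, h2⟩ := one_sub_E (x := -x) (by linarith)
        rw [E_neg] at h1 h2
        rw [abs_of_nonpos (by linarith)]
        rw [neg_sq] at h2
        linarith
    refine key.trans ?_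
    have := Real.exp_pos (-Real.pi * x ^ 2)
    nlinarith
  -- When `|x| ≤ b` the sign may be the wrong one. The trivial bound 2 then suffices, because
  -- `e^{πb²} e^{-πx²} ≥ 1`.
  · have h1 : |σ - E x| ≤ 2 := by
      have h2 := abs_E_le x
      have h3 : |σ| = 1 := by rcases hσ with rfl | rfl <;> simp
      have := abs_sub σ (E x)
      linarith
    refine h1.trans ?_
    rw [mul_assoc, ← Real.exp_add]
    have : 1 ≤ Real.exp (Real.pi * b ^ 2 + -Real.pi * x ^ 2) := by
      refine Real.one_le_exp ?_
      have : x ^ 2 ≤ b ^ 2 := sq_le_sq' (by linarith [abs_le.1 hb]) (abs_le.1 hb).2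
      nlinarith [Real.pi_pos]
    linarith

lemma summable_exp_neg_sq {a : ℝ} (ha : 0 < a) (c : ℝ) :
    Summable fun r : ℤ => Real.exp (-a * (r : ℝ) ^ 2 + c * |(r : ℝ)|) := by
  have := summable_pow_mul_jacobiTheta₂_term_bound (c / (2 * Real.pi)) (T := a / Real.pi)
    (div_pos ha Real.pi_pos) 0
  refine this.congr fun r => ?_
  have := Real.pi_ne_zero
  simp only [pow_zero, one_mul]
  congr 1
  push_cast
  field_simp
  ring

/-! ### The functions `R`: analyticity, `∂̄`-derivative and translations. -/

/-- The general term of `R`, with `Im u / y` replaced by an independent complex variable. -/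
def RTerm (m : ℕ) (τ : ℍ) (r : ℤ) (p : ℂ × ℂ) : ℂ :=
  ((Real.sign ((r : ℝ) + 1 / 2) : ℝ) - EC ((r + 2 * m * p.1) * (Real.sqrt (τ.im / m) : ℝ))) *
    exp (-Real.pi * I * (r : ℂ) ^ 2 * τ / (2 * m) - 2 * Real.pi * I * (r : ℂ) * p.2)

/-- The extension of `R` to a holomorphic function of two variables. -/
def RC (m : ℕ) (l : ℤ) (τ : ℍ) (p : ℂ × ℂ) : ℂ :=
  ∑' r : {r : ℤ // r ≡ l [ZMOD 2 * m]}, RTerm m τ r p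

lemma RTerm_im_div (m : ℕ) (τ : ℍ) (r : ℤ) (u : ℂ) :
    RTerm m τ r ((u.im / τ.im : ℝ), u) =
    ((Real.sign (((r : ℤ) : ℝ) + 1 / 2)
        - E ((((r : ℤ) : ℝ) + 2 * m * u.im / τ.im) * Real.sqrt (τ.im / m)) : ℝ) : ℂ) *
      exp (-Real.pi * I * ((r : ℤ) : ℂ) ^ 2 * τ / (2 * m)
        - 2 * Real.pi * I * ((r : ℤ) : ℂ) * u) := by
  rw [RTerm, ofReal_sub, ← EC_ofReal]
  congr 3
  push_cast
  ring_nf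

lemma R_eq_RC (m : ℕ) (l : ℤ) (u : ℂ) (τ : ℍ) :
    R m l u τ = RC m l τ ((u.im / τ.im : ℝ), u) :=
  tsum_congr fun r => (RTerm_im_div m τ r u).symm

lemma sign_add_half (r : ℤ) : Real.sign ((r : ℝ) + 1 / 2) = if 0 ≤ r then 1 else -1 := by
  split_ifs with h
  · refine Real.sign_of_pos ?_
    have : (0 : ℝ) ≤ r := by exact_mod_cast h
    linarith
  · refine Real.sign_of_neg ?_
    have : (r : ℝ) ≤ -1 := by exact_mod_cast (by omega : r ≤ -1)
    linarith

lemma re_R_exponent {m : ℕ} (hm : 0 < m) (τ : ℍ) (r : ℤ) (u : ℂ) :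
    (-Real.pi * I * (r : ℂ) ^ 2 * τ / (2 * m) - 2 * Real.pi * I * (r : ℂ) * u).re =
      Real.pi * (r : ℝ) ^ 2 * τ.im / (2 * m) + 2 * Real.pi * r * u.im := by
  have hmR : (m : ℝ) ≠ 0 := by exact_mod_cast hm.ne'
  have hm' : (m : ℂ) ≠ 0 := by exact_mod_cast hm.ne'
  have e : (-Real.pi * I * (r : ℂ) ^ 2 * τ / (2 * m) - 2 * Real.pi * I * (r : ℂ) * u) =
    ((-Real.pi * (r : ℝ) ^ 2 / (2 * m) : ℝ) : ℂ) * (I * τ) + ((-2 * Real.pi * r : ℝ) : ℂ) * (I * u) := by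
    push_cast
    field_simp
    ring
  rw [e, add_re, re_ofReal_mul, re_ofReal_mul]
  simp only [mul_re, I_re, I_im, zero_mul, one_mul, zero_sub, UpperHalfPlane.coe_im]
  field_simp

/-- The factor `sgn - E` decays like `e^{-πκ²r²}` with `κ² = y/m`, while the exponential grows like
`e^{πκ²r²/2}`. Half of the Gaussian survives and absorbs the terms linear in `r`, uniformly for
bounded `p`. -/
lemma exists_bound_RTerm {m : ℕ} (hm : 0 < m) (τ : ℍ) {A : ℝ} (hA : 0 ≤ A) :
    ∃ b : ℤ → ℝ, Summable b ∧ ∀ (r : ℤ) (p : ℂ × ℂ), ‖p.1‖ ≤ A → ‖p.2‖ ≤ A → ‖RTerm m τ r p‖ ≤ b r := by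
  have hmR : (0 : ℝ) < m := by exact_mod_cast hm
  have hy := τ.im_pos
  set κ : ℝ := Real.sqrt (τ.im / m) with hκ
  have hκ0 : 0 < κ := Real.sqrt_pos.2 (by positivity)
  have hκ2 : κ ^ 2 = τ.im / m := Real.sq_sqrt (by positivity)
  set B : ℝ := κ * (2 * m * A) with hB
  have hB0 : 0 ≤ B := by positivity
  have hpi := Real.pi_pos
  refine ⟨fun r => (2 * Real.exp (Real.pi * B ^ 2) * (1 + B)) * Real.exp (-(Real.pi * κ ^ 2 / 2) * (r : ℝ) ^ 2 +
    (4 * Real.pi * m * κ ^ 2 * A + 2 * Real.pi * A) * |(r : ℝ)|),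
    (summable_exp_neg_sq (by positivity) _).mul_left _, ?_⟩
  rintro r ⟨α, u⟩ h1 h2
  simp only at h1 h2
  set x : ℝ := κ * (r + 2 * m * α.re) with hx
  set η : ℝ := κ * (2 * m * α.im) with hη
  have hre : |α.re| ≤ A := (abs_re_le_norm α).trans h1
  have him : |α.im| ≤ A := (abs_im_le_norm α).trans h1
  have huim : |u.im| ≤ A := (abs_im_le_norm u).trans h2
  have hηB : |η| ≤ B := by
    rw [hη, hB, abs_mul, abs_mul, abs_of_pos hκ0, abs_of_pos (by positivity : (0 : ℝ) < 2 * m)]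
    gcongr
  have hw : (r + 2 * m * α) * (κ : ℂ) = x + η * I := by
    rw [hx, hη]
    conv_lhs => rw [← re_add_im α]
    push_cast
    ring
  have hs := sign_add_half r
  have hσ : Real.sign ((r : ℝ) + 1 / 2) = 1 ∨ Real.sign ((r : ℝ) + 1 / 2) = -1 := by
    rw [hs]; split_ifs <;> simp
  -- If the sign of `x` differs from that of `r`, the shift `2m Re α` outweighs `r`, and then `|x|`
  -- is at most `B`.
  have hcond : 0 ≤ Real.sign ((r : ℝ) + 1 / 2) * x ∨ |x| ≤ B := by
    by_cases hx0 : 0 ≤ Real.sign ((r : ℝ) + 1 / 2) * x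
    · exact Or.inl hx0
    · right
      have hre' := abs_le.1 hre
      rw [hs] at hx0
      split_ifs at hx0 with hr
      · have hr' : (0 : ℝ) ≤ r := by exact_mod_cast hr
        rw [abs_of_nonpos (by linarith), hx, hB, ← mul_neg]
        gcongr
        nlinarith
      · have hr' : (r : ℝ) ≤ 0 := by exact_mod_cast (by omega : r ≤ 0)
        rw [abs_of_nonneg (by linarith), hx, hB]
        gcongr
        nlinarith
  have hE := abs_sign_sub_E_le hσ hcond
  have hEC := norm_EC_sub_le x η
  have hfac : ‖((Real.sign ((r : ℝ) + 1 / 2) : ℝ) : ℂ) - EC (x + η * I)‖ ≤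
      2 * Real.exp (Real.pi * B ^ 2) * (1 + B) * Real.exp (-Real.pi * x ^ 2) := by
    have e : ((Real.sign ((r : ℝ) + 1 / 2) : ℝ) : ℂ) - EC (x + η * I) =
      ((Real.sign ((r : ℝ) + 1 / 2) - E x : ℝ) : ℂ) - (EC (x + η * I) - E x) := by push_cast; ring
    rw [e]
    refine (norm_sub_le _ _).trans ?_
    rw [norm_real, Real.norm_eq_abs]
    have h3 : Real.exp (Real.pi * η ^ 2) ≤ Real.exp (Real.pi * B ^ 2) := by
      rw [Real.exp_le_exp]
      have : η ^ 2 ≤ B ^ 2 := sq_le_sq' (by linarith [abs_le.1 hηB]) (abs_le.1 hηB).2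
      gcongr
    have h4 : 2 * Real.exp (Real.pi * η ^ 2) * |η| * Real.exp (-Real.pi * x ^ 2) ≤
      2 * Real.exp (Real.pi * B ^ 2) * B * Real.exp (-Real.pi * x ^ 2) := by gcongr
    linarith
  rw [RTerm, norm_mul, norm_exp]
  simp only
  rw [re_R_exponent hm, ← hκ, hw]
  refine (mul_le_mul_of_nonneg_right hfac (Real.exp_pos _).le).trans ?_
  rw [mul_assoc _ (Real.exp _), ← Real.exp_add]
  refine mul_le_mul_of_nonneg_left ?_ (by positivity)
  rw [Real.exp_le_exp]
  have e1 : Real.pi * (r : ℝ) ^ 2 * τ.im / (2 * m) = Real.pi * κ ^ 2 / 2 * (r : ℝ) ^ 2 := by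
    rw [hκ2]; field_simp
  rw [e1, hx, mul_pow]
  have e2 : -(r * α.re) ≤ |(r : ℝ)| * A := by
    calc -(r * α.re) ≤ |(r : ℝ) * α.re| := neg_le_abs _
      _ = |(r : ℝ)| * |α.re| := abs_mul _ _
      _ ≤ _ := by gcongr
  have e3 : r * u.im ≤ |(r : ℝ)| * A := by
    calc r * u.im ≤ |(r : ℝ) * u.im| := le_abs_self _
      _ = |(r : ℝ)| * |u.im| := abs_mul _ _
      _ ≤ _ := by gcongr
  have e4 : -((r : ℝ) + 2 * m * α.re) ^ 2 ≤ -(r : ℝ) ^ 2 + 4 * m * (|(r : ℝ)| * A) := by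
    nlinarith [sq_nonneg (m * α.re), mul_le_mul_of_nonneg_left e2 hmR.le]
  have e5 := mul_le_mul_of_nonneg_left e4 (by positivity : 0 ≤ Real.pi * κ ^ 2)
  have e6 := mul_le_mul_of_nonneg_left e3 (by positivity : 0 ≤ 2 * Real.pi)
  linarith

lemma summable_RTerm {m : ℕ} (hm : 0 < m) (τ : ℍ) (p : ℂ × ℂ) :
    Summable fun r : ℤ => RTerm m τ r p := by
  obtain ⟨b, hb, h⟩ := exists_bound_RTerm hm τ (A := max ‖p.1‖ ‖p.2‖) (le_max_of_le_left (norm_nonneg _))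
  exact Summable.of_norm_bounded hb fun r => h r p (le_max_left _ _) (le_max_right _ _)

lemma continuous_EC : Continuous EC :=
  continuous_iff_continuousAt.2 fun w => (hasDerivAt_EC w).continuousAt

lemma hasDerivAt_RTerm_fst (m : ℕ) (τ : ℍ) (r : ℤ) (α u : ℂ) :
    HasDerivAt (fun α => RTerm m τ r (α, u))
      (-(2 * exp (-Real.pi * ((r + 2 * m * α) * (Real.sqrt (τ.im / m) : ℝ)) ^ 2) *
        (2 * m * (Real.sqrt (τ.im / m) : ℝ))) *
      exp (-Real.pi * I * (r : ℂ) ^ 2 * τ / (2 * m) - 2 * Real.pi * I * (r : ℂ) * u)) α := by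
  have h1 : HasDerivAt (fun α : ℂ => (r + 2 * m * α) * ((Real.sqrt (τ.im / m) : ℝ) : ℂ))
      (2 * m * (Real.sqrt (τ.im / m) : ℝ)) α := by
    simpa using (((hasDerivAt_id α).const_mul (2 * m : ℂ)).const_add (r : ℂ)).mul_const
      ((Real.sqrt (τ.im / m) : ℝ) : ℂ)
  have h2 := HasDerivAt.comp α (hasDerivAt_EC _) h1
  exact (h2.const_sub ((Real.sign ((r : ℝ) + 1 / 2) : ℝ) : ℂ)).mul_const
    (exp (-Real.pi * I * (r : ℂ) ^ 2 * τ / (2 * m) - 2 * Real.pi * I * (r : ℂ) * u))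

lemma differentiable_RTerm_snd (m : ℕ) (τ : ℍ) (r : ℤ) (α : ℂ) :
    Differentiable ℂ (fun u => RTerm m τ r (α, u)) := by
  have h : Differentiable ℂ fun u : ℂ => exp (-Real.pi * I * (r : ℂ) ^ 2 * τ / (2 * m) -
    2 * Real.pi * I * (r : ℂ) * u) := by fun_prop
  exact h.const_mul (((Real.sign ((r : ℝ) + 1 / 2) : ℝ) : ℂ) -
    EC ((r + 2 * m * α) * (Real.sqrt (τ.im / m) : ℝ)))

lemma continuous_RTerm (m : ℕ) (τ : ℍ) (r : ℤ) : Continuous (RTerm m τ r) := by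
  have := continuous_EC
  unfold RTerm; fun_prop

lemma continuous_RC {m : ℕ} (hm : 0 < m) (l : ℤ) (τ : ℍ) : Continuous (RC m l τ) := by
  rw [continuous_iff_continuousAt]
  intro c
  obtain ⟨b, hb, h⟩ := exists_bound_RTerm hm τ (A := ‖c‖ + 1) (by positivity)
  have : ContinuousOn (RC m l τ) (Metric.ball c 1) := by
    refine continuousOn_tsum (fun r => (continuous_RTerm m τ r).continuousOn) (hb.subtype _) ?_
    intro r p hp
    have h1 : ‖p‖ ≤ ‖c‖ + 1 := by
      have := norm_sub_norm_le p c
      rw [Metric.mem_ball, dist_eq_norm] at hp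
      linarith
    exact h r p ((norm_fst_le p).trans h1) ((norm_snd_le p).trans h1)
  exact this.continuousAt (Metric.ball_mem_nhds _ one_pos)

/-- Termwise differentiation. The derivative is needed explicitly because it is the only one that
contributes to the Cauchy–Riemann defect of `R`; the sign has disappeared from it. -/
lemma hasDerivAt_RC_fst {m : ℕ} (hm : 0 < m) (l : ℤ) (τ : ℍ) (α u : ℂ) :
    HasDerivAt (fun α => RC m l τ (α, u)) (∑' r : {r : ℤ // r ≡ l [ZMOD 2 * m]},
      (-(2 * exp (-Real.pi * ((((r : ℤ) : ℂ) + 2 * m * α) * (Real.sqrt (τ.im / m) : ℝ)) ^ 2) *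
        (2 * m * (Real.sqrt (τ.im / m) : ℝ))) *
      exp (-Real.pi * I * ((r : ℤ) : ℂ) ^ 2 * τ / (2 * m) - 2 * Real.pi * I * ((r : ℤ) : ℂ) * u))) α := by
  obtain ⟨b, hb, h⟩ := exists_bound_RTerm hm τ (A := ‖α‖ + ‖u‖ + 1) (by positivity)
  have hα : α ∈ Metric.ball (0 : ℂ) (‖α‖ + ‖u‖ + 1) := by
    rw [mem_ball_zero_iff]; linarith [norm_nonneg u]
  have hF : ∀ r : {r : ℤ // r ≡ l [ZMOD 2 * m]}, DifferentiableOn ℂ (fun α => RTerm m τ r (α, u))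
      (Metric.ball (0 : ℂ) (‖α‖ + ‖u‖ + 1)) := fun r w _ =>
    (hasDerivAt_RTerm_fst m τ r w u).differentiableAt.differentiableWithinAt
  have hbd : ∀ (r : {r : ℤ // r ≡ l [ZMOD 2 * m]}), ∀ w ∈ Metric.ball (0 : ℂ) (‖α‖ + ‖u‖ + 1),
      ‖RTerm m τ r (w, u)‖ ≤ b r := fun r w hw =>
    h r (w, u) (mem_ball_zero_iff.1 hw).le (by simp only; linarith [norm_nonneg α])
  have h1 := differentiableOn_tsum_of_summable_norm (hb.subtype _) hF Metric.isOpen_ball hbd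
  have h2 := hasSum_deriv_of_summable_norm (hb.subtype _) hF Metric.isOpen_ball hbd hα
  have h3 := (h1.differentiableAt (Metric.isOpen_ball.mem_nhds hα)).hasDerivAt
  rw [← h2.tsum_eq] at h3
  exact h3.congr_deriv (tsum_congr fun r => (hasDerivAt_RTerm_fst m τ r α u).deriv)

lemma differentiable_RC_snd {m : ℕ} (hm : 0 < m) (l : ℤ) (τ : ℍ) (α : ℂ) :
    Differentiable ℂ (fun u => RC m l τ (α, u)) := by
  intro u
  obtain ⟨b, hb, h⟩ := exists_bound_RTerm hm τ (A := ‖α‖ + ‖u‖ + 1) (by positivity)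
  have hu : u ∈ Metric.ball (0 : ℂ) (‖α‖ + ‖u‖ + 1) := by
    rw [mem_ball_zero_iff]; linarith [norm_nonneg α]
  have hF : ∀ r : {r : ℤ // r ≡ l [ZMOD 2 * m]}, DifferentiableOn ℂ (fun u => RTerm m τ r (α, u))
      (Metric.ball (0 : ℂ) (‖α‖ + ‖u‖ + 1)) := fun r =>
    (differentiable_RTerm_snd m τ r α).differentiableOn
  have hbd : ∀ (r : {r : ℤ // r ≡ l [ZMOD 2 * m]}), ∀ w ∈ Metric.ball (0 : ℂ) (‖α‖ + ‖u‖ + 1),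
      ‖RTerm m τ r (α, w)‖ ≤ b r := fun r w hw =>
    h r (α, w) (by simp only; linarith [norm_nonneg u]) (mem_ball_zero_iff.1 hw).le
  exact (differentiableOn_tsum_of_summable_norm (hb.subtype _) hF Metric.isOpen_ball hbd).differentiableAt
    (Metric.isOpen_ball.mem_nhds hu)

lemma analyticAt_RC {m : ℕ} (hm : 0 < m) (l : ℤ) (τ : ℍ) (c : ℂ × ℂ) : AnalyticAt ℂ (RC m l τ) c :=
  analyticAt_of_separately_differentiable one_pos (continuous_RC hm l τ).continuousOn
    (fun w _ v _ => (hasDerivAt_RC_fst hm l τ v w).differentiableAt.differentiableWithinAt)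
    (fun v _ => (differentiable_RC_snd hm l τ v).differentiableOn)

/-- The real-linear embedding `u ↦ (Im u / y, u)`. -/
def imEmb (τ : ℍ) : ℂ →L[ℝ] ℂ × ℂ :=
  (ofRealCLM.comp ((τ.im)⁻¹ • imCLM)).prod (ContinuousLinearMap.id ℝ ℂ)

lemma imEmb_apply (τ : ℍ) (u : ℂ) : imEmb τ u = (((u.im / τ.im : ℝ) : ℂ), u) := by
  simp [imEmb, div_eq_inv_mul]

/-- `R` is the pullback of the holomorphic `RC` under the real-linear map `u ↦ (Im u / y, u)`. -/
lemma analyticAt_R {m : ℕ} (hm : 0 < m) (l : ℤ) (τ : ℍ) (u : ℂ) :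
    AnalyticAt ℝ (fun v => R m l v τ) u := by
  have h1 : (fun v => R m l v τ) = fun v => RC m l τ (imEmb τ v) := by
    funext v; rw [imEmb_apply, R_eq_RC]
  rw [h1]
  exact (analyticAt_RC hm l τ _).restrictScalars.comp ((imEmb τ).analyticAt u)

/-- `F(iv)`-derivative minus `i` times the derivative: it vanishes exactly when the real-differentiable
function `F` is complex differentiable. -/
def crDefect (F : ℂ → ℂ) (v : ℂ) : ℂ := fderiv ℝ F v I - I * fderiv ℝ F v 1

open ComplexConjugate in
-- The second variable of `RC` enters holomorphically and drops out; the first contributes its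
-- partial derivative divided by `y`. Completing the square in the exponent then makes each summand
-- the conjugate of a theta term, up to a Gaussian in `Im u` common to all of them.
lemma crDefect_R {m : ℕ} (hm : 0 < m) (l : ℤ) (τ : ℍ) (u : ℂ) :
    crDefect (fun v => R m l v τ) u =
      -4 * (m * (Real.sqrt (τ.im / m) : ℝ) / τ.im * Real.exp (-4 * Real.pi * m * u.im ^ 2 / τ.im) : ℝ) *
        conj (theta m l u τ) := by
  have hmR : (0 : ℝ) < m := by exact_mod_cast hm
  have hm' : (m : ℂ) ≠ 0 := by exact_mod_cast hm.ne'
  have hy := τ.im_pos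
  have hyC : (τ.im : ℂ) ≠ 0 := by exact_mod_cast hy.ne'
  have h1 : (fun v => R m l v τ) = RC m l τ ∘ (imEmb τ) := by
    funext v; simp only [Function.comp, imEmb_apply, R_eq_RC]
  set c : ℂ × ℂ := imEmb τ u with hc
  have hd := (analyticAt_RC hm l τ c).differentiableAt
  have hd2 : HasFDerivAt (fun v => R m l v τ) (((fderiv ℂ (RC m l τ) c).restrictScalars ℝ).comp (imEmb τ)) u := by
    rw [h1]
    exact HasFDerivAt.comp (g := RC m l τ) (f := imEmb τ) u (hd.hasFDerivAt.restrictScalars ℝ)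
      ((imEmb τ).hasFDerivAt (x := u))
  rw [crDefect, hd2.fderiv]
  simp only [ContinuousLinearMap.comp_apply, ContinuousLinearMap.coe_restrictScalars', imEmb_apply]
  have e1 : (((I.im / τ.im : ℝ) : ℂ), I) = ((τ.im : ℂ)⁻¹) • ((1 : ℂ), (0 : ℂ)) + I • ((0 : ℂ), (1 : ℂ)) := by
    simp
  have e2 : ((((1 : ℂ).im / τ.im : ℝ) : ℂ), (1 : ℂ)) = ((0 : ℂ), (1 : ℂ)) := by simp
  rw [e1, e2, map_add, map_smul, map_smul]
  have h3 : HasDerivAt (fun α => RC m l τ (α, u)) (fderiv ℂ (RC m l τ) c (1, 0)) c.1 := by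
    have h4 : HasDerivAt (fun α : ℂ => (α, u)) ((1 : ℂ), (0 : ℂ)) c.1 :=
      (hasDerivAt_id _).prodMk (hasDerivAt_const _ _)
    have h5 : c = (c.1, u) := by rw [hc, imEmb_apply]
    exact HasFDerivAt.comp_hasDerivAt c.1 (h5 ▸ hd.hasFDerivAt) h4
  have h6 := h3.unique (hasDerivAt_RC_fst hm l τ c.1 u)
  rw [h6]
  simp only [smul_eq_mul]
  rw [add_sub_cancel_right, theta, conj_tsum, ← tsum_mul_left, ← tsum_mul_left]
  refine tsum_congr fun r => ?_
  have e3 : c.1 = (u.im / τ.im : ℝ) := by rw [hc, imEmb_apply]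
  have hκ2 : ((Real.sqrt (τ.im / m) : ℝ) : ℂ) ^ 2 = τ.im / m := by
    rw [← ofReal_pow, Real.sq_sqrt (by positivity)]; push_cast; rfl
  rw [e3, ← exp_conj]
  have e4 : exp (-Real.pi * ((((r : ℤ) : ℂ) + 2 * m * ((u.im / τ.im : ℝ) : ℂ)) * (Real.sqrt (τ.im / m) : ℝ)) ^ 2) *
      exp (-Real.pi * I * ((r : ℤ) : ℂ) ^ 2 * τ / (2 * m) - 2 * Real.pi * I * ((r : ℤ) : ℂ) * u) =
      exp (-4 * Real.pi * m * u.im ^ 2 / τ.im) * exp (conj (Real.pi * I * ((r : ℤ) : ℂ) ^ 2 * τ / (2 * m) +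
        2 * Real.pi * I * ((r : ℤ) : ℂ) * u)) := by
    rw [← exp_add, ← exp_add, mul_pow, hκ2]
    congr 1
    simp only [map_add, map_mul, map_div₀, conj_ofReal, conj_I, map_pow, map_intCast, map_ofNat, map_natCast]
    have hτ : (τ : ℂ) = τ.re + τ.im * I := (re_add_im (τ : ℂ)).symm
    have hu : u = u.re + u.im * I := (re_add_im u).symm
    have hcτ : conj (τ : ℂ) = τ.re - τ.im * I := by apply Complex.ext <;> simp
    have hcu : conj u = u.re - u.im * I := by apply Complex.ext <;> simp
    rw [hcτ, hcu]
    conv_lhs => rw [hτ]; enter [2, 2]; rw [hu]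
    push_cast
    field_simp
    ring_nf
    simp only [I_sq]
    ring
  push_cast at e4 ⊢
  linear_combination (-(4 * m * ((Real.sqrt (τ.im / m) : ℝ) : ℂ) / τ.im)) * e4

lemma R_add_one (m : ℕ) (l : ℤ) (u : ℂ) (τ : ℍ) : R m l (u + 1) τ = R m l u τ := by
  refine tsum_congr fun r => ?_
  have h1 : (u + 1).im = u.im := by simp
  rw [h1]
  congr 1
  rw [exp_eq_exp_iff_exists_int]
  exact ⟨-r, by push_cast; ring⟩

lemma R_T {m : ℕ} (hm : 0 < m) (l : ℤ) (u : ℂ) (τ τ' : ℍ) (h : (τ' : ℂ) = τ + 1) :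
    R m l u τ' = exp (-Real.pi * I * (l : ℂ) ^ 2 / (2 * m)) * R m l u τ := by
  have hm' : (m : ℂ) ≠ 0 := by exact_mod_cast hm.ne'
  have him : τ'.im = τ.im := by
    rw [← UpperHalfPlane.coe_im, h]; simp
  rw [R, R, ← tsum_mul_left]
  refine tsum_congr fun r => ?_
  rw [him, h, mul_left_comm]
  congr 1
  rw [← exp_add, exp_eq_exp_iff_exists_int]
  obtain ⟨k, hk⟩ : ∃ k : ℤ, (r : ℤ) = l + 2 * m * k := by
    obtain ⟨k, hk⟩ := r.2.symm.dvd
    exact ⟨k, by linarith⟩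
  refine ⟨-(l * k + m * k ^ 2), ?_⟩
  rw [hk]
  push_cast
  field_simp
  ring

/-- Passing from `u` to `u + τ` shifts the index by `2m` everywhere except in the sign. In the
difference the error functions cancel and `sgn(λ + 1/2) - sgn(λ - 2m + 1/2)` remains, which is 2 for
`0 ≤ λ < 2m` and 0 otherwise. The class of `l` has one element in that range, namely `l`. -/
lemma R_add_tau {m : ℕ} (hm : 0 < m) (l : Fin (2 * m)) (u : ℂ) (τ : ℍ) :
    R m (l : ℕ) u τ - exp (-2 * Real.pi * I * m * τ - 4 * Real.pi * I * m * u) * R m (l : ℕ) (u + τ) τ =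
      2 * exp (-Real.pi * I * ((l : ℕ) : ℂ) ^ 2 * τ / (2 * m) - 2 * Real.pi * I * ((l : ℕ) : ℂ) * u) := by
  have hm' : (m : ℂ) ≠ 0 := by exact_mod_cast hm.ne'
  have hy : τ.im ≠ 0 := τ.im_pos.ne'
  let e : ℤ → ℂ := fun r =>
    exp (-Real.pi * I * (r : ℂ) ^ 2 * τ / (2 * m) - 2 * Real.pi * I * (r : ℂ) * u)
  let G : ℤ → ℂ := fun r => ((Real.sign (((r : ℤ) : ℝ) + 1 / 2)
        - E ((((r : ℤ) : ℝ) + 2 * m * u.im / τ.im) * Real.sqrt (τ.im / m)) : ℝ) : ℂ) * e r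
  let H : ℤ → ℂ := fun r => ((Real.sign ((((r - 2 * m : ℤ)) : ℝ) + 1 / 2)
        - E ((((r : ℤ) : ℝ) + 2 * m * u.im / τ.im) * Real.sqrt (τ.im / m)) : ℝ) : ℂ) * e r
  have hsG : Summable G := (summable_RTerm hm τ ((u.im / τ.im : ℝ), u)).congr fun r => RTerm_im_div m τ r u
  have hsh : ∀ r : ℤ, exp (-2 * Real.pi * I * m * τ - 4 * Real.pi * I * m * u) *
      (((Real.sign (((r : ℤ) : ℝ) + 1 / 2)
        - E ((((r : ℤ) : ℝ) + 2 * m * (u + τ).im / τ.im) * Real.sqrt (τ.im / m)) : ℝ) : ℂ) *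
      exp (-Real.pi * I * ((r : ℤ) : ℂ) ^ 2 * τ / (2 * m)
        - 2 * Real.pi * I * ((r : ℤ) : ℂ) * (u + τ))) = H (r + (2 * m : ℕ)) := by
    intro r
    simp only [H, e]
    have h1 : ((r : ℤ) : ℝ) + 2 * m * (u + τ).im / τ.im = ((r + (2 * m : ℕ) : ℤ) : ℝ) + 2 * m * u.im / τ.im := by
      rw [add_im, UpperHalfPlane.coe_im]
      push_cast
      field_simp
      ring
    have h2 : r + (2 * m : ℕ) - 2 * (m : ℤ) = r := by push_cast; ring
    rw [h1, h2, mul_left_comm, ← exp_add]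
    congr 2
    push_cast
    field_simp
    ring
  have hsH : Summable H := by
    have h3 := ((summable_RTerm hm τ (((u + τ).im / τ.im : ℝ), u + τ)).congr fun r =>
      RTerm_im_div m τ r (u + τ)).mul_left (exp (-2 * Real.pi * I * m * τ - 4 * Real.pi * I * m * u))
    have h4 : Summable fun r : ℤ => H (r + (2 * m : ℕ)) := h3.congr hsh
    exact (Equiv.addRight ((2 * m : ℕ) : ℤ)).summable_iff.1 h4
  have hR : exp (-2 * Real.pi * I * m * τ - 4 * Real.pi * I * m * u) * R m (l : ℕ) (u + τ) τ =
      ∑' r : {r : ℤ // r ≡ ((l : ℕ) : ℤ) [ZMOD 2 * m]}, H r := by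
    have h5 := tsum_class_add (n := 2 * m) (by omega) ((l : ℕ) : ℤ) H
    rw [coe_two_mul_cast] at h5
    rw [← h5, R, ← tsum_mul_left]
    refine tsum_congr fun r => ?_
    have := hsh r
    rw [coe_two_mul_cast] at this
    exact this
  have hR0 : R m (l : ℕ) u τ = ∑' r : {r : ℤ // r ≡ ((l : ℕ) : ℤ) [ZMOD 2 * m]}, G r := rfl
  rw [hR, hR0]
  refine ((hsG.subtype {r : ℤ | r ≡ ((l : ℕ) : ℤ) [ZMOD 2 * m]}).tsum_sub (hsH.subtype _)).symm.trans ?_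
  change ∑' r : {r : ℤ // r ≡ ((l : ℕ) : ℤ) [ZMOD 2 * m]}, (G r - H r) = _
  have hl := l.2
  have hterm : ∀ r : ℤ, G r - H r = (if 0 ≤ r ∧ r < 2 * m then 2 else 0) * e r := by
    intro r
    simp only [G, H]
    rw [sign_add_half, sign_add_half, ← sub_mul]
    congr 1
    by_cases h1 : 0 ≤ r
    · by_cases h2 : r < 2 * m
      · have h3 : ¬ (0 ≤ r - 2 * (m : ℤ)) := by omega
        simp only [h1, h2, h3, if_true, if_false, true_and]
        push_cast; ring
      · have h3 : 0 ≤ r - 2 * (m : ℤ) := by omega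
        simp only [h1, h2, h3, if_true, if_false, and_false]
        push_cast; ring
    · have h3 : ¬ (0 ≤ r - 2 * (m : ℤ)) := by omega
      simp only [h1, h3, if_false, false_and]
      push_cast; ring
  simp only [hterm]
  rw [tsum_eq_single (⟨((l : ℕ) : ℤ), Int.ModEq.refl _⟩ : {r : ℤ // r ≡ ((l : ℕ) : ℤ) [ZMOD 2 * m]})]
  · have h1 : (0 : ℤ) ≤ (l : ℕ) ∧ ((l : ℕ) : ℤ) < 2 * m := by omega
    simp only [h1, and_self, if_true, e]
    push_cast
    rfl
  · rintro ⟨r, hr⟩ hne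
    rw [if_neg, zero_mul]
    rintro ⟨h1, h2⟩
    apply hne
    ext
    simp only at h1 h2 ⊢
    have h3 := Int.emod_eq_of_lt h1 h2
    have h4 : ((l : ℕ) : ℤ) % (2 * m) = (l : ℕ) := Int.emod_eq_of_lt (by omega) (by omega)
    rw [← h3, ← h4]
    exact hr

/-! ### The sums `f`: poles and translations in `u`. -/

/-- The general term of `f`. -/
def fTerm (m : ℕ) (τ : ℍ) (z : ℂ) (r : ℤ) (u : ℂ) : ℂ :=
  exp (2 * Real.pi * I * m * (r : ℂ) ^ 2 * τ + 4 * Real.pi * I * m * r * z) /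
      (1 - exp (2 * Real.pi * I * r * τ + 2 * Real.pi * I * (z - u)))

lemma summable_fTerm_num {m : ℕ} (hm : 0 < m) (τ : ℍ) (z : ℂ) :
    Summable fun r : ℤ => exp (2 * Real.pi * I * m * (r : ℂ) ^ 2 * τ + 4 * Real.pi * I * m * r * z) := by
  refine ((summable_jacobiTheta₂_term_iff (2 * m * z) _).2 (im_two_mul_pos hm τ)).congr fun r => ?_
  rw [jacobiTheta₂_term]
  congr 1
  ring

lemma mem_lattice_of_exp_eq_one {τ : ℍ} {z u : ℂ} {r : ℤ}
    (h : 1 - exp (2 * Real.pi * I * r * τ + 2 * Real.pi * I * (z - u)) = 0) : u - z ∈ lattice τ := by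
  have h1 : exp (2 * Real.pi * I * r * τ + 2 * Real.pi * I * (z - u)) = 1 := by linear_combination -h
  obtain ⟨n, hn⟩ := exp_eq_one_iff.1 h1
  refine ⟨r, -n, ?_⟩
  have : (2 * Real.pi * I : ℂ) ≠ 0 := by simp [Real.pi_ne_zero]
  refine mul_left_cancel₀ this ?_
  push_cast
  linear_combination -hn

/-- Outside a finite set of `r`, the denominators are bounded below near `u₀`. -/
lemma exists_denominator_bound (τ : ℍ) (z u₀ : ℂ) : ∃ s : Finset ℤ, 0 ∈ s ∧ ∀ r ∉ s, ∀ u ∈ Metric.ball u₀ 1,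
    1 / 2 ≤ ‖1 - exp (2 * Real.pi * I * r * τ + 2 * Real.pi * I * (z - u))‖ := by
  have hy := τ.im_pos
  have hpi := Real.pi_gt_three
  -- Of the margin 2, one unit allows for `u` in the unit ball. The other makes `|r Im τ + Im (z -
  -- u)|` larger than 1, which gives `‖X‖ ≥ 2` or `‖X‖ ≤ 1/2`.
  set M : ℝ := ‖z - u₀‖ + 2 with hM
  obtain ⟨N, hN⟩ := exists_nat_gt (M / τ.im)
  have hN' : M < N * τ.im := (div_lt_iff₀ hy).1 hN
  refine ⟨Finset.Icc (-N) N, by simp, fun r hr u hu => ?_⟩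
  have him : |(z - u).im| ≤ M - 1 := by
    refine (abs_im_le_norm _).trans ?_
    have : z - u = (z - u₀) + (u₀ - u) := by ring
    rw [this]
    refine (norm_add_le _ _).trans ?_
    rw [Metric.mem_ball, dist_comm, dist_eq_norm] at hu
    linarith
  have him' := abs_le.1 him
  set X := exp (2 * Real.pi * I * r * τ + 2 * Real.pi * I * (z - u)) with hX
  have hnX : ‖X‖ = Real.exp (-(2 * Real.pi) * (r * τ.im + (z - u).im)) := by
    rw [hX, norm_exp]
    congr 1
    have : (2 * Real.pi * I * r * τ + 2 * Real.pi * I * (z - u) : ℂ) =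
      ((2 * Real.pi : ℝ) : ℂ) * (I * (((r : ℝ) : ℂ) * τ + (z - u))) := by push_cast; ring
    rw [this, re_ofReal_mul]
    simp only [mul_re, I_re, I_im, zero_mul, one_mul, zero_sub, add_im, im_ofReal_mul, UpperHalfPlane.coe_im]
    ring
  rw [Finset.mem_Icc, not_and_or, not_le, not_le] at hr
  rcases hr with hr | hr
  · have h1 : (r : ℝ) ≤ -N := by exact_mod_cast hr.le
    have h2 : (r : ℝ) * τ.im ≤ -N * τ.im := mul_le_mul_of_nonneg_right h1 hy.le
    have h3 : 2 ≤ ‖X‖ := by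
      rw [hnX]
      have := Real.add_one_le_exp (-(2 * Real.pi) * (r * τ.im + (z - u).im))
      nlinarith
    have h4 := norm_sub_norm_le X 1
    rw [norm_one, norm_sub_rev] at h4
    linarith
  · have h1 : (N : ℝ) ≤ r := by exact_mod_cast hr.le
    have h2 : (N : ℝ) * τ.im ≤ r * τ.im := mul_le_mul_of_nonneg_right h1 hy.le
    have h3 : ‖X‖ ≤ 1 / 2 := by
      rw [hnX]
      have h5 := Real.add_one_le_exp ((2 * Real.pi) * (r * τ.im + (z - u).im))
      have h6 : 2 ≤ Real.exp ((2 * Real.pi) * (r * τ.im + (z - u).im)) := by nlinarith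
      rw [neg_mul, Real.exp_neg]
      rw [one_div]
      exact inv_anti₀ two_pos h6
    have h4 := norm_sub_norm_le 1 X
    rw [norm_one] at h4
    linarith

lemma norm_fTerm_le {m : ℕ} {τ : ℍ} {z u : ℂ} {r : ℤ}
    (h : 1 / 2 ≤ ‖1 - exp (2 * Real.pi * I * r * τ + 2 * Real.pi * I * (z - u))‖) :
    ‖fTerm m τ z r u‖ ≤
      2 * ‖exp (2 * Real.pi * I * m * (r : ℂ) ^ 2 * τ + 4 * Real.pi * I * m * r * z)‖ := by
  rw [fTerm, norm_div, div_le_iff₀ (by linarith)]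
  have := norm_nonneg (exp (2 * Real.pi * I * m * (r : ℂ) ^ 2 * τ + 4 * Real.pi * I * m * r * z))
  nlinarith

lemma summable_fTerm {m : ℕ} (hm : 0 < m) (τ : ℍ) (z u : ℂ) :
    Summable fun r : ℤ => fTerm m τ z r u := by
  obtain ⟨s, -, hs⟩ := exists_denominator_bound τ z u
  refine Summable.of_norm_bounded_eventually ((summable_fTerm_num hm τ z).norm.mul_left 2) ?_
  refine s.finite_toSet.subset fun r hr => ?_
  by_contra hr'
  exact hr (norm_fTerm_le (hs r hr' u (Metric.mem_ball_self one_pos)))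

lemma analyticAt_fTerm (m : ℕ) (τ : ℍ) (z : ℂ) (r : ℤ) {u : ℂ}
    (h : 1 - exp (2 * Real.pi * I * r * τ + 2 * Real.pi * I * (z - u)) ≠ 0) :
    AnalyticAt ℂ (fTerm m τ z r) u := by
  unfold fTerm
  exact AnalyticAt.div analyticAt_const (by fun_prop) h

lemma meromorphicAt_fTerm (m : ℕ) (τ : ℍ) (z : ℂ) (r : ℤ) (u : ℂ) :
    MeromorphicAt (fTerm m τ z r) u := by
  have h : AnalyticAt ℂ (fun u : ℂ => 1 - exp (2 * Real.pi * I * r * τ + 2 * Real.pi * I * (z - u))) u := by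
    fun_prop
  exact (MeromorphicAt.const _ _).div h.meromorphicAt

/-- Near `u₀`, `f` is a finite sum of its terms plus a holomorphic function. -/
lemma exists_f_decomposition {m : ℕ} (hm : 0 < m) (τ : ℍ) (z u₀ : ℂ) :
    ∃ (s : Finset ℤ) (g : ℂ → ℂ), 0 ∈ s ∧ AnalyticAt ℂ g u₀ ∧
      (fun u => f m u z τ) =ᶠ[𝓝 u₀] fun u => (∑ r ∈ s, fTerm m τ z r u) + g u := by
  obtain ⟨s, h0, hs⟩ := exists_denominator_bound τ z u₀
  refine ⟨s, fun u => ∑' r : {r : ℤ // r ∉ s}, fTerm m τ z r u, h0, ?_, ?_⟩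
  · have hd : DifferentiableOn ℂ (fun u => ∑' r : {r : ℤ // r ∉ s}, fTerm m τ z r u) (Metric.ball u₀ 1) := by
      refine differentiableOn_tsum_of_summable_norm (u := fun r : {r : ℤ // r ∉ s} =>
        2 * ‖exp (2 * Real.pi * I * m * ((r : ℤ) : ℂ) ^ 2 * τ + 4 * Real.pi * I * m * (r : ℤ) * z)‖)
        (((summable_fTerm_num hm τ z).norm.mul_left 2).subtype {r : ℤ | r ∉ s}) ?_ Metric.isOpen_ball ?_
      · intro r u hu
        refine (analyticAt_fTerm m τ z r ?_).differentiableAt.differentiableWithinAt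
        intro h
        have := hs r r.2 u hu
        rw [h, norm_zero] at this
        linarith
      · intro r u hu
        exact norm_fTerm_le (hs r r.2 u hu)
    exact hd.analyticAt (Metric.ball_mem_nhds _ one_pos)
  · refine Eventually.of_forall fun u => ?_
    exact ((summable_fTerm hm τ z u).sum_add_tsum_subtype_compl s).symm

lemma analyticAt_f {m : ℕ} (hm : 0 < m) (τ : ℍ) {z u : ℂ} (h : u - z ∉ lattice τ) :
    AnalyticAt ℂ (fun u => f m u z τ) u := by
  obtain ⟨s, g, -, hg, he⟩ := exists_f_decomposition hm τ z u
  refine AnalyticAt.congr ?_ he.symm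
  refine AnalyticAt.add ?_ hg
  exact Finset.analyticAt_fun_sum _ fun r _ =>
    analyticAt_fTerm m τ z r fun h' => h (mem_lattice_of_exp_eq_one h')

lemma meromorphicAt_f {m : ℕ} (hm : 0 < m) (τ : ℍ) (z u : ℂ) :
    MeromorphicAt (fun u => f m u z τ) u := by
  obtain ⟨s, g, -, hg, he⟩ := exists_f_decomposition hm τ z u
  refine MeromorphicAt.congr ?_ (he.symm.filter_mono nhdsWithin_le_nhds)
  exact (MeromorphicAt.fun_sum fun r _ => meromorphicAt_fTerm m τ z r u).add hg.meromorphicAt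

lemma ne_zero_of_im_ne {τ : ℍ} {r : ℤ} (hr : r ≠ 0) (n : ℤ) : (r : ℂ) * τ ≠ n := by
  intro h
  have := congrArg Complex.im h
  simp only [mul_im, intCast_re, intCast_im, zero_mul, add_zero, UpperHalfPlane.coe_im] at this
  have h2 := τ.im_pos.ne'
  simp_all

/-- `v ↦ f_v(z)` has a simple pole at `z`, with residue `1/(2πi)`. -/
lemma tendsto_sub_mul_f {m : ℕ} (hm : 0 < m) (τ : ℍ) (z : ℂ) :
    Tendsto (fun u => (u - z) * f m u z τ) (𝓝[≠] z) (𝓝 (2 * Real.pi * I)⁻¹) := by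
  obtain ⟨s, g, h0, hg, he⟩ := exists_f_decomposition hm τ z z
  have hid : Tendsto (fun u : ℂ => u - z) (𝓝[≠] z) (𝓝 0) := by
    have : Tendsto (fun u : ℂ => u - z) (𝓝 z) (𝓝 (z - z)) := (continuous_id.sub continuous_const).tendsto z
    rw [sub_self] at this
    exact this.mono_left nhdsWithin_le_nhds
  have hreg : ∀ G : ℂ → ℂ, AnalyticAt ℂ G z → Tendsto (fun u => (u - z) * G u) (𝓝[≠] z) (𝓝 0) := by
    intro G hG
    have := hid.mul (hG.continuousAt.tendsto.mono_left nhdsWithin_le_nhds : Tendsto G (𝓝[≠] z) _)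
    rwa [zero_mul] at this
  -- Only the term with `r = 0` is singular at `z`; its denominator vanishes there with derivative
  -- `2πi`.
  have hzero : Tendsto (fun u => (u - z) * fTerm m τ z 0 u) (𝓝[≠] z) (𝓝 (2 * Real.pi * I)⁻¹) := by
    have hd : HasDerivAt (fun u : ℂ => 1 - exp (2 * Real.pi * I * (z - u))) (2 * Real.pi * I) z := by
      have h1 : HasDerivAt (fun u : ℂ => 2 * Real.pi * I * (z - u)) (-(2 * Real.pi * I)) z := by
        simpa using ((hasDerivAt_id z).const_sub z).const_mul (2 * Real.pi * I)
      have h2 := h1.cexp.const_sub 1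
      simpa using h2
    have h3 := hd.tendsto_slope.inv₀ (by simp [Real.pi_ne_zero])
    refine h3.congr' ?_
    filter_upwards with u
    rw [slope_def_field, inv_div]
    simp [fTerm, div_eq_mul_inv]
  have hrest : AnalyticAt ℂ (fun u => (∑ r ∈ s.erase 0, fTerm m τ z r u) + g u) z := by
    refine AnalyticAt.add ?_ hg
    refine Finset.analyticAt_fun_sum _ fun r hr => analyticAt_fTerm m τ z r fun h => ?_
    have hr0 := (Finset.mem_erase.1 hr).1
    have h1 : exp (2 * Real.pi * I * r * τ + 2 * Real.pi * I * (z - z)) = 1 := by linear_combination -h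
    obtain ⟨n, hn⟩ := exp_eq_one_iff.1 h1
    refine ne_zero_of_im_ne (τ := τ) hr0 n ?_
    have : (2 * Real.pi * I : ℂ) ≠ 0 := by simp [Real.pi_ne_zero]
    refine mul_left_cancel₀ this ?_
    linear_combination hn
  have := hzero.add (hreg _ hrest)
  rw [add_zero] at this
  refine this.congr' ?_
  filter_upwards [he.filter_mono nhdsWithin_le_nhds] with u hu
  simp only [hu, ← Finset.add_sum_erase _ _ h0]
  ring

lemma f_add_one (m : ℕ) (u z : ℂ) (τ : ℍ) : f m (u + 1) z τ = f m u z τ := by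
  refine tsum_congr fun r => ?_
  congr 2
  rw [exp_eq_exp_iff_exists_int]
  exact ⟨-1, by push_cast; ring⟩

lemma f_T (m : ℕ) (u z : ℂ) (τ τ' : ℍ) (h : (τ' : ℂ) = τ + 1) : f m u z τ' = f m u z τ := by
  refine tsum_congr fun r => ?_
  rw [h]
  congr 1
  · rw [exp_eq_exp_iff_exists_int]
    exact ⟨m * r ^ 2, by push_cast; ring⟩
  · congr 1
    rw [exp_eq_exp_iff_exists_int]
    exact ⟨r, by ring⟩

/-- After the shift `r ↦ r + 1` in the second series both series have the denominator `1 - X r`,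
with numerators `N r` and `N r * X r ^ (2m)`. The quotient is the geometric sum of the `N r * X r ^
l` with `l < 2m`, and for fixed `l` these add up to `θ_{m,l}(z)` times an exponential in `u`. -/
lemma f_add_tau {m : ℕ} (hm : 0 < m) {u z : ℂ} {τ : ℍ} (h : u - z ∉ lattice τ) :
    f m u z τ - exp (-2 * Real.pi * I * m * τ - 4 * Real.pi * I * m * u) * f m (u + τ) z τ =
      ∑ l : Fin (2 * m), exp (-Real.pi * I * ((l : ℕ) : ℂ) ^ 2 * τ / (2 * m)
        - 2 * Real.pi * I * ((l : ℕ) : ℂ) * u) * theta m (l : ℕ) z τ := by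
  have hm' : (m : ℂ) ≠ 0 := by exact_mod_cast hm.ne'
  let N : ℤ → ℂ := fun r => exp (2 * Real.pi * I * m * (r : ℂ) ^ 2 * τ + 4 * Real.pi * I * m * r * z)
  let X : ℤ → ℂ := fun r => exp (2 * Real.pi * I * r * τ + 2 * Real.pi * I * (z - u))
  have hX : ∀ r, 1 - X r ≠ 0 := fun r h' => h (mem_lattice_of_exp_eq_one h')
  have h1 : exp (-2 * Real.pi * I * m * τ - 4 * Real.pi * I * m * u) * f m (u + τ) z τ =
      ∑' r : ℤ, N r * X r ^ (2 * m) / (1 - X r) := by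
    rw [f, ← (Equiv.addRight (1 : ℤ)).tsum_eq, ← tsum_mul_left]
    refine tsum_congr fun r => ?_
    rw [← mul_div_assoc]
    simp only [N, X, Equiv.coe_addRight]
    congr 1
    · rw [← exp_nat_mul, ← exp_add, ← exp_add]
      congr 1
      push_cast
      ring
    · congr 2
      push_cast
      ring
  have hs2 : Summable fun r : ℤ => N r * X r ^ (2 * m) / (1 - X r) := by
    have h2 := ((Equiv.addRight (1 : ℤ)).summable_iff.2 (summable_fTerm hm τ z (u + τ))).mul_left
      (exp (-2 * Real.pi * I * m * τ - 4 * Real.pi * I * m * u))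
    refine h2.congr fun r => ?_
    simp only [Function.comp, fTerm, N, X, Equiv.coe_addRight]
    rw [← mul_div_assoc]
    congr 1
    · rw [← exp_nat_mul, ← exp_add, ← exp_add]
      congr 1
      push_cast
      ring
    · congr 2
      push_cast
      ring
  have hs1 := summable_fTerm hm τ z u
  have h3 : f m u z τ = ∑' r : ℤ, fTerm m τ z r u := rfl
  have hterm : ∀ (l : Fin (2 * m)) (r : ℤ), exp (-Real.pi * I * ((l : ℕ) : ℂ) ^ 2 * τ / (2 * m)
        - 2 * Real.pi * I * ((l : ℕ) : ℂ) * u) *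
      exp (Real.pi * I * ((((l : ℕ) : ℤ) : ℂ) + 2 * m * r) ^ 2 * τ / (2 * m)
      + 2 * Real.pi * I * ((((l : ℕ) : ℤ) : ℂ) + 2 * m * r) * z) = N r * X r ^ (l : ℕ) := by
    intro l r
    simp only [N, X]
    rw [← exp_nat_mul, ← exp_add, ← exp_add]
    congr 1
    push_cast
    field_simp
    ring
  have hsl : ∀ l : Fin (2 * m), Summable fun r : ℤ => N r * X r ^ (l : ℕ) := by
    intro l
    have := (summable_theta_term hm z τ).comp_injective (i := fun k : ℤ => ((l : ℕ) : ℤ) + (2 * m : ℕ) * k) (by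
      intro a b hab
      simp only [add_right_inj] at hab
      exact mul_left_cancel₀ (by exact_mod_cast (by omega : 2 * m ≠ 0)) hab)
    refine (this.mul_left (exp (-Real.pi * I * ((l : ℕ) : ℂ) ^ 2 * τ / (2 * m)
        - 2 * Real.pi * I * ((l : ℕ) : ℂ) * u))).congr fun r => ?_
    rw [← hterm]
    simp
  rw [h1, h3, ← hs1.tsum_sub hs2]
  simp_rw [theta_eq_tsum hm, ← tsum_mul_left, hterm]
  rw [← Summable.tsum_finsetSum fun l _ => hsl l]
  refine tsum_congr fun r => ?_
  have hg := geom_sum_mul (X r) (2 * m)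
  rw [← Finset.mul_sum, Fin.sum_univ_eq_sum_range (fun i => X r ^ i) (2 * m)]
  have := hX r
  have e : fTerm m τ z r u = N r / (1 - X r) := rfl
  rw [e]
  field_simp
  linear_combination N r * hg

/-! ### The completed function `f̃`. -/

lemma fTilde_add_one (m : ℕ) (u z : ℂ) (τ : ℍ) : fTilde m (u + 1) z τ = fTilde m u z τ := by
  simp only [fTilde, f_add_one, R_add_one]

/-- The defect of `f` in `f_add_tau` is exactly half of that of `∑ R θ` obtained from `R_add_tau`.
The resulting multiplier is inverse to that of `φ` in the elliptic law. -/
lemma fTilde_add_tau {m : ℕ} (hm : 0 < m) {u z : ℂ} {τ : ℍ} (h : u - z ∉ lattice τ) :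
    fTilde m (u + τ) z τ = exp (2 * Real.pi * I * m * τ + 4 * Real.pi * I * m * u) * fTilde m u z τ := by
  set e := exp (-2 * Real.pi * I * m * τ - 4 * Real.pi * I * m * u) with he
  have he' : exp (2 * Real.pi * I * m * τ + 4 * Real.pi * I * m * u) * e = 1 := by
    rw [he, ← exp_add, ← exp_zero]; congr 1; ring
  have h1 := f_add_tau hm h
  have h2 : fTilde m u z τ - e * fTilde m (u + τ) z τ = 0 := by
    have h3 : ∑ l : Fin (2 * m), R m (l : ℕ) u τ * theta m (l : ℕ) z τ -
        e * ∑ l : Fin (2 * m), R m (l : ℕ) (u + τ) τ * theta m (l : ℕ) z τ =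
        2 * ∑ l : Fin (2 * m), exp (-Real.pi * I * ((l : ℕ) : ℂ) ^ 2 * τ / (2 * m)
        - 2 * Real.pi * I * ((l : ℕ) : ℂ) * u) * theta m (l : ℕ) z τ := by
      rw [Finset.mul_sum, Finset.mul_sum, ← Finset.sum_sub_distrib]
      refine Finset.sum_congr rfl fun l _ => ?_
      have := R_add_tau hm l u τ
      linear_combination theta m (l : ℕ) z τ * this
    rw [fTilde, fTilde]
    linear_combination h1 - 1 / 2 * h3
  linear_combination (-fTilde m (u + τ) z τ) * he' - exp (2 * Real.pi * I * m * τ + 4 * Real.pi * I * m * u) * h2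

lemma fTilde_T {m : ℕ} (hm : 0 < m) (u z : ℂ) (τ τ' : ℍ) (h : (τ' : ℂ) = τ + 1) :
    fTilde m u z τ' = fTilde m u z τ := by
  rw [fTilde, fTilde, f_T m u z τ τ' h]
  congr 2
  refine Finset.sum_congr rfl fun l _ => ?_
  rw [R_T hm _ u τ τ' h, theta_T hm _ z τ τ' h, mul_mul_mul_comm, ← exp_add]
  have : (-Real.pi * I * (((l : ℕ) : ℤ) : ℂ) ^ 2 / (2 * m) + Real.pi * I * (((l : ℕ) : ℤ) : ℂ) ^ 2 / (2 * m)) = 0 := by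
    ring
  rw [this, exp_zero, one_mul]

lemma analyticAt_fTilde {m : ℕ} (hm : 0 < m) (τ : ℍ) {z u : ℂ} (h : u - z ∉ lattice τ) :
    AnalyticAt ℝ (fun u => fTilde m u z τ) u := by
  unfold fTilde
  refine (analyticAt_f hm τ h).restrictScalars.sub (analyticAt_const.mul ?_)
  exact Finset.analyticAt_fun_sum _ fun l _ => (analyticAt_R hm _ τ u).mul analyticAt_const

/-- The translates of `z` are the zeros of the denominators of `f`. Near `c` only finitely many of
these can vanish, and each has nonzero derivative. -/
lemma eventually_sub_notMem_lattice (τ : ℍ) (z c : ℂ) : ∀ᶠ u in 𝓝[≠] c, u - z ∉ lattice τ := by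
  obtain ⟨s, -, hs⟩ := exists_denominator_bound τ z c
  have h1 : ∀ᶠ u in 𝓝[≠] c, ∀ r ∈ s, exp (2 * Real.pi * I * r * τ + 2 * Real.pi * I * (z - u)) ≠ 1 := by
    rw [Filter.eventually_all_finset]
    intro r _
    have hd : HasDerivAt (fun u : ℂ => exp (2 * Real.pi * I * r * τ + 2 * Real.pi * I * (z - u)))
        (exp (2 * Real.pi * I * r * τ + 2 * Real.pi * I * (z - c)) * (-(2 * Real.pi * I))) c := by
      have h1 : HasDerivAt (fun u : ℂ => 2 * Real.pi * I * r * τ + 2 * Real.pi * I * (z - u)) (-(2 * Real.pi * I)) c := by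
        simpa using (((hasDerivAt_id c).const_sub z).const_mul (2 * Real.pi * I)).const_add (2 * Real.pi * I * r * τ)
      exact h1.cexp
    exact hd.eventually_ne (mul_ne_zero (exp_ne_zero _) (by simp [Real.pi_ne_zero]))
  filter_upwards [h1, nhdsWithin_le_nhds (Metric.ball_mem_nhds c one_pos)] with u hu hub
  rintro ⟨l, n, hln⟩
  have h2 : exp (2 * Real.pi * I * l * τ + 2 * Real.pi * I * (z - u)) = 1 := by
    rw [exp_eq_one_iff]
    exact ⟨-n, by push_cast; linear_combination (-2 * Real.pi * I) * hln⟩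
  by_cases hl : l ∈ s
  · exact hu l hl h2
  · have := hs l hl u hub
    rw [h2, sub_self, norm_zero] at this
    linarith

lemma tendsto_sub_mul_fTilde {m : ℕ} (hm : 0 < m) (τ : ℍ) (z : ℂ) :
    Tendsto (fun u => (u - z) * fTilde m u z τ) (𝓝[≠] z) (𝓝 (2 * Real.pi * I)⁻¹) := by
  have h1 := tendsto_sub_mul_f hm τ z
  have h2 : AnalyticAt ℝ (fun u : ℂ => (u - z) * (1 / 2 * ∑ l : Fin (2 * m), R m (l : ℕ) u τ * theta m (l : ℕ) z τ)) z := by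
    refine (analyticAt_id.sub analyticAt_const).mul (analyticAt_const.mul ?_)
    exact Finset.analyticAt_fun_sum _ fun l _ => (analyticAt_R hm _ τ z).mul analyticAt_const
  have h3 := h2.continuousAt.tendsto.mono_left (nhdsWithin_le_nhds (s := {z}ᶜ))
  rw [sub_self, zero_mul] at h3
  have h4 := h1.sub h3
  rw [sub_zero] at h4
  refine h4.congr fun u => ?_
  rw [fTilde]; ring

/-! ### The Cauchy–Riemann defect -/

lemma crDefect_add {F G : ℂ → ℂ} {v : ℂ} (hF : DifferentiableAt ℝ F v) (hG : DifferentiableAt ℝ G v) :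
    crDefect (fun u => F u + G u) v = crDefect F v + crDefect G v := by
  simp only [crDefect, fderiv_fun_add hF hG, add_apply]
  ring

lemma crDefect_sum {ι : Type*} {s : Finset ι} {F : ι → ℂ → ℂ} {v : ℂ}
    (hF : ∀ i ∈ s, DifferentiableAt ℝ (F i) v) :
    crDefect (fun u => ∑ i ∈ s, F i u) v = ∑ i ∈ s, crDefect (F i) v := by
  simp only [crDefect, fderiv_fun_sum hF, sum_apply, Finset.mul_sum,
    Finset.sum_sub_distrib]

lemma crDefect_eq_zero {F : ℂ → ℂ} {v : ℂ} (hF : DifferentiableAt ℂ F v) : crDefect F v = 0 := by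
  rw [crDefect, hF.fderiv_restrictScalars ℝ]
  simp only [ContinuousLinearMap.coe_restrictScalars']
  have := (fderiv ℂ F v).map_smul I 1
  simp only [smul_eq_mul, mul_one] at this
  rw [this, sub_self]

lemma crDefect_mul {g F : ℂ → ℂ} {v : ℂ} (hg : DifferentiableAt ℂ g v) (hF : DifferentiableAt ℝ F v) :
    crDefect (fun u => g u * F u) v = g v * crDefect F v := by
  have h0 := crDefect_eq_zero hg
  simp only [crDefect] at h0 ⊢
  rw [fderiv_fun_mul (hg.restrictScalars ℝ) hF]
  simp only [add_apply, smul_apply, smul_eq_mul]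
  linear_combination F v * h0

open ComplexConjugate in
-- The defect is a multiple of `∂F/∂v̄`, for which the chain rule with `v ↦ av` gives the factor
-- `conj a`.
lemma crDefect_comp_mul {F : ℂ → ℂ} {a v : ℂ} (hF : DifferentiableAt ℝ F (a * v)) :
    crDefect (fun u => F (a * u)) v = conj a * crDefect F (a * v) := by
  have h1 : HasFDerivAt (fun u : ℂ => a * u) (ContinuousLinearMap.mul ℝ ℂ a) v :=
    (ContinuousLinearMap.mul ℝ ℂ a).hasFDerivAt
  have h2 := (hF.hasFDerivAt.comp v h1).fderiv
  have h3 : (F ∘ fun u => a * u) = fun u => F (a * u) := rfl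
  rw [h3] at h2
  simp only [crDefect, h2, ContinuousLinearMap.comp_apply, ContinuousLinearMap.mul_apply', mul_one]
  set A := fderiv ℝ F (a * v)
  have h4 : ∀ x y : ℝ, A (x + y * I) = x * A 1 + y * A I := by
    intro x y
    have e : (x + y * I : ℂ) = x • (1 : ℂ) + y • I := by simp
    rw [e, map_add, map_smul, map_smul]
    simp
  have e1 : a * I = ((-a.im : ℝ) : ℂ) + (a.re : ℝ) * I := by
    apply Complex.ext <;> simp
  have e2 : conj a = a.re - a.im * I := by apply Complex.ext <;> simp
  have e3 : A a = a.re * A 1 + a.im * A I := by rw [← h4, re_add_im]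
  rw [e1, h4, e3, e2]
  push_cast
  linear_combination (-(a.im * A 1)) * I_sq

lemma differentiableAt_of_crDefect {F : ℂ → ℂ} {v : ℂ} (hF : DifferentiableAt ℝ F v)
    (h : crDefect F v = 0) : DifferentiableAt ℂ F v := by
  rw [differentiableAt_complex_iff_differentiableAt_real]
  refine ⟨hF, ?_⟩
  rw [smul_eq_mul]
  exact sub_eq_zero.1 h

open ComplexConjugate in
-- `f` is holomorphic in `u` off the translates of `z`, so the whole defect comes from the
-- `R`-terms.
lemma crDefect_fTilde {m : ℕ} (hm : 0 < m) (τ : ℍ) {z u : ℂ} (h : u - z ∉ lattice τ) :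
    crDefect (fun u => fTilde m u z τ) u =
      2 * (m * (Real.sqrt (τ.im / m) : ℝ) / τ.im * Real.exp (-4 * Real.pi * m * u.im ^ 2 / τ.im) : ℝ) *
        ∑ l : Fin (2 * m), conj (theta m (l : ℕ) u τ) * theta m (l : ℕ) z τ := by
  have h1 : (fun u => fTilde m u z τ) = fun u => f m u z τ +
      ∑ l : Fin (2 * m), (-(1 / 2) * theta m (l : ℕ) z τ) * R m (l : ℕ) u τ := by
    funext u
    rw [fTilde, Finset.mul_sum, sub_eq_add_neg, ← Finset.sum_neg_distrib]
    congr 1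
    exact Finset.sum_congr rfl fun l _ => by ring
  have hR : ∀ l : ℤ, DifferentiableAt ℝ (fun u => R m l u τ) u := fun l =>
    (analyticAt_R hm l τ u).differentiableAt
  rw [h1, crDefect_add ((analyticAt_f hm τ h).differentiableAt.restrictScalars ℝ)
    (DifferentiableAt.fun_sum fun l _ => (hR _).const_mul _),
    crDefect_eq_zero (analyticAt_f hm τ h).differentiableAt, zero_add,
    crDefect_sum (fun l _ => (hR _).const_mul _), Finset.mul_sum]
  refine Finset.sum_congr rfl fun l _ => ?_
  rw [crDefect_mul (differentiableAt_const _) (hR _), crDefect_R hm]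
  ring

/-! ### Vanishing in negative index, and the inversion law of `f̃`. -/

/-- Riemann's removable singularity theorem along a discrete set. -/
lemma exists_entire_extension {G : ℂ → ℂ} {L : Set ℂ} (hL : ∀ c, ∀ᶠ u in 𝓝[≠] c, u ∉ L)
    (hd : ∀ u ∉ L, DifferentiableAt ℂ G u)
    (hlim : ∀ c ∈ L, Tendsto (fun u => (u - c) * G u) (𝓝[≠] c) (𝓝 0)) :
    ∃ H : ℂ → ℂ, Differentiable ℂ H ∧ ∀ u ∉ L, H u = G u := by
  have hval : ∀ u ∉ L, limUnder (𝓝[≠] u) G = G u := fun u hu =>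
    ((hd u hu).continuousAt.tendsto.mono_left nhdsWithin_le_nhds).limUnder_eq
  refine ⟨fun u => limUnder (𝓝[≠] u) G, fun c => ?_, hval⟩
  by_cases hc : c ∈ L
  · have h1 := hL c
    rw [eventually_nhdsWithin_iff] at h1
    obtain ⟨t, ht, hto, hct⟩ := eventually_nhds_iff.1 h1
    have htn : t ∈ 𝓝 c := hto.mem_nhds hct
    have h2 : DifferentiableOn ℂ G (t \ {c}) := fun u hu =>
      (hd u (ht u hu.1 hu.2)).differentiableWithinAt
    have h3 : (fun z => G z - G c) =o[𝓝[≠] c] fun z => (z - c)⁻¹ := by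
      rw [Asymptotics.isLittleO_iff_tendsto']
      · have h4 : Tendsto (fun u : ℂ => (u - c) * G c) (𝓝[≠] c) (𝓝 0) := by
          have : Tendsto (fun u : ℂ => (u - c) * G c) (𝓝 c) (𝓝 ((c - c) * G c)) :=
            ((continuous_id.sub continuous_const).mul continuous_const).tendsto c
          rw [sub_self, zero_mul] at this
          exact this.mono_left nhdsWithin_le_nhds
        have h5 := (hlim c hc).sub h4
        rw [sub_zero] at h5
        refine h5.congr fun u => ?_
        rw [div_inv_eq_mul]; ring
      · filter_upwards [self_mem_nhdsWithin] with u hu h0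
        exact absurd (inv_eq_zero.1 h0) (sub_ne_zero.2 hu)
    have h6 := differentiableOn_update_limUnder_of_isLittleO htn h2 h3
    refine (h6.differentiableAt htn).congr_of_eventuallyEq ?_
    filter_upwards [htn] with u hu
    by_cases huc : u = c
    · rw [huc, Function.update_self]
    · rw [Function.update_of_ne huc, hval u (ht u hu huc)]
  · refine (hd c hc).congr_of_eventuallyEq ?_
    have h1 := hL c
    rw [eventually_nhdsWithin_iff] at h1
    filter_upwards [h1] with u hu
    by_cases huc : u = c
    · rw [huc]; exact hval c hc
    · exact hval u (hu huc)

lemma dense_compl_of_eventually {L : Set ℂ} (hL : ∀ c, ∀ᶠ u in 𝓝[≠] c, u ∉ L) : Dense Lᶜ := by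
  intro c
  rw [mem_closure_iff_frequently]
  exact ((hL c).frequently).filter_mono nhdsWithin_le_nhds

/-- Coordinates with respect to the basis `τ, 1` of `ℂ` over `ℝ`. -/
lemma eq_coords (τ : ℍ) (u : ℂ) :
    u = (u.im / τ.im : ℝ) * τ + (u.re - u.im / τ.im * τ.re : ℝ) := by
  have hy := τ.im_pos.ne'
  apply Complex.ext
  · simp
  · simp [hy]

lemma exists_lattice_translate (τ : ℍ) (u : ℂ) : ∃ (l n : ℤ) (s t : ℝ), s ∈ Set.Icc (0 : ℝ) 1 ∧
    t ∈ Set.Icc (0 : ℝ) 1 ∧ u = s * τ + t + l * τ + n := by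
  have h := eq_coords τ u
  set a : ℝ := u.im / τ.im
  set b : ℝ := u.re - a * τ.re
  refine ⟨⌊a⌋, ⌊b⌋, Int.fract a, Int.fract b, ⟨Int.fract_nonneg _, (Int.fract_lt_one _).le⟩,
    ⟨Int.fract_nonneg _, (Int.fract_lt_one _).le⟩, ?_⟩
  rw [h, Int.fract, Int.fract]
  push_cast
  ring

/-- An entire function with the transformation law of a theta function of negative index vanishes. -/
lemma eq_zero_of_negative_index {m : ℕ} (hm : 0 < m) (τ : ℍ) {H : ℂ → ℂ} (hH : Differentiable ℂ H)
    (h1 : ∀ u, H (u + 1) = H u)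
    (hτ : ∀ u, H (u + τ) = exp (2 * Real.pi * I * m * τ + 4 * Real.pi * I * m * u) * H u) (u : ℂ) :
    H u = 0 := by
  have hy := τ.im_pos
  have hm' : (m : ℂ) ≠ 0 := by exact_mod_cast hm.ne'
  -- The Gaussian weight compensates the multiplier, so `K` is doubly periodic and hence bounded.
  -- The weight is at least 1, so `H` is bounded too, and Liouville's theorem makes it constant.
  let K : ℂ → ℝ := fun u => ‖H u‖ * Real.exp (2 * Real.pi * m * u.im ^ 2 / τ.im)
  have hK1 : Function.Periodic K 1 := by
    intro u; simp [K, h1]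
  have hKτ : Function.Periodic K τ := by
    intro u
    simp only [K, hτ, norm_mul, norm_exp]
    have e : (2 * Real.pi * I * m * τ + 4 * Real.pi * I * m * u : ℂ).re = -(2 * Real.pi * m * τ.im + 4 * Real.pi * m * u.im) := by
      have : (2 * Real.pi * I * m * τ + 4 * Real.pi * I * m * u : ℂ) =
        ((2 * Real.pi * m : ℝ) : ℂ) * (I * τ) + ((4 * Real.pi * m : ℝ) : ℂ) * (I * u) := by push_cast; ring
      rw [this, add_re, re_ofReal_mul, re_ofReal_mul]
      simp [mul_re]
      ring
    rw [e, mul_right_comm, ← Real.exp_add, mul_comm]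
    congr 2
    rw [add_im, UpperHalfPlane.coe_im]
    field_simp
    ring
  have hKc : Continuous K := by
    have := hH.continuous
    have hi := Complex.continuous_im
    simp only [K]
    fun_prop
  have hcpt : IsCompact ((fun p : ℝ × ℝ => (p.1 * τ + p.2 : ℂ)) '' (Set.Icc 0 1 ×ˢ Set.Icc 0 1)) :=
    (isCompact_Icc.prod isCompact_Icc).image (by fun_prop)
  obtain ⟨C, hC⟩ := hcpt.bddAbove_image hKc.continuousOn
  have hKC : ∀ u, K u ≤ C := by
    intro u
    obtain ⟨l, n, s, t, hs, ht, rfl⟩ := exists_lattice_translate τ u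
    have e1 := (hK1.int_mul n) (s * τ + t + l * τ)
    have e2 := (hKτ.int_mul l) (s * τ + t)
    rw [mul_one] at e1
    rw [e1, e2]
    exact hC ⟨_, ⟨(s, t), ⟨hs, ht⟩, rfl⟩, rfl⟩
  have hbd : Bornology.IsBounded (Set.range H) := by
    rw [isBounded_iff_forall_norm_le]
    refine ⟨C, ?_⟩
    rintro _ ⟨v, rfl⟩
    refine le_trans ?_ (hKC v)
    refine le_mul_of_one_le_right (norm_nonneg _) (Real.one_le_exp ?_)
    have := Real.pi_pos
    positivity
  have hconst := fun v => hH.apply_eq_apply_of_bounded hbd v u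
  -- At this point the multiplier is `e^{πi} = -1`, so the constant equals its own negative.
  have h2 := hτ (-τ / 2 + 1 / (4 * m))
  rw [hconst, hconst (-τ / 2 + 1 / (4 * m))] at h2
  have e : (2 * Real.pi * I * m * τ + 4 * Real.pi * I * m * (-τ / 2 + 1 / (4 * m)) : ℂ) = Real.pi * I := by
    field_simp; ring
  rw [e, exp_pi_mul_I] at h2
  linear_combination h2 / 2

/-- Compares the Gaussians in `f̃` for `τ` and for `-1/τ`, whose imaginary part is `y/|τ|²`; the
discrepancy is accounted for by `|e^{2πimu²/τ}|²`. -/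
lemma im_sq_div (τ : ℍ) (u : ℂ) :
    (u ^ 2 / τ).im + (u / τ).im ^ 2 * normSq τ / τ.im = u.im ^ 2 / τ.im := by
  have hy := τ.im_pos.ne'
  have hN : normSq (τ : ℂ) ≠ 0 := (normSq_pos.2 τ.ne_zero).ne'
  have hN' : normSq (τ : ℂ) = τ.re ^ 2 + τ.im ^ 2 := by rw [normSq_apply]; simp; ring
  rw [div_im, div_im]
  simp only [UpperHalfPlane.coe_re, UpperHalfPlane.coe_im, pow_two u, mul_re, mul_im]
  field_simp
  rw [hN']
  ring

lemma im_neg_inv {τ τ' : ℍ} (h : (τ' : ℂ) = -1 / τ) : τ'.im = τ.im / normSq τ := by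
  rw [← UpperHalfPlane.coe_im, h, neg_div, one_div, neg_im, inv_im]
  simp only [UpperHalfPlane.coe_im]
  ring

lemma sub_mem_lattice_div_iff {τ τ' : ℍ} (h : (τ' : ℂ) = -1 / τ) (w : ℂ) :
    w / τ ∈ lattice τ' ↔ w ∈ lattice τ := by
  have hτ : (τ : ℂ) ≠ 0 := τ.ne_zero
  constructor
  · rintro ⟨l, n, hln⟩
    refine ⟨n, -l, ?_⟩
    rw [h] at hln
    field_simp at hln
    push_cast
    linear_combination hln
  · rintro ⟨l, n, rfl⟩
    refine ⟨-n, l, ?_⟩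
    rw [h]
    field_simp
    push_cast
    ring

lemma fTilde_add_lattice {m : ℕ} (hm : 0 < m) {u z : ℂ} {τ : ℍ} (h : u - z ∉ lattice τ) (l n : ℤ) :
    fTilde m (u + l * τ + n) z τ =
      exp (2 * Real.pi * I * m * ((l : ℂ) ^ 2 * τ + 2 * l * u)) * fTilde m u z τ := by
  have h1 : ∀ (n : ℤ) (v : ℂ), fTilde m (v + n) z τ = fTilde m v z τ := by
    intro n v
    have : Function.Periodic (fun v => fTilde m v z τ) 1 := fun v => fTilde_add_one m v z τ
    have := this.int_mul n v
    simpa using this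
  rw [h1]
  have hmem : ∀ l : ℤ, u + l * τ - z ∉ lattice τ := by
    rintro l ⟨a, b, hab⟩
    exact h ⟨a - l, b, by push_cast; linear_combination hab⟩
  induction l with
  | zero => simp
  | succ i ih =>
    have e : u + ((i : ℤ) + 1 : ℤ) * (τ : ℂ) = (u + (i : ℤ) * τ) + τ := by push_cast; ring
    rw [e, fTilde_add_tau hm (hmem i), ih, ← mul_assoc, ← exp_add]
    congr 2
    push_cast
    ring
  | pred i ih =>
    have e : u + (-(i : ℤ) : ℤ) * (τ : ℂ) = (u + (-(i : ℤ) - 1 : ℤ) * τ) + τ := by push_cast; ring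
    rw [e, fTilde_add_tau hm (hmem _)] at ih
    have h2 : exp (2 * Real.pi * I * m * τ + 4 * Real.pi * I * m * (u + (-(i : ℤ) - 1 : ℤ) * τ)) ≠ 0 := exp_ne_zero _
    refine mul_left_cancel₀ h2 (ih.trans ?_)
    rw [← mul_assoc, ← exp_add]
    congr 2
    push_cast
    ring

open ComplexConjugate in
/-- The behaviour of `f̃` under `τ ↦ -1/τ`. -/
lemma fTilde_S {m : ℕ} (hm : 0 < m) {u z : ℂ} {τ τ' : ℍ} (h : (τ' : ℂ) = -1 / τ) (hu : u - z ∉ lattice τ) :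
    exp (2 * Real.pi * I * m * u ^ 2 / τ) * fTilde m (u / τ) (z / τ) τ' =
      τ * exp (2 * Real.pi * I * m * z ^ 2 / τ) * fTilde m u z τ := by
  have hτ : (τ : ℂ) ≠ 0 := τ.ne_zero
  have hmR : (0 : ℝ) < m := by exact_mod_cast hm
  have hy := τ.im_pos
  let G : ℂ → ℂ := fun u => exp (2 * Real.pi * I * m * u ^ 2 / τ) * fTilde m ((τ : ℂ)⁻¹ * u) (z / τ) τ' +
      (-τ * exp (2 * Real.pi * I * m * z ^ 2 / τ)) * fTilde m u z τ
  let L : Set ℂ := {u | u - z ∈ lattice τ}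
  have hL : ∀ c, ∀ᶠ u in 𝓝[≠] c, u ∉ L := eventually_sub_notMem_lattice τ z
  have hdiv : ∀ u : ℂ, (τ : ℂ)⁻¹ * u - z / τ = (u - z) / τ := fun u => by field_simp
  have hL' : ∀ u ∉ L, (τ : ℂ)⁻¹ * u - z / τ ∉ lattice τ' := by
    intro u hu
    rw [hdiv, sub_mem_lattice_div_iff h]
    exact hu
  -- holomorphy
  have hd : ∀ u ∉ L, DifferentiableAt ℂ G u := by
    intro u hu
    have hF1 : DifferentiableAt ℝ (fun v => fTilde m v (z / τ) τ') ((τ : ℂ)⁻¹ * u) :=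
      (analyticAt_fTilde hm τ' (hL' u hu)).differentiableAt
    have hF1c : DifferentiableAt ℝ (fun v => fTilde m ((τ : ℂ)⁻¹ * v) (z / τ) τ') u :=
      DifferentiableAt.fun_comp' u hF1 (by fun_prop)
    have hF2 : DifferentiableAt ℝ (fun v => fTilde m v z τ) u := (analyticAt_fTilde hm τ hu).differentiableAt
    have he : DifferentiableAt ℂ (fun u : ℂ => exp (2 * Real.pi * I * m * u ^ 2 / τ)) u := by fun_prop
    have he' : DifferentiableAt ℝ (fun u : ℂ => exp (2 * Real.pi * I * m * u ^ 2 / τ)) u := he.restrictScalars ℝ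
    refine differentiableAt_of_crDefect ((he'.mul hF1c).add (hF2.const_mul _)) ?_
    simp only [G]
    rw [crDefect_add (he'.fun_mul hF1c) (hF2.const_mul _), crDefect_mul he hF1c,
      crDefect_mul (differentiableAt_const _) hF2,
      crDefect_comp_mul (F := fun v => fTilde m v (z / τ) τ') hF1, crDefect_fTilde hm τ' (hL' u hu), crDefect_fTilde hm τ hu]
    have hk := theta_kernel_S hm u z τ τ' h
    rw [inv_mul_eq_div, hk, im_neg_inv h]
    set S := ∑ l : Fin (2 * m), conj (theta m (l : ℕ) u τ) * theta m (l : ℕ) z τ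
    have hN : normSq (τ : ℂ) = ‖(τ : ℂ)‖ ^ 2 := normSq_eq_norm_sq _
    have hn : ‖(τ : ℂ)‖ ≠ 0 := norm_ne_zero_iff.2 hτ
    have hn0 : 0 < ‖(τ : ℂ)‖ := norm_pos_iff.2 hτ
    have hsq : Real.sqrt (τ.im / normSq (τ : ℂ) / m) = Real.sqrt (τ.im / m) / ‖(τ : ℂ)‖ := by
      rw [hN, div_right_comm, Real.sqrt_div' _ (by positivity), Real.sqrt_sq hn0.le]
    -- The factor `conj (1/τ)` from the chain rule for `∂̄` combines with `|τ|²` to give the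
    -- automorphy factor `τ`.
    have hcc : conj ((τ : ℂ)⁻¹) * (‖(τ : ℂ)‖ : ℂ) ^ 2 = τ := by
      rw [← ofReal_pow, ← hN, ← mul_conj, map_inv₀]
      have : conj (τ : ℂ) ≠ 0 := by simpa using hτ
      field_simp
    have hexp : exp (2 * Real.pi * I * m * u ^ 2 / τ) * conj (exp (2 * Real.pi * I * m * u ^ 2 / τ)) *
        (Real.exp (-4 * Real.pi * m * (u / τ).im ^ 2 / (τ.im / normSq (τ : ℂ))) : ℝ) =
        (Real.exp (-4 * Real.pi * m * u.im ^ 2 / τ.im) : ℝ) := by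
      rw [mul_conj, normSq_eq_norm_sq, norm_exp, ← Real.exp_nat_mul, ← ofReal_mul, ← Real.exp_add]
      congr 2
      have e : (2 * Real.pi * I * m * u ^ 2 / τ : ℂ).re = -(2 * Real.pi * m) * (u ^ 2 / τ).im := by
        have : (2 * Real.pi * I * m * u ^ 2 / τ : ℂ) = ((2 * Real.pi * m : ℝ) : ℂ) * (I * (u ^ 2 / τ)) := by
          push_cast; ring
        rw [this, re_ofReal_mul]
        simp only [mul_re, I_re, I_im]
        ring
      rw [e]
      have hid := im_sq_div τ u
      have hN0 : normSq (τ : ℂ) ≠ 0 := by rw [hN]; positivity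
      have e2 : (-4 * Real.pi * m * (u / τ).im ^ 2 / (τ.im / normSq (τ : ℂ))) =
        -4 * Real.pi * m * ((u / τ).im ^ 2 * normSq (τ : ℂ) / τ.im) := by field_simp
      have e3 : -4 * Real.pi * m * u.im ^ 2 / τ.im = -4 * Real.pi * m * (u.im ^ 2 / τ.im) := by ring
      rw [e2, e3, ← hid]
      push_cast
      ring
    rw [hsq]
    push_cast at hexp ⊢
    have hnC : (‖(τ : ℂ)‖ : ℂ) ≠ 0 := by exact_mod_cast hn
    have hyC : (τ.im : ℂ) ≠ 0 := by exact_mod_cast hy.ne'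
    have hfac : (Real.sqrt (τ.im / m) / ‖(τ : ℂ)‖ / (τ.im / normSq (τ : ℂ)) * ‖(τ : ℂ)‖ : ℂ) =
        Real.sqrt (τ.im / m) / τ.im * ‖(τ : ℂ)‖ ^ 2 := by
      rw [hN]
      push_cast
      field_simp
    rw [← hexp]
    generalize exp (2 * Real.pi * I * m * u ^ 2 / τ) = A at *
    generalize exp (2 * Real.pi * I * m * z ^ 2 / τ) = B at *
    generalize exp (-4 * Real.pi * m * (u / τ).im ^ 2 / (τ.im / normSq (τ : ℂ))) = C at *
    have hg : (m * (Real.sqrt (τ.im / m) / ‖(τ : ℂ)‖) / (τ.im / normSq (τ : ℂ)) * C * ‖(τ : ℂ)‖ : ℂ) =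
      m * C * (Real.sqrt (τ.im / m) / τ.im * ‖(τ : ℂ)‖ ^ 2) := by rw [← hfac]; ring
    linear_combination (A * conj ((τ : ℂ)⁻¹) * 2 * conj A * B * S) * hg +
      (A * 2 * conj A * B * S * m * C * (Real.sqrt (τ.im / m) / τ.im)) * hcc
  -- quasi-periodicity
  have hLt : ∀ u ∉ L, ∀ a b : ℤ, u + a * τ + b ∉ L := by
    rintro u hu a b ⟨c, d, hcd⟩
    exact hu ⟨c - a, d - b, by push_cast; linear_combination hcd⟩
  have hq : ∀ u ∉ L, ∀ a b : ℤ, G (u + a * τ + b) =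
      exp (2 * Real.pi * I * m * ((a : ℂ) ^ 2 * τ + 2 * a * u)) * G u := by
    intro u hu a b
    simp only [G]
    rw [fTilde_add_lattice hm hu]
    have e1 : (τ : ℂ)⁻¹ * (u + a * τ + b) = (τ : ℂ)⁻¹ * u + (-b : ℤ) * τ' + a := by
      rw [h]; push_cast; field_simp; ring
    rw [e1, fTilde_add_lattice hm (hL' u hu)]
    -- The Gaussian exponential restores the quasi-periods of `τ`: the two exponents differ by `2πi
    -- · 2mab`.
    have e2 : exp (2 * Real.pi * I * m * (u + a * τ + b) ^ 2 / τ) *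
        exp (2 * Real.pi * I * m * (((-b : ℤ) : ℂ) ^ 2 * τ' + 2 * (-b : ℤ) * ((τ : ℂ)⁻¹ * u))) =
        exp (2 * Real.pi * I * m * ((a : ℂ) ^ 2 * τ + 2 * a * u)) * exp (2 * Real.pi * I * m * u ^ 2 / τ) := by
      rw [← exp_add, ← exp_add, exp_eq_exp_iff_exists_int, h]
      refine ⟨2 * m * a * b, ?_⟩
      push_cast
      field_simp
      ring
    linear_combination (fTilde m ((τ : ℂ)⁻¹ * u) (z / τ) τ') * e2
  -- removability at `z`
  have hz : Tendsto (fun u => (u - z) * G u) (𝓝[≠] z) (𝓝 0) := by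
    have t1 := tendsto_sub_mul_fTilde hm τ z
    have t2 := tendsto_sub_mul_fTilde hm τ' (z / τ)
    have hmap : Tendsto (fun u : ℂ => (τ : ℂ)⁻¹ * u) (𝓝[≠] z) (𝓝[≠] (z / τ)) := by
      refine tendsto_nhdsWithin_iff.2 ⟨?_, ?_⟩
      · have : Tendsto (fun u : ℂ => (τ : ℂ)⁻¹ * u) (𝓝 z) (𝓝 ((τ : ℂ)⁻¹ * z)) :=
          (continuous_const.mul continuous_id).tendsto z
        rw [inv_mul_eq_div] at this
        exact this.mono_left nhdsWithin_le_nhds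
      · filter_upwards [self_mem_nhdsWithin] with u hu
        simp only [Set.mem_compl_iff, Set.mem_singleton_iff]
        intro h'
        apply hu
        field_simp at h'
        exact h'
    have t3 := t2.comp hmap
    have he : Tendsto (fun u : ℂ => exp (2 * Real.pi * I * m * u ^ 2 / τ)) (𝓝[≠] z)
        (𝓝 (exp (2 * Real.pi * I * m * z ^ 2 / τ))) := by
      have : Continuous (fun u : ℂ => exp (2 * Real.pi * I * m * u ^ 2 / τ)) := by fun_prop
      exact (this.tendsto z).mono_left nhdsWithin_le_nhds
    -- Writing `u - z = τ (u/τ - z/τ)`, both summands of `G` have the same residue at `z` up to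
    -- sign.
    have t4 := ((he.mul t3).const_mul (τ : ℂ)).add (t1.const_mul (-τ * exp (2 * Real.pi * I * m * z ^ 2 / τ)))
    have e0 : (τ : ℂ) * (exp (2 * Real.pi * I * m * z ^ 2 / τ) * (2 * Real.pi * I)⁻¹) +
      -τ * exp (2 * Real.pi * I * m * z ^ 2 / τ) * (2 * Real.pi * I)⁻¹ = 0 := by ring
    rw [e0] at t4
    refine t4.congr fun u => ?_
    simp only [G, Function.comp, hdiv]
    field_simp
  -- The other translates reduce to `z` by the quasi-periodicity of `G`.
  have hlim : ∀ c ∈ L, Tendsto (fun u => (u - c) * G u) (𝓝[≠] c) (𝓝 0) := by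
    rintro c ⟨a, b, hab⟩
    have hc : c = z + a * τ + b := by linear_combination hab
    have hmap : Tendsto (fun u : ℂ => u - a * τ - b) (𝓝[≠] c) (𝓝[≠] z) := by
      refine tendsto_nhdsWithin_iff.2 ⟨?_, ?_⟩
      · have : Tendsto (fun u : ℂ => u - a * τ - b) (𝓝 c) (𝓝 (c - a * τ - b)) :=
          ((continuous_id.sub continuous_const).sub continuous_const).tendsto c
        have e : c - a * τ - b = z := by rw [hc]; ring
        rw [e] at this
        exact this.mono_left nhdsWithin_le_nhds
      · filter_upwards [self_mem_nhdsWithin] with u hu h'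
        apply hu
        simp only [Set.mem_singleton_iff] at h' ⊢
        rw [hc, ← h']; ring
    have he : Tendsto (fun u : ℂ => exp (2 * Real.pi * I * m * ((a : ℂ) ^ 2 * τ + 2 * a * u))) (𝓝[≠] z)
        (𝓝 (exp (2 * Real.pi * I * m * ((a : ℂ) ^ 2 * τ + 2 * a * z)))) := by
      have : Continuous (fun u : ℂ => exp (2 * Real.pi * I * m * ((a : ℂ) ^ 2 * τ + 2 * a * u))) := by fun_prop
      exact (this.tendsto z).mono_left nhdsWithin_le_nhds
    have t1 := (he.mul hz).comp hmap
    rw [mul_zero] at t1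
    refine t1.congr' ?_
    filter_upwards [hL c] with u hu
    have h1 := hLt u hu (-a) (-b)
    have h2 := hq _ h1 a b
    have e : u + ((-a : ℤ) : ℂ) * τ + ((-b : ℤ) : ℂ) = u - a * τ - b := by push_cast; ring
    rw [e] at h2
    have e2 : u - a * τ - b + a * τ + b = u := by ring
    rw [e2] at h2
    simp only [Function.comp, h2, hc]
    ring
  obtain ⟨H, hH, hHG⟩ := exists_entire_extension hL hd hlim
  have hdense := dense_compl_of_eventually hL
  have hH1 : ∀ u, H (u + 1) = H u := by
    have : (fun u => H (u + 1)) = H := by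
      refine Continuous.ext_on hdense ?_ hH.continuous fun u hu => ?_
      · exact hH.continuous.comp (by fun_prop)
      · have h1 := hLt u hu 0 1
        have h2 := hq u hu 0 1
        simp at h1 h2
        rw [hHG u hu, hHG _ h1, h2]
    exact fun u => congrFun this u
  have hHτ : ∀ u, H (u + τ) = exp (2 * Real.pi * I * m * τ + 4 * Real.pi * I * m * u) * H u := by
    have : (fun u => H (u + τ)) = fun u => exp (2 * Real.pi * I * m * τ + 4 * Real.pi * I * m * u) * H u := by
      have hc := hH.continuous
      refine Continuous.ext_on hdense (hc.comp (by fun_prop)) (by fun_prop) fun u hu => ?_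
      have h1 := hLt u hu 1 0
      have h2 := hq u hu 1 0
      simp only [Int.cast_one, one_mul, Int.cast_zero, add_zero] at h1 h2
      rw [hHG u hu, hHG _ h1, h2]
      congr 2
      ring
    exact fun u => congrFun this u
  have h0 := eq_zero_of_negative_index hm τ hH hH1 hHτ u
  rw [hHG u hu] at h0
  simp only [G, inv_mul_eq_div] at h0
  linear_combination h0

/-! ### Iterated Wirtinger derivatives -/

lemma analyticAt_wirtinger {F : ℂ → ℂ} {u : ℂ} (hF : AnalyticAt ℝ F u) : AnalyticAt ℝ (wirtinger F) u := by
  have h : ∀ w : ℂ, AnalyticAt ℝ (fun v => fderiv ℝ F v w) u := fun w =>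
    ((ContinuousLinearMap.apply ℝ ℂ w).analyticAt _).comp hF.fderiv
  exact analyticAt_const.mul ((h 1).sub (analyticAt_const.mul (h I)))

lemma wirtinger_congr {F G : ℂ → ℂ} {u : ℂ} (h : F =ᶠ[𝓝 u] G) : wirtinger F =ᶠ[𝓝 u] wirtinger G := by
  filter_upwards [h.fderiv (𝕜 := ℝ)] with v hv
  simp only [wirtinger, hv]

lemma iterate_wirtinger_congr {F G : ℂ → ℂ} {u : ℂ} (h : F =ᶠ[𝓝 u] G) (n : ℕ) :
    wirtinger^[n] F =ᶠ[𝓝 u] wirtinger^[n] G := by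
  induction n generalizing F G with
  | zero => exact h
  | succ n ih => exact ih (wirtinger_congr h)

lemma iterate_wirtinger_sum {ι : Type*} {s : Finset ι} {F : ι → ℂ → ℂ} {c : ι → ℂ} {u : ℂ}
    (hF : ∀ i ∈ s, AnalyticAt ℝ (F i) u) (n : ℕ) :
    wirtinger^[n] (fun v => ∑ i ∈ s, c i * F i v) =ᶠ[𝓝 u] fun v => ∑ i ∈ s, c i * wirtinger^[n] (F i) v := by
  induction n generalizing F with
  | zero => exact EventuallyEq.rfl
  | succ n ih =>
    simp only [Function.iterate_succ, Function.comp_apply]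
    have h1 : wirtinger (fun v => ∑ i ∈ s, c i * F i v) =ᶠ[𝓝 u] fun v => ∑ i ∈ s, c i * wirtinger (F i) v := by
      have h2 : ∀ᶠ v in 𝓝 u, ∀ i ∈ s, AnalyticAt ℝ (F i) v := by
        rw [Filter.eventually_all_finset]
        exact fun i hi => (hF i hi).eventually_analyticAt
      filter_upwards [h2] with v hv
      have h3 : ∀ i ∈ s, DifferentiableAt ℝ (fun v => c i * F i v) v := fun i hi =>
        (hv i hi).differentiableAt.const_mul _
      simp only [wirtinger, fderiv_fun_sum h3, sum_apply, Finset.mul_sum,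
        ← Finset.sum_sub_distrib]
      refine Finset.sum_congr rfl fun i hi => ?_
      rw [fderiv_const_mul (hv i hi).differentiableAt]
      simp only [smul_apply, smul_eq_mul]
      ring
    exact (iterate_wirtinger_congr h1 n).trans (ih fun i hi => analyticAt_wirtinger (hF i hi))

lemma iterate_wirtinger_const_mul {F : ℂ → ℂ} {u : ℂ} (hF : AnalyticAt ℝ F u) (c : ℂ) (n : ℕ) :
    wirtinger^[n] (fun v => c * F v) =ᶠ[𝓝 u] fun v => c * wirtinger^[n] F v := by
  have := iterate_wirtinger_sum (s := {()}) (F := fun _ => F) (c := fun _ => c) (u := u) (fun _ _ => hF) n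
  simpa using this

lemma wirtinger_comp_affine {F : ℂ → ℂ} {a b u : ℂ} (hF : DifferentiableAt ℝ F (a * u + b)) :
    wirtinger (fun v => F (a * v + b)) u = a * wirtinger F (a * u + b) := by
  have h1 : HasFDerivAt (fun v : ℂ => a * v + b) (ContinuousLinearMap.mul ℝ ℂ a) u :=
    ((ContinuousLinearMap.mul ℝ ℂ a).hasFDerivAt).add_const b
  have h2 := (hF.hasFDerivAt.comp u h1).fderiv
  have h3 : (F ∘ fun v => a * v + b) = fun v => F (a * v + b) := rfl
  rw [h3] at h2
  simp only [wirtinger, h2, ContinuousLinearMap.comp_apply, ContinuousLinearMap.mul_apply', mul_one]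
  set A := fderiv ℝ F (a * u + b)
  have h4 : ∀ x y : ℝ, A (x + y * I) = x * A 1 + y * A I := by
    intro x y
    have e : (x + y * I : ℂ) = x • (1 : ℂ) + y • I := by simp
    rw [e, map_add, map_smul, map_smul]
    simp
  have e1 : a * I = ((-a.im : ℝ) : ℂ) + (a.re : ℝ) * I := by
    apply Complex.ext <;> simp
  have e3 : A a = a.re * A 1 + a.im * A I := by rw [← h4, re_add_im]
  rw [e1, h4, e3]
  push_cast
  have e4 : a = a.re + a.im * I := (re_add_im a).symm
  linear_combination (-(1 / 2) * (A 1 - I * A I)) * e4 + (1 / 2 * a.im * A I) * I_sq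

lemma iterate_wirtinger_comp_affine {F : ℂ → ℂ} {a b u : ℂ} (hF : AnalyticAt ℝ F (a * u + b)) (n : ℕ) :
    wirtinger^[n] (fun v => F (a * v + b)) =ᶠ[𝓝 u] fun v => a ^ n * wirtinger^[n] F (a * v + b) := by
  have hL : AnalyticAt ℝ (fun v : ℂ => a * v + b) u := by fun_prop
  induction n generalizing F with
  | zero => simp
  | succ n ih =>
    simp only [Function.iterate_succ, Function.comp_apply]
    have h1 : wirtinger (fun v => F (a * v + b)) =ᶠ[𝓝 u] fun v => a * wirtinger F (a * v + b) := by
      have h2 := hL.continuousAt.eventually hF.eventually_analyticAt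
      filter_upwards [h2] with v hv
      exact wirtinger_comp_affine hv.differentiableAt
    have h3 := analyticAt_wirtinger hF
    refine (iterate_wirtinger_congr h1 n).trans ?_
    refine (iterate_wirtinger_const_mul (F := fun v => wirtinger F (a * v + b)) (AnalyticAt.comp (f := fun v => a * v + b) (x := u) h3 hL) a n).trans ?_
    filter_upwards [ih h3] with v hv
    rw [hv]; ring

lemma iterate_wirtinger_of_analyticAt {F : ℂ → ℂ} {u : ℂ} (hF : AnalyticAt ℂ F u) (n : ℕ) :
    wirtinger^[n] F =ᶠ[𝓝 u] iteratedDeriv n F := by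
  rw [iteratedDeriv_eq_iterate]
  induction n generalizing F with
  | zero => exact EventuallyEq.rfl
  | succ n ih =>
    simp only [Function.iterate_succ, Function.comp_apply]
    have h1 : wirtinger F =ᶠ[𝓝 u] deriv F := by
      filter_upwards [hF.eventually_analyticAt] with v hv
      have h2 := crDefect_eq_zero hv.differentiableAt
      have h3 : fderiv ℝ F v 1 = deriv F v := by
        rw [hv.differentiableAt.fderiv_restrictScalars ℝ]
        simp
      rw [crDefect] at h2
      rw [wirtinger, ← h3]
      linear_combination (-(I / 2)) * h2 - (fderiv ℝ F v 1 / 2) * I_sq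
    exact (iterate_wirtinger_congr h1 n).trans (ih hF.deriv)

/-! ### Residues -/

lemma poleOrder_spec {g : ℂ → ℂ} {u : ℂ} (ho : meromorphicOrderAt g u < 0) :
    0 < poleOrder g u ∧ meromorphicOrderAt g u = ((-(poleOrder g u : ℤ) : ℤ) : WithTop ℤ) := by
  have hne : meromorphicOrderAt g u ≠ ⊤ := ne_top_of_lt ho
  lift meromorphicOrderAt g u to ℤ using hne with n hn
  have hn0 : n < 0 := by exact_mod_cast ho
  have : poleOrder g u = (-n).toNat := by rw [poleOrder, ← hn]; simp
  constructor
  · omega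
  · rw [this]
    congr 1
    omega

lemma eventuallyEq_nhds_of_nhdsNE {F G : ℂ → ℂ} {u : ℂ} (hF : ContinuousAt F u) (hG : ContinuousAt G u)
    (h : F =ᶠ[𝓝[≠] u] G) : F =ᶠ[𝓝 u] G :=
  (ContinuousAt.eventuallyEq_nhds_iff_eventuallyEq_nhdsNE hF hG).1 h

lemma clearPole_eventuallyEq (g : ℂ → ℂ) (u : ℂ) :
    ∀ᶠ v in 𝓝[≠] u, clearPole g u v = (v - u) ^ poleOrder g u * g v := by
  filter_upwards [self_mem_nhdsWithin] with v hv
  rw [clearPole, Function.update_of_ne hv]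

lemma analyticAt_clearPole {g : ℂ → ℂ} {u : ℂ} (ho : meromorphicOrderAt g u < 0) :
    AnalyticAt ℂ (clearPole g u) u := by
  have hg : MeromorphicAt g u := meromorphicAt_of_meromorphicOrderAt_ne_zero ho.ne
  obtain ⟨hs, hs'⟩ := poleOrder_spec ho
  obtain ⟨h, hh, -, he⟩ := (meromorphicOrderAt_eq_int_iff hg).1 hs'
  have h1 : ∀ᶠ v in 𝓝[≠] u, (v - u) ^ poleOrder g u * g v = h v := by
    filter_upwards [he, self_mem_nhdsWithin] with v hv hvu
    have : v - u ≠ 0 := sub_ne_zero.2 hvu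
    rw [hv, zpow_neg, zpow_natCast, smul_eq_mul]
    field_simp
  have hlim : limUnder (𝓝[≠] u) (fun v => (v - u) ^ poleOrder g u * g v) = h u := by
    refine Tendsto.limUnder_eq ?_
    exact (hh.continuousAt.tendsto.mono_left nhdsWithin_le_nhds).congr' (h1.mono fun v hv => hv.symm)
  refine hh.congr ?_
  rw [eventually_nhdsWithin_iff] at h1
  filter_upwards [h1] with v hv
  by_cases hvu : v = u
  · rw [clearPole, hvu, Function.update_self, hlim]
  · rw [clearPole, Function.update_of_ne hvu, hv hvu]

lemma res_of_pole (F : ℂ → ℂ) {g : ℂ → ℂ} {u : ℂ} (ho : meromorphicOrderAt g u < 0) :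
    res F g u = 1 / ((poleOrder g u - 1).factorial : ℂ) *
      wirtinger^[poleOrder g u - 1] (fun v => F v * clearPole g u v) u := by
  rw [res, if_neg (poleOrder_spec ho).1.ne']

/-- Linearity in the real-analytic factor. It permits the splitting of `f̃` into its holomorphic
part and its `R`-terms inside a residue. -/
lemma res_sum {ι : Type*} {s : Finset ι} {F : ι → ℂ → ℂ} {c : ι → ℂ} {g : ℂ → ℂ} {u : ℂ}
    (hF : ∀ i ∈ s, AnalyticAt ℝ (F i) u) (ho : meromorphicOrderAt g u < 0) :
    res (fun v => ∑ i ∈ s, c i * F i v) g u = ∑ i ∈ s, c i * res (F i) g u := by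
  have hQ := (analyticAt_clearPole ho).restrictScalars (𝕜 := ℝ)
  simp only [res_of_pole _ ho]
  have h1 : (fun v => (∑ i ∈ s, c i * F i v) * clearPole g u v) =
      fun v => ∑ i ∈ s, c i * (F i v * clearPole g u v) := by
    funext v
    rw [Finset.sum_mul]
    exact Finset.sum_congr rfl fun i _ => by ring
  rw [h1, (iterate_wirtinger_sum (F := fun i v => F i v * clearPole g u v)
    (fun i hi => (hF i hi).mul hQ) _).eq_of_nhds, Finset.mul_sum]
  exact Finset.sum_congr rfl fun i _ => by ring

lemma res_sub {F G : ℂ → ℂ} {g : ℂ → ℂ} {u : ℂ} (hF : AnalyticAt ℝ F u) (hG : AnalyticAt ℝ G u)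
    (ho : meromorphicOrderAt g u < 0) :
    res (fun v => F v - G v) g u = res F g u - res G g u := by
  have := res_sum (s := Finset.univ) (F := ![F, G]) (c := ![1, -1]) (g := g) (u := u)
    (by intro i _; fin_cases i <;> simpa) ho
  simpa [Fin.sum_univ_two, sub_eq_add_neg] using this

/-- Change of variables `w = av + b` in the residue. -/
lemma res_comp_affine {F₁ F₂ g₁ g₂ c : ℂ → ℂ} {a b C u : ℂ} (ha : a ≠ 0)
    (ho : meromorphicOrderAt g₁ u < 0) (hord : meromorphicOrderAt g₂ (a * u + b) = meromorphicOrderAt g₁ u)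
    (hF₁ : AnalyticAt ℝ F₁ u) (hF₂ : AnalyticAt ℝ F₂ (a * u + b))
    (hg : ∀ᶠ v in 𝓝[≠] u, g₂ (a * v + b) = c v * g₁ v)
    (hF : ∀ᶠ v in 𝓝[≠] u, F₂ (a * v + b) * c v = C * F₁ v) :
    res F₂ g₂ (a * u + b) = a * C * res F₁ g₁ u := by
  have ho₂ : meromorphicOrderAt g₂ (a * u + b) < 0 := hord ▸ ho
  have hs : poleOrder g₂ (a * u + b) = poleOrder g₁ u := by rw [poleOrder, poleOrder, hord]
  have hL : AnalyticAt ℂ (fun v : ℂ => a * v + b) u := by fun_prop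
  have hQ₁ := (analyticAt_clearPole ho).restrictScalars (𝕜 := ℝ)
  have hQ₂ := (analyticAt_clearPole ho₂).restrictScalars (𝕜 := ℝ)
  have hLR := hL.restrictScalars (𝕜 := ℝ)
  set s := poleOrder g₁ u with hsdef
  have hspos : 0 < s := (poleOrder_spec ho).1
  have hP : AnalyticAt ℝ (fun w => F₂ w * clearPole g₂ (a * u + b) w) (a * u + b) := hF₂.mul hQ₂
  have hP₁ : AnalyticAt ℝ (fun w => F₁ w * clearPole g₁ u w) u := hF₁.mul hQ₁
  have hmap : Tendsto (fun v : ℂ => a * v + b) (𝓝[≠] u) (𝓝[≠] (a * u + b)) := by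
    refine tendsto_nhdsWithin_iff.2 ⟨hL.continuousAt.tendsto.mono_left nhdsWithin_le_nhds, ?_⟩
    filter_upwards [self_mem_nhdsWithin] with v hv h'
    apply hv
    simpa [ha] using h'
  -- Clearing the pole of order `s` in the variable `av + b` costs `a ^ s`. The `s - 1` derivatives
  -- taken below give back `a ^ (s - 1)`, so a single factor `a` remains, as for the differential
  -- `dv`.
  have key : (fun v => F₂ (a * v + b) * clearPole g₂ (a * u + b) (a * v + b)) =ᶠ[𝓝 u]
      fun v => (a ^ s * C) * (F₁ v * clearPole g₁ u v) := by
    refine eventuallyEq_nhds_of_nhdsNE ?_ ?_ ?_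
    · exact (AnalyticAt.comp (f := fun v => a * v + b) (x := u) hP hLR).continuousAt
    · exact (analyticAt_const.mul hP₁).continuousAt
    · filter_upwards [clearPole_eventuallyEq g₁ u, hmap.eventually (clearPole_eventuallyEq g₂ (a * u + b)),
        hg, hF] with v h1 h2 h3 h4
      rw [h1, h2, h3, hs]
      have e : a * v + b - (a * u + b) = a * (v - u) := by ring
      rw [e, mul_pow]
      linear_combination (a ^ s * (v - u) ^ s * g₁ v) * h4
  have h5 := (iterate_wirtinger_comp_affine hP (s - 1)).eq_of_nhds
  have h6 := (iterate_wirtinger_congr key (s - 1)).eq_of_nhds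
  have h7 := (iterate_wirtinger_const_mul hP₁ (a ^ s * C) (s - 1)).eq_of_nhds
  rw [res_of_pole _ ho₂, res_of_pole _ ho, hs, ← hsdef]
  rw [h6, h7] at h5
  have e : a ^ s = a ^ (s - 1) * a := by rw [← pow_succ, Nat.sub_add_cancel hspos]
  rw [e] at h5
  have h8 : a ^ (s - 1) ≠ 0 := pow_ne_zero _ ha
  have h9 : wirtinger^[s - 1] (fun w => F₂ w * clearPole g₂ (a * u + b) w) (a * u + b) =
      a * C * wirtinger^[s - 1] (fun v => F₁ v * clearPole g₁ u v) u := by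
    refine mul_left_cancel₀ h8 ?_
    linear_combination -h5
  rw [h9]
  ring

/-! ### Poles of meromorphic functions -/

lemma IsMeromorphicFun.eventually_not_pole {g : ℂ → ℂ} (hg : IsMeromorphicFun g) (u : ℂ) :
    ∀ᶠ v in 𝓝[≠] u, ¬ meromorphicOrderAt g v < 0 := by
  filter_upwards [(hg.1 u).eventually_analyticAt] with v hv
  exact not_lt.2 hv.meromorphicOrderAt_nonneg

/-- Poles under a transformation law `g₂(av + b) = c(v) g₁(v)`. -/
lemma meromorphicOrderAt_comp_affine {g₁ g₂ c : ℂ → ℂ} {a b : ℂ} (ha : a ≠ 0)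
    (hg₁ : IsMeromorphicFun g₁) (hg₂ : IsMeromorphicFun g₂)
    (hc : Differentiable ℂ c) (hc0 : ∀ v, c v ≠ 0)
    (h : ∀ v, ¬ meromorphicOrderAt g₁ v < 0 → ¬ meromorphicOrderAt g₂ (a * v + b) < 0 →
      g₂ (a * v + b) = c v * g₁ v) (u : ℂ) :
    meromorphicOrderAt g₂ (a * u + b) = meromorphicOrderAt g₁ u ∧
      ∀ᶠ v in 𝓝[≠] u, g₂ (a * v + b) = c v * g₁ v := by
  have hL : AnalyticAt ℂ (fun v : ℂ => a * v + b) u := by fun_prop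
  have hmap : Tendsto (fun v : ℂ => a * v + b) (𝓝[≠] u) (𝓝[≠] (a * u + b)) := by
    refine tendsto_nhdsWithin_iff.2 ⟨hL.continuousAt.tendsto.mono_left nhdsWithin_le_nhds, ?_⟩
    filter_upwards [self_mem_nhdsWithin] with v hv h'
    apply hv
    simpa [ha] using h'
  have hev : ∀ᶠ v in 𝓝[≠] u, g₂ (a * v + b) = c v * g₁ v := by
    filter_upwards [hg₁.eventually_not_pole u, hmap.eventually (hg₂.eventually_not_pole (a * u + b))] with v h1 h2
    exact h v h1 h2
  refine ⟨?_, hev⟩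
  have hd : deriv (fun v : ℂ => a * v + b) u ≠ 0 := by
    have : HasDerivAt (fun v : ℂ => a * v + b) a u := by
      simpa using ((hasDerivAt_id u).const_mul a).add_const b
    rwa [this.deriv]
  have h1 := meromorphicOrderAt_comp_of_deriv_ne_zero (f := g₂) hL hd
  rw [← h1]
  have h2 : (g₂ ∘ fun v : ℂ => a * v + b) =ᶠ[𝓝[≠] u] c * g₁ := hev
  rw [meromorphicOrderAt_congr h2]
  exact meromorphicOrderAt_mul_of_ne_zero (hc.analyticAt u) (hc0 u)

/-! ### Integrals along quadrilaterals -/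

/-- The integral of `G` along the segment from `a` to `b`. -/
def segInt (G : ℂ → ℂ) (a b : ℂ) : ℂ := ∫ t in (0 : ℝ)..1, (b - a) * G (a + t * (b - a))

lemma add_mul_sub_mem_segment {a b : ℂ} {t : ℝ} (ht : t ∈ Set.Icc (0 : ℝ) 1) :
    a + t * (b - a) ∈ segment ℝ a b := by
  rw [segment_eq_image']
  exact ⟨t, ht, by simp⟩

lemma segInt_congr {G H : ℂ → ℂ} {a b : ℂ} (h : Set.EqOn G H (segment ℝ a b)) :
    segInt G a b = segInt H a b := by
  refine intervalIntegral.integral_congr fun t ht => ?_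
  rw [Set.uIcc_of_le zero_le_one] at ht
  simp only [h (add_mul_sub_mem_segment ht)]

lemma continuousOn_segInt_integrand {G : ℂ → ℂ} {a b : ℂ} (hG : ContinuousOn G (segment ℝ a b)) :
    ContinuousOn (fun t : ℝ => (b - a) * G (a + t * (b - a))) (Set.uIcc 0 1) := by
  rw [Set.uIcc_of_le zero_le_one]
  exact continuousOn_const.mul (hG.comp (by fun_prop) fun t ht => add_mul_sub_mem_segment ht)

lemma segInt_add {G H : ℂ → ℂ} {a b : ℂ} (hG : ContinuousOn G (segment ℝ a b))
    (hH : ContinuousOn H (segment ℝ a b)) :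
    segInt (fun v => G v + H v) a b = segInt G a b + segInt H a b := by
  rw [segInt, segInt, segInt, ← intervalIntegral.integral_add
    (continuousOn_segInt_integrand hG).intervalIntegrable (continuousOn_segInt_integrand hH).intervalIntegrable]
  exact intervalIntegral.integral_congr fun t _ => by ring

lemma segInt_const_mul (c : ℂ) (G : ℂ → ℂ) (a b : ℂ) :
    segInt (fun v => c * G v) a b = c * segInt G a b := by
  rw [segInt, segInt, ← intervalIntegral.integral_const_mul]
  exact intervalIntegral.integral_congr fun t _ => by ring

lemma segInt_eq_sub {G P : ℂ → ℂ} {a b : ℂ} (hG : ContinuousOn G (segment ℝ a b))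
    (hP : ∀ v ∈ segment ℝ a b, HasDerivAt P (G v) v) : segInt G a b = P b - P a := by
  have h1 : ∀ t ∈ Set.uIcc (0 : ℝ) 1, HasDerivAt (fun t : ℝ => P (a + t * (b - a)))
      ((b - a) * G (a + t * (b - a))) t := by
    intro t ht
    rw [Set.uIcc_of_le zero_le_one] at ht
    have h2 : HasDerivAt (fun t : ℂ => a + t * (b - a)) (b - a) (t : ℂ) := by
      simpa using ((hasDerivAt_id (t : ℂ)).mul_const (b - a)).const_add a
    have h3 := (HasDerivAt.comp (t : ℂ) (hP _ (add_mul_sub_mem_segment ht)) h2).comp_ofReal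
    rw [mul_comm]
    exact h3
  rw [segInt, intervalIntegral.integral_eq_sub_of_hasDerivAt h1
    (continuousOn_segInt_integrand hG).intervalIntegrable]
  simp

lemma segInt_symm (G : ℂ → ℂ) (a b : ℂ) : segInt G b a = -segInt G a b := by
  have h := intervalIntegral.integral_comp_sub_left (a := 0) (b := 1)
    (fun t : ℝ => (b - a) * G (a + t * (b - a))) 1
  simp only [sub_zero, sub_self] at h
  rw [segInt, segInt, ← h, ← intervalIntegral.integral_neg]
  refine intervalIntegral.integral_congr fun t _ => ?_
  have e : a + ((1 - t : ℝ) : ℂ) * (b - a) = b + t * (a - b) := by push_cast; ring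
  simp only [e]
  ring

/-- The boundary of the quadrilateral with vertices `a, b, c, d`. -/
def quadBd (a b c d : ℂ) : Set ℂ :=
  segment ℝ a b ∪ segment ℝ b c ∪ segment ℝ c d ∪ segment ℝ d a

/-- The integral along the boundary of the quadrilateral with vertices `a, b, c, d`. -/
def quadInt (G : ℂ → ℂ) (a b c d : ℂ) : ℂ :=
  segInt G a b + segInt G b c + segInt G c d + segInt G d a

section Quad

variable {a b c d : ℂ}

lemma quadBd_subsets : segment ℝ a b ⊆ quadBd a b c d ∧ segment ℝ b c ⊆ quadBd a b c d ∧
    segment ℝ c d ⊆ quadBd a b c d ∧ segment ℝ d a ⊆ quadBd a b c d := by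
  refine ⟨fun x hx => ?_, fun x hx => ?_, fun x hx => ?_, fun x hx => ?_⟩ <;> simp [quadBd, hx]

lemma quadInt_congr {G H : ℂ → ℂ} (h : Set.EqOn G H (quadBd a b c d)) :
    quadInt G a b c d = quadInt H a b c d := by
  obtain ⟨h1, h2, h3, h4⟩ := quadBd_subsets (a := a) (b := b) (c := c) (d := d)
  rw [quadInt, quadInt, segInt_congr (h.mono h1), segInt_congr (h.mono h2), segInt_congr (h.mono h3),
    segInt_congr (h.mono h4)]

lemma quadInt_add {G H : ℂ → ℂ} (hG : ContinuousOn G (quadBd a b c d))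
    (hH : ContinuousOn H (quadBd a b c d)) :
    quadInt (fun v => G v + H v) a b c d = quadInt G a b c d + quadInt H a b c d := by
  obtain ⟨h1, h2, h3, h4⟩ := quadBd_subsets (a := a) (b := b) (c := c) (d := d)
  simp only [quadInt]
  rw [segInt_add (hG.mono h1) (hH.mono h1), segInt_add (hG.mono h2) (hH.mono h2),
    segInt_add (hG.mono h3) (hH.mono h3), segInt_add (hG.mono h4) (hH.mono h4)]
  ring

lemma quadInt_const_mul (k : ℂ) (G : ℂ → ℂ) :
    quadInt (fun v => k * G v) a b c d = k * quadInt G a b c d := by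
  simp only [quadInt, segInt_const_mul]
  ring

lemma quadInt_eq_zero {G P : ℂ → ℂ} (hG : ContinuousOn G (quadBd a b c d))
    (hP : ∀ v ∈ quadBd a b c d, HasDerivAt P (G v) v) : quadInt G a b c d = 0 := by
  obtain ⟨h1, h2, h3, h4⟩ := quadBd_subsets (a := a) (b := b) (c := c) (d := d)
  rw [quadInt, segInt_eq_sub (hG.mono h1) fun v hv => hP v (h1 hv),
    segInt_eq_sub (hG.mono h2) fun v hv => hP v (h2 hv),
    segInt_eq_sub (hG.mono h3) fun v hv => hP v (h3 hv),
    segInt_eq_sub (hG.mono h4) fun v hv => hP v (h4 hv)]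
  ring

lemma continuousOn_inv_sub_pow {s : Set ℂ} {u : ℂ} (hu : u ∉ s) (n : ℕ) :
    ContinuousOn (fun v : ℂ => ((v - u) ^ n)⁻¹) s := by
  refine ContinuousOn.inv₀ (by fun_prop) fun v hv => pow_ne_zero _ (sub_ne_zero.2 ?_)
  rintro rfl
  exact hu hv

lemma quadInt_inv_sub_pow {u : ℂ} (hu : u ∉ quadBd a b c d) (j : ℕ) :
    quadInt (fun v => ((v - u) ^ (j + 2))⁻¹) a b c d = 0 := by
  refine quadInt_eq_zero (P := fun v => -(1 / ((j : ℂ) + 1)) * ((v - u) ^ (j + 1))⁻¹)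
    (continuousOn_inv_sub_pow hu _) fun v hv => ?_
  have hvu : v - u ≠ 0 := sub_ne_zero.2 (by rintro rfl; exact hu hv)
  have h1 : HasDerivAt (fun v : ℂ => (v - u) ^ (j + 1)) (((j + 1 : ℕ) : ℂ) * (v - u) ^ j) v := by
    simpa using ((hasDerivAt_id v).sub_const u).fun_pow (j + 1)
  have h2 := (h1.inv (pow_ne_zero _ hvu)).const_mul (-(1 / ((j : ℂ) + 1)))
  have hj : (j : ℂ) + 1 ≠ 0 := by exact_mod_cast Nat.succ_ne_zero j
  refine HasDerivAt.congr_deriv h2 ?_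
  push_cast
  field_simp
  ring

lemma quadInt_sum {ι : Type*} (s : Finset ι) (F : ι → ℂ → ℂ)
    (hF : ∀ i ∈ s, ContinuousOn (F i) (quadBd a b c d)) :
    quadInt (fun v => ∑ i ∈ s, F i v) a b c d = ∑ i ∈ s, quadInt (F i) a b c d := by
  classical
  induction s using Finset.induction_on with
  | empty => simp [quadInt, segInt]
  | insert i s hi ih =>
    simp only [Finset.sum_insert hi]
    rw [quadInt_add (hF i (Finset.mem_insert_self _ _))
      (continuousOn_finsetSum _ fun j hj => hF j (Finset.mem_insert_of_mem hj)),
      ih fun j hj => hF j (Finset.mem_insert_of_mem hj)]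

/-- `G` is meromorphic at `u` with residue `c` (in terms of its Laurent expansion). -/
def HasRes (G : ℂ → ℂ) (u c : ℂ) : Prop :=
  ∃ (N : ℕ) (α : ℕ → ℂ) (k : ℂ → ℂ), AnalyticAt ℂ k u ∧ ∀ᶠ v in 𝓝[≠] u,
    G v = (∑ j ∈ Finset.range N, α j * ((v - u) ^ (j + 2))⁻¹) + c * (v - u)⁻¹ + k v

/-- The residue theorem for a quadrilateral, with unevaluated winding numbers. -/
lemma quadInt_eq_sum_res {x : ℂ} {ρ : ℝ} (T : Finset ℂ) (C : ℂ → ℂ) {G : ℂ → ℂ}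
    (hbd : quadBd a b c d ⊆ Metric.ball x ρ) (hT : ∀ u ∈ T, u ∉ quadBd a b c d)
    (hG : ∀ v ∈ Metric.ball x ρ, v ∉ T → DifferentiableAt ℂ G v)
    (hres : ∀ u ∈ T, HasRes G u (C u)) :
    quadInt G a b c d = ∑ u ∈ T, C u * quadInt (fun v => (v - u)⁻¹) a b c d := by
  classical
  induction T using Finset.induction_on generalizing G with
  | empty =>
    have hd : DifferentiableOn ℂ G (Metric.ball x ρ) := fun v hv =>
      (hG v hv (by simp)).differentiableWithinAt
    -- With no singularities left, `G` has a primitive on the ball.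
    obtain ⟨P, hP⟩ := hd.isExactOn_ball
    rw [Finset.sum_empty]
    exact quadInt_eq_zero (hd.continuousOn.mono hbd) fun v hv => hP v (hbd hv)
  | insert u T hu ih =>
    obtain ⟨N, α, k, hk, he⟩ := hres u (Finset.mem_insert_self _ _)
    have huB := hT u (Finset.mem_insert_self _ _)
    -- Subtracting the principal part removes the singularity at `u`. Its terms of order at least 2
    -- have primitives away from `u`, so only the term of order 1 contributes to the integral.
    set PP : ℂ → ℂ := fun v => (∑ j ∈ Finset.range N, α j * ((v - u) ^ (j + 2))⁻¹) + C u * (v - u)⁻¹ with hPP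
    have hPPa : ∀ v, v ≠ u → AnalyticAt ℂ PP v := by
      intro v hv
      have h0 : v - u ≠ 0 := sub_ne_zero.2 hv
      have h1 : AnalyticAt ℂ (fun v : ℂ => v - u) v := by fun_prop
      refine (Finset.analyticAt_fun_sum _ fun j _ => analyticAt_const.mul ?_).add
        (analyticAt_const.mul (h1.inv h0))
      exact (h1.pow (j + 2)).inv (pow_ne_zero _ h0)
    let G' : ℂ → ℂ := Function.update (fun v => G v - PP v) u (k u)
    have hG'ne : ∀ v, v ≠ u → G' =ᶠ[𝓝 v] fun v => G v - PP v := by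
      intro v hv
      filter_upwards [isOpen_ne.mem_nhds hv] with w hw
      simp only [G', Function.update_of_ne hw]
    have hG'u : G' =ᶠ[𝓝 u] k := by
      rw [eventually_nhdsWithin_iff] at he
      filter_upwards [he] with w hw
      by_cases hwu : w = u
      · simp only [G', hwu, Function.update_self]
      · simp only [G', Function.update_of_ne hwu, hw hwu, hPP]
        ring
    have hmain := ih (G := G') (fun w hw => hT w (Finset.mem_insert_of_mem hw)) (by
        intro v hv hvT
        by_cases hvu : v = u
        · subst hvu
          exact (hk.congr hG'u.symm).differentiableAt
        · refine DifferentiableAt.congr_of_eventuallyEq ?_ (hG'ne v hvu)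
          exact (hG v hv (by simp [hvu, hvT])).sub (hPPa v hvu).differentiableAt) (by
        intro w hw
        have hwu : w ≠ u := by rintro rfl; exact hu hw
        obtain ⟨N', α', k', hk', he'⟩ := hres w (Finset.mem_insert_of_mem hw)
        refine ⟨N', α', fun v => k' v - PP v, hk'.sub (hPPa w hwu), ?_⟩
        filter_upwards [he', (hG'ne w hwu).filter_mono nhdsWithin_le_nhds] with v h1 h2
        rw [h2, h1]; ring)
    have hPPc : ContinuousOn PP (quadBd a b c d) := fun v hv =>
      (hPPa v (by rintro rfl; exact huB hv)).continuousAt.continuousWithinAt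
    have hGc : ContinuousOn (fun v => G v - PP v) (quadBd a b c d) := by
      refine ContinuousOn.sub (fun v hv => ?_) hPPc
      refine (hG v (hbd hv) fun hvT => hT v hvT hv).continuousAt.continuousWithinAt
    have h1 : quadInt G a b c d = quadInt G' a b c d + quadInt PP a b c d := by
      have h2 : quadInt G' a b c d = quadInt (fun v => G v - PP v) a b c d :=
        quadInt_congr fun v hv => Function.update_of_ne (by rintro rfl; exact huB hv) _ _
      rw [h2, ← quadInt_add hGc hPPc]
      exact quadInt_congr fun v _ => by simp
    have hinv : ContinuousOn (fun v : ℂ => (v - u)⁻¹) (quadBd a b c d) := by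
      have := continuousOn_inv_sub_pow huB 1
      simpa only [pow_one] using this
    have h2 : quadInt PP a b c d = C u * quadInt (fun v => (v - u)⁻¹) a b c d := by
      have hterm : ∀ j ∈ Finset.range N, ContinuousOn (fun v : ℂ => α j * ((v - u) ^ (j + 2))⁻¹) (quadBd a b c d) :=
        fun j _ => continuousOn_const.mul (continuousOn_inv_sub_pow huB _)
      rw [hPP, quadInt_add (continuousOn_finsetSum _ hterm) (continuousOn_const.fun_mul hinv),
        quadInt_sum _ _ hterm, quadInt_const_mul, Finset.sum_eq_zero, zero_add]
      intro j _
      rw [quadInt_const_mul, quadInt_inv_sub_pow huB, mul_zero]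
    rw [h1, hmain, h2, Finset.sum_insert hu, add_comm]

/-- The winding number of a quadrilateral around a point outside an open half plane containing it. -/
lemma quadInt_inv_sub_eq_zero {u ω : ℂ} (ha : 0 < (ω * (a - u)).re) (hb : 0 < (ω * (b - u)).re)
    (hc : 0 < (ω * (c - u)).re) (hd : 0 < (ω * (d - u)).re) :
    quadInt (fun v => (v - u)⁻¹) a b c d = 0 := by
  have hpos : ∀ {x y : ℂ}, 0 < (ω * (x - u)).re → 0 < (ω * (y - u)).re →
      ∀ v ∈ segment ℝ x y, 0 < (ω * (v - u)).re := by
    rintro x y hx hy v ⟨s, t, hs, ht, hst, rfl⟩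
    have e : ω * (s • x + t • y - u) = (s : ℂ) * (ω * (x - u)) + (t : ℂ) * (ω * (y - u)) := by
      have : (s : ℂ) + t = 1 := by exact_mod_cast hst
      simp only [real_smul]
      linear_combination (ω * u) * this
    rw [e, add_re, re_ofReal_mul, re_ofReal_mul]
    rcases hs.eq_or_lt with rfl | hs
    · have : t = 1 := by linarith
      subst this; simpa using hy
    · have := mul_pos hs hx
      have := mul_nonneg ht hy.le
      linarith
  have hall : ∀ v ∈ quadBd a b c d, 0 < (ω * (v - u)).re := by
    rintro v (((hv | hv) | hv) | hv)
    exacts [hpos ha hb v hv, hpos hb hc v hv, hpos hc hd v hv, hpos hd ha v hv]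
  have hne : ∀ v ∈ quadBd a b c d, v - u ≠ 0 := by
    intro v hv h0
    have := hall v hv
    simp [h0] at this
  -- On the boundary `ω (v - u)` stays in the right half plane, where the principal logarithm is
  -- holomorphic.
  refine quadInt_eq_zero (P := fun v => log (ω * (v - u))) ?_ fun v hv => ?_
  · exact ContinuousOn.inv₀ (by fun_prop) hne
  · have h1 : HasDerivAt (fun v : ℂ => ω * (v - u)) ω v := by
      simpa using ((hasDerivAt_id v).sub_const u).const_mul ω
    have h2 := h1.clog (Or.inl (hall v hv))
    refine h2.congr_deriv ?_
    have hω : ω ≠ 0 := by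
      rintro rfl
      have := hall v hv
      simp at this
    have := hne v hv
    field_simp

/-- The quotient `(v - u)/(x - u)` starts at 1 and moves along a segment. It could reach the
negative real axis only by passing through 0, that is, if `u` were on the segment; so its principal
logarithm is a primitive. -/
lemma segInt_inv_sub {x y u : ℂ} (hu : u ∉ segment ℝ x y) :
    segInt (fun v => (v - u)⁻¹) x y = log ((y - u) / (x - u)) := by
  have hx : x - u ≠ 0 := sub_ne_zero.2 (by rintro rfl; exact hu (left_mem_segment ℝ _ _))
  have hne : ∀ v ∈ segment ℝ x y, v - u ≠ 0 := fun v hv =>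
    sub_ne_zero.2 (by rintro rfl; exact hu hv)
  have hslit : ∀ v ∈ segment ℝ x y, (v - u) / (x - u) ∈ slitPlane := by
    intro v hv
    rw [segment_eq_image'] at hv
    obtain ⟨t, ht, rfl⟩ := hv
    by_contra hns
    rw [mem_slitPlane_iff, not_or, not_lt, not_not] at hns
    set w := (y - u) / (x - u) with hw
    have hyw : y - u = w * (x - u) := by rw [hw]; field_simp
    have e : ((fun θ : ℝ => x + θ • (y - x)) t - u) / (x - u) = 1 + (t : ℂ) * (w - 1) := by
      rw [div_eq_iff hx]
      simp only [real_smul]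
      linear_combination (t : ℂ) * hyw
    rw [e] at hns
    simp only [add_re, one_re, re_ofReal_mul, sub_re, add_im, one_im, im_ofReal_mul, sub_im] at hns
    obtain ⟨h1, h2⟩ := hns
    have ht0 : t ≠ 0 := by rintro rfl; norm_num at h1
    have hwim : w.im = 0 := by
      have : t * w.im = 0 := by linarith
      exact (mul_eq_zero.1 this).resolve_left ht0
    have htpos : 0 < t := lt_of_le_of_ne ht.1 (Ne.symm ht0)
    have hwre : w.re - 1 < 0 := by
      by_contra h3
      have := mul_nonneg htpos.le (not_lt.1 h3)
      linarith
    -- The parameter at which the quotient would be 0 and the segment would meet `u`.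
    set t' : ℝ := -1 / (w.re - 1) with ht'
    have ht'pos : 0 ≤ t' := div_nonneg_of_nonpos (by norm_num) hwre.le
    have ht'1 : t' * (w.re - 1) = -1 := by rw [ht']; field_simp [hwre.ne]
    have ht'le : t' ≤ 1 := by
      have h4 : t * (w.re - 1) ≤ t' * (w.re - 1) := by rw [ht'1]; linarith
      have h5 := (mul_le_mul_right_of_neg hwre).1 h4
      exact h5.trans ht.2
    apply hu
    rw [segment_eq_image']
    refine ⟨t', ⟨ht'pos, ht'le⟩, ?_⟩
    have hwr : w = w.re := by apply Complex.ext <;> simp [hwim]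
    have h6 : (t' : ℂ) * (w - 1) = -1 := by rw [hwr]; exact_mod_cast ht'1
    simp only [real_smul]
    linear_combination (x - u) * h6 + t' * hyw
  have h := segInt_eq_sub (G := fun v => (v - u)⁻¹) (P := fun v => log ((v - u) / (x - u)))
    (ContinuousOn.inv₀ (by fun_prop) hne) (fun v hv => by
      have h1 : HasDerivAt (fun v : ℂ => (v - u) / (x - u)) (1 / (x - u)) v := by
        simpa using ((hasDerivAt_id v).sub_const u).div_const (x - u)
      refine (h1.clog (hslit v hv)).congr_deriv ?_
      have := hne v hv
      field_simp)
  rw [h, div_self hx, log_one, sub_zero]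

/-- The winding number of a quadrilateral around a point to the left of all its edges. -/
lemma quadInt_inv_sub_eq_two_pi_I {u : ℂ} (hu : u ∉ quadBd a b c d)
    (hab : 0 < ((b - u) / (a - u)).im) (hbc : 0 < ((c - u) / (b - u)).im)
    (hcd : 0 < ((d - u) / (c - u)).im) (hda : 0 < ((a - u) / (d - u)).im) :
    quadInt (fun v => (v - u)⁻¹) a b c d = 2 * Real.pi * I := by
  obtain ⟨h1, h2, h3, h4⟩ := quadBd_subsets (a := a) (b := b) (c := c) (d := d)
  have hne : ∀ {x : ℂ}, x ∈ quadBd a b c d → x - u ≠ 0 := fun {x} hx =>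
    sub_ne_zero.2 (by rintro rfl; exact hu hx)
  have ha := hne (h1 (left_mem_segment ℝ _ _))
  have hb := hne (h2 (left_mem_segment ℝ _ _))
  have hc := hne (h3 (left_mem_segment ℝ _ _))
  have hd := hne (h4 (left_mem_segment ℝ _ _))
  have harg : ∀ w : ℂ, 0 < w.im → exp (log w) = w ∧ 0 < (log w).im ∧ (log w).im < Real.pi := by
    intro w hw
    have hw0 : w ≠ 0 := by rintro rfl; simp at hw
    refine ⟨exp_log hw0, ?_, ?_⟩
    · rw [log_im]
      refine lt_of_le_of_ne (arg_nonneg_iff.2 hw.le) fun h0 => ?_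
      have := arg_eq_zero_iff.1 h0.symm
      linarith [this.2]
    · rw [log_im]
      refine lt_of_le_of_ne (arg_le_pi w) fun h0 => ?_
      have := arg_eq_pi_iff.1 h0
      linarith [this.2]
  obtain ⟨e1, p1, q1⟩ := harg _ hab
  obtain ⟨e2, p2, q2⟩ := harg _ hbc
  obtain ⟨e3, p3, q3⟩ := harg _ hcd
  obtain ⟨e4, p4, q4⟩ := harg _ hda
  rw [quadInt, segInt_inv_sub fun h => hu (h1 h), segInt_inv_sub fun h => hu (h2 h),
    segInt_inv_sub fun h => hu (h3 h), segInt_inv_sub fun h => hu (h4 h)]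
  set S := log ((b - u) / (a - u)) + log ((c - u) / (b - u)) + log ((d - u) / (c - u)) +
    log ((a - u) / (d - u)) with hS
  have hexp : exp S = 1 := by
    rw [hS, exp_add, exp_add, exp_add, e1, e2, e3, e4]
    field_simp
  obtain ⟨n, hn⟩ := exp_eq_one_iff.1 hexp
  have him : S.im = n * (2 * Real.pi) := by
    rw [hn]; simp
  -- Each of the four logarithms has imaginary part strictly between 0 and `π`, so the only multiple
  -- of `2π` available for the sum is `2π` itself.
  have hlow : 0 < S.im := by rw [hS]; simp only [add_im]; linarith
  have hup : S.im < 4 * Real.pi := by rw [hS]; simp only [add_im]; linarith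
  rw [him] at hlow hup
  have hpi := Real.pi_pos
  have hn1 : n = 1 := by
    have h5 : (0 : ℝ) < n := by
      by_contra h6
      have := mul_nonneg (neg_nonneg.2 (not_lt.1 h6)) (by positivity : (0 : ℝ) ≤ 2 * Real.pi)
      linarith
    have h6 : (n : ℝ) < 2 := by
      by_contra h7
      have := mul_le_mul_of_nonneg_right (not_lt.1 h7) (by positivity : (0 : ℝ) ≤ 2 * Real.pi)
      linarith
    have h7 : (0 : ℤ) < n := by exact_mod_cast h5
    have h8 : n < 2 := by exact_mod_cast h6
    omega
  rw [hn, hn1]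
  push_cast
  ring

end Quad

/-- Taylor expansion of an analytic function with analytic remainder. -/
lemma exists_taylor {h : ℂ → ℂ} {u : ℂ} (hh : AnalyticAt ℂ h u) (N : ℕ) :
    ∃ k : ℂ → ℂ, AnalyticAt ℂ k u ∧ ∀ v,
      h v = (∑ j ∈ Finset.range N, iteratedDeriv j h u / (j.factorial : ℂ) * (v - u) ^ j) + (v - u) ^ N * k v := by
  have hp := hh.hasFPowerSeriesAt
  set p := FormalMultilinearSeries.ofScalars ℂ (fun n => iteratedDeriv n h u / (n.factorial : ℂ)) with hpdef
  -- The remainder after `N` terms is the `N`-fold divided difference at `u`, which is analytic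
  -- because its power series is the shifted one.
  have hk : ∀ N, HasFPowerSeriesAt ((Function.swap dslope u)^[N] h) (FormalMultilinearSeries.fslope^[N] p) u :=
    fun N => hp.has_fpower_series_iterate_dslope_fslope N
  have hk0 : ∀ N, (Function.swap dslope u)^[N] h u = iteratedDeriv N h u / (N.factorial : ℂ) := by
    intro N
    have h1 := (hk N).coeff_zero 1
    have h2 : (FormalMultilinearSeries.fslope^[N] p).coeff 0 = p.coeff N := by
      rw [FormalMultilinearSeries.coeff_iterate_fslope, zero_add]
    rw [← h1]
    change (FormalMultilinearSeries.fslope^[N] p).coeff 0 = _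
    rw [h2, hpdef, FormalMultilinearSeries.coeff_ofScalars]
  refine ⟨(Function.swap dslope u)^[N] h, (hk N).analyticAt, fun v => ?_⟩
  induction N with
  | zero => simp
  | succ N ih =>
    have h1 := sub_smul_dslope ((Function.swap dslope u)^[N] h) u v
    have h2 : (Function.swap dslope u)^[N + 1] h = dslope ((Function.swap dslope u)^[N] h) u := by
      rw [Function.iterate_succ_apply']
    rw [hk0, smul_eq_mul] at h1
    rw [h2, Finset.sum_range_succ, pow_succ]
    linear_combination ih - (v - u) ^ N * h1

lemma HasRes.congr {G H : ℂ → ℂ} {u c : ℂ} (h : HasRes G u c) (he : H =ᶠ[𝓝[≠] u] G) : HasRes H u c := by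
  obtain ⟨N, α, k, hk, h1⟩ := h
  exact ⟨N, α, k, hk, by filter_upwards [h1, he] with v h1 h2; rw [h2, h1]⟩

/-- The residue of `F g` for holomorphic `F` in terms of `res`. -/
lemma hasRes_mul {F g : ℂ → ℂ} {u : ℂ} (hF : AnalyticAt ℂ F u) (ho : meromorphicOrderAt g u < 0) :
    HasRes (fun v => F v * g v) u (res F g u) := by
  have hQ := analyticAt_clearPole ho
  obtain ⟨hs, -⟩ := poleOrder_spec ho
  obtain ⟨n, hn⟩ := Nat.exists_eq_succ_of_ne_zero hs.ne'
  set h : ℂ → ℂ := fun v => F v * clearPole g u v with hh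
  have hha : AnalyticAt ℂ h u := hF.mul hQ
  have hres : res F g u = iteratedDeriv n h u / (n.factorial : ℂ) := by
    rw [res_of_pole _ ho, (iterate_wirtinger_of_analyticAt hha _).eq_of_nhds, hn]
    simp only [Nat.succ_eq_add_one, Nat.add_sub_cancel]
    ring
  obtain ⟨k, hk, hT⟩ := exists_taylor hha (n + 1)
  -- The pole order is `n + 1`: the Taylor coefficient of index `n` is the residue, and the one of
  -- index `n - 1 - j` belongs to `(v - u)^{-(j+2)}`.
  refine ⟨n, fun j => iteratedDeriv (n - 1 - j) h u / ((n - 1 - j).factorial : ℂ), k, hk, ?_⟩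
  filter_upwards [clearPole_eventuallyEq g u, self_mem_nhdsWithin] with v hv hvu
  have h0 : v - u ≠ 0 := sub_ne_zero.2 hvu
  have h1 : h v = F v * ((v - u) ^ (n + 1) * g v) := by rw [hh, ← Nat.succ_eq_add_one, ← hn, ← hv]
  have h2 := hT v
  rw [h1, Finset.sum_range_succ, ← hres,
    ← Finset.sum_range_reflect] at h2
  have h3 : ∑ j ∈ Finset.range n, iteratedDeriv (n - 1 - j) h u / ((n - 1 - j).factorial : ℂ) * (v - u) ^ (n - 1 - j)
      = (v - u) ^ (n + 1) * ∑ j ∈ Finset.range n,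
        iteratedDeriv (n - 1 - j) h u / ((n - 1 - j).factorial : ℂ) * ((v - u) ^ (j + 2))⁻¹ := by
    rw [Finset.mul_sum]
    refine Finset.sum_congr rfl fun j hj => ?_
    have hj' := Finset.mem_range.1 hj
    have e : (v - u) ^ (n + 1) = (v - u) ^ (n - 1 - j) * (v - u) ^ (j + 2) := by
      rw [← pow_add]; congr 1; omega
    rw [e]
    field_simp
  rw [h3] at h2
  have hpow : (v - u) ^ (n + 1) ≠ 0 := pow_ne_zero _ h0
  refine mul_left_cancel₀ hpow ?_
  have e : (v - u) ^ (n + 1) * (v - u)⁻¹ = (v - u) ^ n := by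
    rw [pow_succ]; field_simp
  linear_combination h2 - res F g u * e

/-- The existence of the limit makes `(v - u) G` agree near `u` with a holomorphic function whose
value at `u` is `c`. Dividing its first-order Taylor expansion by `v - u` shows that `G` has at most
a simple pole. -/
lemma hasRes_of_tendsto {G : ℂ → ℂ} {u c : ℂ} (hG : MeromorphicAt G u)
    (h : Tendsto (fun v => (v - u) * G v) (𝓝[≠] u) (𝓝 c)) : HasRes G u c := by
  have hm : MeromorphicAt (fun v => (v - u) * G v) u :=
    MeromorphicAt.mul (by fun_prop) hG
  obtain ⟨g, hg, he⟩ := hm.meromorphicOrderAt_nonneg_iff.1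
    ((tendsto_nhds_iff_meromorphicOrderAt_nonneg hm).1 ⟨c, h⟩)
  have hgc : g u = c := tendsto_nhds_unique
    (hg.continuousAt.tendsto.mono_left nhdsWithin_le_nhds) (h.congr' he)
  obtain ⟨k, hk, hT⟩ := exists_taylor hg 1
  refine ⟨0, fun _ => 0, k, hk, ?_⟩
  filter_upwards [he, self_mem_nhdsWithin] with v hv hvu
  have h0 : v - u ≠ 0 := sub_ne_zero.2 hvu
  have h1 := hT v
  simp [hgc] at h1
  rw [h1] at hv
  simp only [Finset.range_zero, Finset.sum_empty, zero_add]
  refine mul_left_cancel₀ h0 (hv.trans ?_)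
  field_simp

/-! ### Discrete sets -/

lemma finite_inter_compact {L K : Set ℂ} (hL : ∀ c, ∀ᶠ u in 𝓝[≠] c, u ∉ L) (hK : IsCompact K) :
    (L ∩ K).Finite := by
  refine hK.induction_on (p := fun s => (L ∩ s).Finite) (by simp) (fun s t hst ht => ht.subset
    (Set.inter_subset_inter_right _ hst)) (fun s t hs ht => by rw [Set.inter_union_distrib_left]; exact hs.union ht) ?_
  intro c _
  have h := hL c
  rw [eventually_nhdsWithin_iff] at h
  refine ⟨_, mem_nhdsWithin_of_mem_nhds h, (Set.finite_singleton c).subset ?_⟩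
  rintro u ⟨hu1, hu2⟩
  by_contra hne
  exact hu2 hne hu1

lemma countable_of_discrete {L : Set ℂ} (hL : ∀ c, ∀ᶠ u in 𝓝[≠] c, u ∉ L) : L.Countable := by
  have h : L ⊆ ⋃ n : ℕ, L ∩ Metric.closedBall 0 n := by
    intro u hu
    obtain ⟨n, hn⟩ := exists_nat_ge ‖u‖
    exact Set.mem_iUnion.2 ⟨n, hu, by simpa using hn⟩
  exact (Set.countable_iUnion fun n : ℕ => (finite_inter_compact hL (isCompact_closedBall 0 (n : ℝ))).countable).mono h

/-! ### The fundamental parallelogram -/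

/-- The parametrization `(s, t) ↦ p + sτ + t` of the plane. -/
def paraHomeo (τ : ℍ) (p : ℂ) : ℝ × ℝ ≃ₜ ℂ where
  toFun x := p + x.1 * τ + x.2
  invFun u := ((u - p).im / τ.im, (u - p).re - (u - p).im / τ.im * τ.re)
  left_inv x := by
    have hy := τ.im_pos.ne'
    ext <;> simp [hy, add_sub_right_comm]
  right_inv u := by
    have h := eq_coords τ (u - p)
    simp only
    push_cast at h ⊢
    linear_combination -h
  continuous_toFun := by fun_prop
  continuous_invFun := by
    have h1 := Complex.continuous_im
    have h2 := Complex.continuous_re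
    fun_prop

lemma paraHomeo_apply (τ : ℍ) (p : ℂ) (s t : ℝ) : paraHomeo τ p (s, t) = p + s * τ + t := rfl

lemma para_eq_image (τ : ℍ) (p : ℂ) : para τ p = paraHomeo τ p '' (Set.Ioo 0 1 ×ˢ Set.Ioo 0 1) := by
  ext w
  constructor
  · rintro ⟨s, hs, t, ht, rfl⟩
    exact ⟨(s, t), ⟨hs, ht⟩, rfl⟩
  · rintro ⟨⟨s, t⟩, ⟨hs, ht⟩, rfl⟩
    exact ⟨s, hs, t, ht, rfl⟩

lemma mem_para_iff {τ : ℍ} {p : ℂ} {s t : ℝ} :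
    p + s * τ + t ∈ para τ p ↔ s ∈ Set.Ioo (0 : ℝ) 1 ∧ t ∈ Set.Ioo (0 : ℝ) 1 := by
  rw [para_eq_image, ← paraHomeo_apply, (paraHomeo τ p).injective.mem_set_image, Set.mem_prod]

lemma mem_frontier_para_iff {τ : ℍ} {p : ℂ} {s t : ℝ} : p + s * τ + t ∈ frontier (para τ p) ↔
    (s ∈ Set.Icc (0 : ℝ) 1 ∧ (t = 0 ∨ t = 1)) ∨ ((s = 0 ∨ s = 1) ∧ t ∈ Set.Icc (0 : ℝ) 1) := by
  rw [para_eq_image, ← (paraHomeo τ p).image_frontier, ← paraHomeo_apply, (paraHomeo τ p).injective.mem_set_image,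
    frontier_prod_eq, closure_Ioo zero_ne_one, frontier_Ioo zero_lt_one]
  simp

lemma exists_coords (τ : ℍ) (p u : ℂ) : ∃ s t : ℝ, u = p + s * τ + t := by
  obtain ⟨⟨s, t⟩, h⟩ := (paraHomeo τ p).surjective u
  exact ⟨s, t, h.symm⟩

lemma coords_injective {τ : ℍ} {p : ℂ} {s t s' t' : ℝ} (h : p + s * τ + t = p + s' * (τ : ℂ) + t') :
    s = s' ∧ t = t' := by
  have := (paraHomeo τ p).injective (a₁ := (s, t)) (a₂ := (s', t')) h
  simpa using this

/-- There is a parallelogram whose boundary avoids a given countable set. -/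
lemma exists_disjoint_frontier_para (τ : ℍ) {L : Set ℂ} (hL : L.Countable) :
    ∃ p, Disjoint (frontier (para τ p)) L := by
  let σ : ℂ → ℝ × ℝ := (paraHomeo τ 0).symm
  -- The coordinates of `L` are excluded together with their translates by `-1`, so that opposite
  -- sides are avoided at the same time.
  let A : Set ℝ := ((fun u => (σ u).1) '' L) ∪ ((fun u => (σ u).1 - 1) '' L)
  let B : Set ℝ := ((fun u => (σ u).2) '' L) ∪ ((fun u => (σ u).2 - 1) '' L)
  obtain ⟨s₀, hs₀⟩ := (((hL.image _).union (hL.image _) : A.Countable).dense_compl ℝ).nonempty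
  obtain ⟨t₀, ht₀⟩ := (((hL.image _).union (hL.image _) : B.Countable).dense_compl ℝ).nonempty
  refine ⟨s₀ * τ + t₀, Set.disjoint_left.2 fun u hu huL => ?_⟩
  obtain ⟨s, t, rfl⟩ := exists_coords τ (s₀ * τ + t₀) u
  rw [mem_frontier_para_iff] at hu
  have hσ : σ (s₀ * τ + t₀ + s * τ + t) = (s₀ + s, t₀ + t) := by
    rw [← (paraHomeo τ 0).symm_apply_apply (s₀ + s, t₀ + t), paraHomeo_apply]
    simp only [σ]
    congr 1
    push_cast
    ring
  have h1 : s ≠ 0 ∧ s ≠ 1 := by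
    constructor
    · rintro rfl
      exact hs₀ (Or.inl ⟨_, huL, by simp only [hσ]; ring⟩)
    · rintro rfl
      exact hs₀ (Or.inr ⟨_, huL, by simp only [hσ]; ring⟩)
  have h2 : t ≠ 0 ∧ t ≠ 1 := by
    constructor
    · rintro rfl
      exact ht₀ (Or.inl ⟨_, huL, by simp only [hσ]; ring⟩)
    · rintro rfl
      exact ht₀ (Or.inr ⟨_, huL, by simp only [hσ]; ring⟩)
  tauto

/-- The integral along the boundary of `P_p`. -/
def paraInt (G : ℂ → ℂ) (τ : ℍ) (p : ℂ) : ℂ := quadInt G p (p + 1) (p + 1 + τ) (p + τ)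

lemma quadBd_subset_frontier (τ : ℍ) (p : ℂ) :
    quadBd p (p + 1) (p + 1 + τ) (p + τ) ⊆ frontier (para τ p) := by
  have key : ∀ {s t : ℝ} {v : ℂ}, v = p + s * τ + t → ((s ∈ Set.Icc (0 : ℝ) 1 ∧ (t = 0 ∨ t = 1)) ∨
      ((s = 0 ∨ s = 1) ∧ t ∈ Set.Icc (0 : ℝ) 1)) → v ∈ frontier (para τ p) := by
    rintro s t v rfl h
    exact mem_frontier_para_iff.2 h
  rintro v (((hv | hv) | hv) | hv) <;> rw [segment_eq_image'] at hv <;> obtain ⟨θ, hθ, rfl⟩ := hv <;>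
    simp only [real_smul]
  · refine key (s := 0) (t := θ) ?_ (Or.inr ⟨Or.inl rfl, hθ⟩)
    push_cast; ring
  · refine key (s := θ) (t := 1) ?_ (Or.inl ⟨hθ, Or.inr rfl⟩)
    push_cast; ring
  · refine key (s := 1) (t := 1 - θ) ?_ (Or.inr ⟨Or.inr rfl, by constructor <;> linarith [hθ.1, hθ.2]⟩)
    push_cast; ring
  · refine key (s := 1 - θ) (t := 0) ?_ (Or.inl ⟨by constructor <;> linarith [hθ.1, hθ.2], Or.inl rfl⟩)
    push_cast; ring

lemma im_div_pos {z w : ℂ} (h : 0 < (w * starRingEnd ℂ z).im) : 0 < (w / z).im := by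
  have hz : z ≠ 0 := by rintro rfl; simp at h
  have e : w / z = ((normSq z)⁻¹ : ℝ) * (w * starRingEnd ℂ z) := by
    rw [div_eq_mul_inv, inv_def]; ring
  rw [e, im_ofReal_mul]
  exact mul_pos (inv_pos.2 (normSq_pos.2 hz)) h

lemma paraInt_inv_sub_of_mem {τ : ℍ} {p u : ℂ} (hu : u ∈ para τ p) (hf : u ∉ frontier (para τ p)) :
    paraInt (fun v => (v - u)⁻¹) τ p = 2 * Real.pi * I := by
  obtain ⟨s, hs, t, ht, rfl⟩ := hu
  have hy := τ.im_pos
  have h1 := mul_pos hs.1 hy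
  have h2 := mul_pos ht.1 hy
  have h3 := mul_pos (sub_pos.2 hs.2) hy
  have h4 := mul_pos (sub_pos.2 ht.2) hy
  refine quadInt_inv_sub_eq_two_pi_I (fun h => hf (quadBd_subset_frontier τ p h)) ?_ ?_ ?_ ?_ <;>
  · refine im_div_pos ?_
    simp
    nlinarith

lemma paraInt_inv_sub_of_notMem {τ : ℍ} {p u : ℂ} (hu : u ∉ para τ p) (hf : u ∉ frontier (para τ p)) :
    paraInt (fun v => (v - u)⁻¹) τ p = 0 := by
  obtain ⟨s, t, rfl⟩ := exists_coords τ p u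
  rw [mem_para_iff] at hu
  rw [mem_frontier_para_iff] at hf
  have hy := τ.im_pos
  have hcases : s < 0 ∨ 1 < s ∨ t < 0 ∨ 1 < t := by
    by_contra hcon
    push Not at hcon
    obtain ⟨h1, h2, h3, h4⟩ := hcon
    rcases h1.eq_or_lt with h | h1
    · exact hf (Or.inr ⟨Or.inl h.symm, h3, h4⟩)
    rcases h2.eq_or_lt with h | h2
    · exact hf (Or.inr ⟨Or.inr h, h3, h4⟩)
    rcases h3.eq_or_lt with h | h3
    · exact hf (Or.inl ⟨⟨h1.le, h2.le⟩, Or.inl h.symm⟩)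
    rcases h4.eq_or_lt with h | h4
    · exact hf (Or.inl ⟨⟨h1.le, h2.le⟩, Or.inr h⟩)
    exact hu ⟨⟨h1, h2⟩, h3, h4⟩
  -- `ω` rotates the half plane that contains the parallelogram, beyond the line through `u`
  -- parallel to the violated side, onto the right half plane, up to scale. The conjugate of `τ`
  -- handles the slanted sides.
  rcases hcases with h | h | h | h
  · have h1 := mul_pos (neg_pos.2 h) hy
    refine quadInt_inv_sub_eq_zero (ω := -I) ?_ ?_ ?_ ?_ <;> simp <;> nlinarith
  · have h1 := mul_pos (sub_pos.2 h) hy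
    refine quadInt_inv_sub_eq_zero (ω := I) ?_ ?_ ?_ ?_ <;> simp <;> nlinarith
  · have h1 := mul_pos (neg_pos.2 h) hy
    refine quadInt_inv_sub_eq_zero (ω := I * starRingEnd ℂ (τ : ℂ)) ?_ ?_ ?_ ?_ <;> simp <;> nlinarith
  · have h1 := mul_pos (sub_pos.2 h) hy
    refine quadInt_inv_sub_eq_zero (ω := -I * starRingEnd ℂ (τ : ℂ)) ?_ ?_ ?_ ?_ <;> simp <;> nlinarith

lemma isCompact_closure_para (τ : ℍ) (p : ℂ) : IsCompact (closure (para τ p)) := by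
  rw [para_eq_image, ← (paraHomeo τ p).image_closure, closure_prod_eq, closure_Ioo zero_ne_one]
  exact (isCompact_Icc.prod isCompact_Icc).image (paraHomeo τ p).continuous

/-- The residue theorem for `P_p`. -/
lemma paraInt_eq_sum_res {τ : ℍ} {p : ℂ} {L : Set ℂ} {G C : ℂ → ℂ} (hL : ∀ c, ∀ᶠ u in 𝓝[≠] c, u ∉ L)
    (hf : Disjoint (frontier (para τ p)) L) (hG : ∀ v ∉ L, DifferentiableAt ℂ G v)
    (hres : ∀ u ∈ L, HasRes G u (C u)) :
    paraInt G τ p = 2 * Real.pi * I * ∑ᶠ u ∈ L ∩ para τ p, C u := by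
  classical
  obtain ⟨ρ, hρ⟩ := (isCompact_closure_para τ p).isBounded.subset_ball (0 : ℂ)
  -- All singularities in a ball containing the parallelogram are taken into account; those outside
  -- `P_p` have winding number 0.
  have hfin := finite_inter_compact hL (isCompact_closedBall (0 : ℂ) ρ)
  set T := hfin.toFinset with hT
  have hbd := quadBd_subset_frontier τ p
  have h1 := quadInt_eq_sum_res (x := 0) (ρ := ρ) (G := G) T C
    ((hbd.trans frontier_subset_closure).trans hρ)
    (fun u hu huB => Set.disjoint_left.1 hf (hbd huB) (hfin.mem_toFinset.1 hu).1)
    (fun v hv hvT => hG v fun hvL => hvT (hfin.mem_toFinset.2 ⟨hvL, Metric.ball_subset_closedBall hv⟩))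
    (fun u hu => hres u (hfin.mem_toFinset.1 hu).1)
  rw [paraInt, h1]
  have hsub : L ∩ para τ p ⊆ L ∩ Metric.closedBall 0 ρ :=
    Set.inter_subset_inter_right _ ((subset_closure.trans hρ).trans Metric.ball_subset_closedBall)
  have hfin' := hfin.subset hsub
  rw [finsum_mem_eq_finite_toFinset_sum _ hfin', Finset.mul_sum]
  have hsubT : hfin'.toFinset ⊆ T := Set.Finite.toFinset_subset_toFinset.2 hsub
  rw [← Finset.sum_subset hsubT]
  · refine Finset.sum_congr rfl fun u hu => ?_
    have hu' := hfin'.mem_toFinset.1 hu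
    have h2 : u ∉ frontier (para τ p) := fun h => Set.disjoint_left.1 hf h hu'.1
    have := paraInt_inv_sub_of_mem hu'.2 h2
    rw [paraInt] at this
    rw [this, mul_comm]
  · intro u hu hnu
    have hu' := hfin.mem_toFinset.1 hu
    have h2 : u ∉ frontier (para τ p) := fun h => Set.disjoint_left.1 hf h hu'.1
    have h3 : u ∉ para τ p := fun h => hnu (hfin'.mem_toFinset.2 ⟨hu'.1, h⟩)
    have := paraInt_inv_sub_of_notMem h3 h2
    rw [paraInt] at this
    rw [this, mul_zero]

lemma paraInt_of_periodic {G : ℂ → ℂ} {τ : ℍ} {p : ℂ}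
    (h : ∀ t ∈ Set.Icc (0 : ℝ) 1, G (p + t * τ + 1) = G (p + t * τ)) :
    paraInt G τ p = segInt G p (p + 1) - segInt G (p + τ) (p + τ + 1) := by
  have h1 : segInt G (p + 1) (p + 1 + τ) = segInt G p (p + τ) := by
    refine intervalIntegral.integral_congr fun t ht => ?_
    rw [Set.uIcc_of_le zero_le_one] at ht
    have e : p + 1 + t * (p + 1 + τ - (p + 1)) = p + t * τ + 1 := by ring
    have e' : p + t * (p + τ - p) = p + t * τ := by ring
    simp only [e, e', h t ht]
    ring
  have h2 : p + 1 + (τ : ℂ) = p + τ + 1 := by ring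
  rw [paraInt, quadInt, h1, segInt_symm G p (p + τ), h2, segInt_symm G (p + τ) (p + τ + 1)]
  ring

/-! ### The lattice -/

lemma zero_mem_lattice (τ : ℍ) : (0 : ℂ) ∈ lattice τ := ⟨0, 0, by simp⟩

lemma neg_mem_lattice {τ : ℍ} {w : ℂ} (h : w ∈ lattice τ) : -w ∈ lattice τ := by
  obtain ⟨l, n, rfl⟩ := h
  exact ⟨-l, -n, by push_cast; ring⟩

lemma add_mem_lattice {τ : ℍ} {w w' : ℂ} (h : w ∈ lattice τ) (h' : w' ∈ lattice τ) : w + w' ∈ lattice τ := by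
  obtain ⟨l, n, rfl⟩ := h
  obtain ⟨l', n', rfl⟩ := h'
  exact ⟨l + l', n + n', by push_cast; ring⟩

lemma sub_mem_lattice_trans {τ : ℍ} {u v w : ℂ} (h : u - v ∈ lattice τ) (h' : v - w ∈ lattice τ) :
    u - w ∈ lattice τ := by
  simpa using add_mem_lattice h h'

lemma sub_mem_lattice_symm {τ : ℍ} {u v : ℂ} (h : u - v ∈ lattice τ) : v - u ∈ lattice τ := by
  simpa using neg_mem_lattice h

lemma eq_of_mem_para {τ : ℍ} {p w w' : ℂ} (hw : w ∈ para τ p) (hw' : w' ∈ para τ p)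
    (h : w - w' ∈ lattice τ) : w = w' := by
  obtain ⟨s, hs, t, ht, rfl⟩ := hw
  obtain ⟨s', hs', t', ht', rfl⟩ := hw'
  obtain ⟨l, n, hln⟩ := h
  have h1 : p + s * (τ : ℂ) + t = p + (s' + l : ℝ) * (τ : ℂ) + (t' + n : ℝ) := by
    push_cast
    linear_combination hln
  obtain ⟨h2, h3⟩ := coords_injective h1
  have hl : l = 0 := by
    have a1 : (l : ℝ) < 1 := by linarith [hs.2, hs'.1]
    have a2 : (-1 : ℝ) < l := by linarith [hs.1, hs'.2]
    have b1 : l < 1 := by exact_mod_cast a1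
    have b2 : -1 < l := by exact_mod_cast a2
    omega
  have hn : n = 0 := by
    have a1 : (n : ℝ) < 1 := by linarith [ht.2, ht'.1]
    have a2 : (-1 : ℝ) < n := by linarith [ht.1, ht'.2]
    have b1 : n < 1 := by exact_mod_cast a1
    have b2 : -1 < n := by exact_mod_cast a2
    omega
  subst hl hn
  simp [h2, h3]

/-- Fractional parts of the coordinates give a translate in the half-open parallelogram, and the
hypothesis rules out its boundary. -/
lemma exists_mem_para {τ : ℍ} {p u : ℂ} (h : Disjoint (frontier (para τ p)) {v | v - u ∈ lattice τ}) :
    ∃ w ∈ para τ p, w - u ∈ lattice τ := by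
  obtain ⟨s, t, rfl⟩ := exists_coords τ p u
  have hlat : p + (Int.fract s : ℝ) * (τ : ℂ) + (Int.fract t : ℝ) - (p + s * τ + t) ∈ lattice τ := by
    refine ⟨-⌊s⌋, -⌊t⌋, ?_⟩
    simp only [Int.fract]
    push_cast
    ring
  have hnf : p + (Int.fract s : ℝ) * (τ : ℂ) + (Int.fract t : ℝ) ∉ frontier (para τ p) :=
    fun hf => Set.disjoint_left.1 h hf hlat
  rw [mem_frontier_para_iff] at hnf
  refine ⟨_, mem_para_iff.2 ⟨⟨lt_of_le_of_ne (Int.fract_nonneg s) fun h0 => hnf (Or.inr ⟨Or.inl h0.symm, ?_⟩),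
    Int.fract_lt_one s⟩, ⟨lt_of_le_of_ne (Int.fract_nonneg t) fun h0 => hnf (Or.inl ⟨?_, Or.inl h0.symm⟩),
    Int.fract_lt_one t⟩⟩, hlat⟩
  · exact ⟨Int.fract_nonneg t, (Int.fract_lt_one t).le⟩
  · exact ⟨Int.fract_nonneg s, (Int.fract_lt_one s).le⟩

lemma dense_coords (τ : ℍ) {A B : Set ℝ} (hA : A.Countable) (hB : B.Countable) :
    Dense {z : ℂ | ∃ s ∉ A, ∃ t ∉ B, z = s * τ + t} := by
  have h1 : Dense (Aᶜ ×ˢ Bᶜ) := (hA.dense_compl ℝ).prod (hB.dense_compl ℝ)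
  have h2 := (paraHomeo τ 0).surjective.denseRange.dense_image (paraHomeo τ 0).continuous h1
  refine h2.mono ?_
  rintro _ ⟨⟨s, t⟩, ⟨hs, ht⟩, rfl⟩
  exact ⟨s, hs, t, ht, by rw [paraHomeo_apply, zero_add]⟩

/-- The points with no translate on the boundary of `P_p` are dense, also after two such conditions
and after a countable set has been removed. -/
lemma dense_disjoint_frontier_para (τ : ℍ) (p p' : ℂ) {L : Set ℂ} (hL : L.Countable) :
    Dense {z : ℂ | z ∉ L ∧ Disjoint (frontier (para τ p)) {v | v - z ∈ lattice τ} ∧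
      Disjoint (frontier (para τ p')) {v | v - z ∈ lattice τ}} := by
  let σ : ℂ → ℝ × ℝ := (paraHomeo τ 0).symm
  -- Excluding the coordinates of `p` and `p'` modulo `ℤ` keeps every translate of `z` off the
  -- sides. To avoid `L` a condition on the first coordinate is enough.
  let A : Set ℝ := (fun u => (σ u).1) '' L ∪
    (Set.range (fun n : ℤ => (σ p).1 + n) ∪ Set.range (fun n : ℤ => (σ p').1 + n))
  let B : Set ℝ := Set.range (fun n : ℤ => (σ p).2 + n) ∪ Set.range (fun n : ℤ => (σ p').2 + n)
  have hA : A.Countable := (hL.image _).union ((Set.countable_range _).union (Set.countable_range _))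
  have hB : B.Countable := (Set.countable_range _).union (Set.countable_range _)
  have hσ : ∀ s t : ℝ, σ (s * τ + t) = (s, t) := by
    intro s t
    rw [← (paraHomeo τ 0).symm_apply_apply (s, t), paraHomeo_apply, zero_add]
  have key : ∀ (q : ℂ) (s t : ℝ), (∀ n : ℤ, s ≠ (σ q).1 + n) → (∀ n : ℤ, t ≠ (σ q).2 + n) →
      Disjoint (frontier (para τ q)) {v | v - (s * τ + t) ∈ lattice τ} := by
    intro q s t hs ht
    refine Set.disjoint_left.2 fun v hv hvl => ?_
    obtain ⟨l, n, hln⟩ := hvl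
    have hq : (σ q).1 * (τ : ℂ) + (σ q).2 = q := by
      have := (paraHomeo τ 0).apply_symm_apply q
      rw [← Prod.mk.eta (p := (paraHomeo τ 0).symm q), paraHomeo_apply, zero_add] at this
      exact this
    have e : v = q + (s + l - (σ q).1 : ℝ) * (τ : ℂ) + (t + n - (σ q).2 : ℝ) := by
      push_cast
      linear_combination hln + hq
    rw [e, mem_frontier_para_iff] at hv
    rcases hv with ⟨-, h | h⟩ | ⟨h | h, -⟩
    · exact ht (-n) (by push_cast; linarith)
    · exact ht (1 - n) (by push_cast; linarith)
    · exact hs (-l) (by push_cast; linarith)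
    · exact hs (1 - l) (by push_cast; linarith)
  refine (dense_coords τ hA hB).mono ?_
  rintro _ ⟨s, hs, t, ht, rfl⟩
  refine ⟨fun h => hs (Or.inl ⟨_, h, by simp only [hσ]⟩), key p s t (fun n h => ?_) (fun n h => ?_),
    key p' s t (fun n h => ?_) (fun n h => ?_)⟩
  · exact hs (Or.inr (Or.inl ⟨n, h.symm⟩))
  · exact ht (Or.inl ⟨n, h.symm⟩)
  · exact hs (Or.inr (Or.inr ⟨n, h.symm⟩))
  · exact ht (Or.inr ⟨n, h.symm⟩)

/-! ### Poles of meromorphic functions with the elliptic law -/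

section
variable {m : ℕ} {φ : ℂ → ℍ → ℂ}

lemma eventually_notMem_sing (hφ : ∀ τ : ℍ, IsMeromorphicFun (fun z => φ z τ)) (τ : ℍ) (c : ℂ) :
    ∀ᶠ u in 𝓝[≠] c, u ∉ Sing φ τ :=
  (hφ τ).eventually_not_pole c

lemma order_add_lattice (hφ : ∀ τ : ℍ, IsMeromorphicFun (fun z => φ z τ)) (hE : IsElliptic m φ)
    (τ : ℍ) (l n : ℤ) (u : ℂ) :
    meromorphicOrderAt (fun z => φ z τ) (1 * u + (l * τ + n)) = meromorphicOrderAt (fun z => φ z τ) u ∧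
      ∀ᶠ v in 𝓝[≠] u, φ (1 * v + (l * τ + n)) τ
        = exp (-2 * Real.pi * I * m * ((l : ℂ) ^ 2 * τ + 2 * l * v)) * φ v τ := by
  refine meromorphicOrderAt_comp_affine one_ne_zero (hφ τ) (hφ τ) (by fun_prop) (fun v => exp_ne_zero _) ?_ u
  intro v h1 h2
  have e : 1 * v + ((l : ℂ) * τ + n) = v + l * τ + n := by ring
  rw [e] at h2 ⊢
  exact hE τ l n v h1 h2

lemma mem_sing_of_sub_mem_lattice (hφ : ∀ τ : ℍ, IsMeromorphicFun (fun z => φ z τ)) (hE : IsElliptic m φ)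
    {τ : ℍ} {u w : ℂ} (h : w - u ∈ lattice τ) (hu : u ∈ Sing φ τ) : w ∈ Sing φ τ := by
  obtain ⟨l, n, hln⟩ := h
  have := (order_add_lattice hφ hE τ l n u).1
  have e : w = 1 * u + (l * τ + n) := by linear_combination hln
  rw [e]
  exact this.trans_lt hu

/-- The multipliers of `f̃` and `φ` under lattice translations are inverse to each other, so their
product is periodic. As `z` is not a pole of `φ`, no pole of `φ` lies on `z + Λ_τ`, and `f̃` is
real-analytic where the residue is taken. -/
lemma res_fTilde_eq (hm : 0 < m) (hφ : ∀ τ : ℍ, IsMeromorphicFun (fun z => φ z τ)) (hE : IsElliptic m φ)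
    {τ : ℍ} {z u w : ℂ} (hz : z ∉ Sing φ τ) (hu : u ∈ Sing φ τ) (h : w - u ∈ lattice τ) :
    res (fun v => fTilde m v z τ) (fun v => φ v τ) w = res (fun v => fTilde m v z τ) (fun v => φ v τ) u := by
  have hu' : u - z ∉ lattice τ := fun h' => hz (mem_sing_of_sub_mem_lattice hφ hE (sub_mem_lattice_symm h') hu)
  have hw' : w - z ∉ lattice τ := fun h' => hu' (sub_mem_lattice_trans (sub_mem_lattice_symm h) h')
  obtain ⟨l, n, hln⟩ := h
  have e : w = 1 * u + (l * τ + n) := by linear_combination hln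
  obtain ⟨h1, h2⟩ := order_add_lattice hφ hE τ l n u
  rw [e] at hw' ⊢
  have := res_comp_affine (F₁ := fun v => fTilde m v z τ) (F₂ := fun v => fTilde m v z τ) (C := 1) one_ne_zero hu h1
    (analyticAt_fTilde hm τ hu') (analyticAt_fTilde hm τ hw') h2 ?_
  · simpa using this
  · filter_upwards [eventually_sub_notMem_lattice τ z u] with v hv
    have e : 1 * v + ((l : ℂ) * τ + n) = v + l * τ + n := by ring
    rw [e, fTilde_add_lattice hm hv, mul_right_comm, ← exp_add]
    have e : 2 * Real.pi * I * m * ((l : ℂ) ^ 2 * τ + 2 * l * v) +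
      -2 * Real.pi * I * m * ((l : ℂ) ^ 2 * τ + 2 * l * v) = 0 := by ring
    rw [e, exp_zero]

lemma finite_sing_inter_para (hφ : ∀ τ : ℍ, IsMeromorphicFun (fun z => φ z τ)) (τ : ℍ) (p : ℂ) :
    (Sing φ τ ∩ para τ p).Finite :=
  (finite_inter_compact (eventually_notMem_sing hφ τ) (isCompact_closure_para τ p)).subset
    (Set.inter_subset_inter_right _ subset_closure)

lemma isPoleReps_inter_para (hφ : ∀ τ : ℍ, IsMeromorphicFun (fun z => φ z τ)) (hE : IsElliptic m φ)
    {τ : ℍ} {p : ℂ} (hp : IsGoodBase φ τ p) : IsPoleReps φ τ (Sing φ τ ∩ para τ p) := by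
  refine ⟨Set.inter_subset_left, fun u hu => ?_⟩
  have hd : Disjoint (frontier (para τ p)) {v | v - u ∈ lattice τ} :=
    hp.mono_right fun v hv => mem_sing_of_sub_mem_lattice hφ hE hv hu
  obtain ⟨w, hw, hwu⟩ := exists_mem_para hd
  refine ⟨w, ⟨⟨mem_sing_of_sub_mem_lattice hφ hE hwu hu, hw⟩, sub_mem_lattice_symm hwu⟩, ?_⟩
  rintro w' ⟨⟨-, hw'⟩, h⟩
  exact eq_of_mem_para hw' hw (sub_mem_lattice_trans (sub_mem_lattice_symm h) (sub_mem_lattice_symm hwu))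

lemma IsPoleReps.exists_bijOn {τ : ℍ} {S S' : Set ℂ} (hS : IsPoleReps φ τ S) (hS' : IsPoleReps φ τ S') :
    ∃ e : ℂ → ℂ, Set.BijOn e S S' ∧ ∀ u ∈ S, u - e u ∈ lattice τ := by
  have h : ∀ u, ∃ w, u ∈ Sing φ τ → w ∈ S' ∧ u - w ∈ lattice τ := by
    intro u
    by_cases hu : u ∈ Sing φ τ
    · obtain ⟨w, hw, -⟩ := hS'.2 u hu
      exact ⟨w, fun _ => hw⟩
    · exact ⟨0, fun h => absurd h hu⟩
  choose e he using h
  refine ⟨e, ⟨fun u hu => (he u (hS.1 hu)).1, fun u hu v hv huv => ?_, fun w hw => ?_⟩,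
    fun u hu => (he u (hS.1 hu)).2⟩
  · refine (hS.2 u (hS.1 hu)).unique ⟨hu, by simpa using zero_mem_lattice τ⟩ ⟨hv, ?_⟩
    refine sub_mem_lattice_trans (he u (hS.1 hu)).2 (sub_mem_lattice_symm ?_)
    rw [huv]
    exact (he v (hS.1 hv)).2
  · obtain ⟨u, ⟨hu, hwu⟩, -⟩ := hS.2 w (hS'.1 hw)
    refine ⟨u, hu, (hS'.2 w (hS'.1 hw)).unique ⟨(he u (hS.1 hu)).1, ?_⟩ ⟨hw, by simpa using zero_mem_lattice τ⟩⟩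
    exact sub_mem_lattice_trans hwu (he u (hS.1 hu)).2

lemma IsPoleReps.finsum_res_eq (hm : 0 < m) (hφ : ∀ τ : ℍ, IsMeromorphicFun (fun z => φ z τ))
    (hE : IsElliptic m φ) {τ : ℍ} {z : ℂ} (hz : z ∉ Sing φ τ) {S S' : Set ℂ} (hS : IsPoleReps φ τ S)
    (hS' : IsPoleReps φ τ S') :
    ∑ᶠ u ∈ S, res (fun v => fTilde m v z τ) (fun v => φ v τ) u =
      ∑ᶠ u ∈ S', res (fun v => fTilde m v z τ) (fun v => φ v τ) u := by
  obtain ⟨e, he, h⟩ := hS.exists_bijOn hS'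
  exact finsum_mem_eq_of_bijOn e he fun u hu =>
    (res_fTilde_eq hm hφ hE hz (hS.1 hu) (sub_mem_lattice_symm (h u hu))).symm

lemma exists_isGoodBase (hφ : ∀ τ : ℍ, IsMeromorphicFun (fun z => φ z τ)) (τ : ℍ) :
    ∃ p, IsGoodBase φ τ p :=
  exists_disjoint_frontier_para τ (countable_of_discrete (eventually_notMem_sing hφ τ))

lemma IsPoleReps.finite (hφ : ∀ τ : ℍ, IsMeromorphicFun (fun z => φ z τ)) (hE : IsElliptic m φ)
    {τ : ℍ} {S : Set ℂ} (hS : IsPoleReps φ τ S) : S.Finite := by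
  obtain ⟨p, hp⟩ := exists_isGoodBase hφ τ
  obtain ⟨e, he, -⟩ := hS.exists_bijOn (isPoleReps_inter_para hφ hE hp)
  exact he.finite_iff_finite.2 (finite_sing_inter_para hφ τ p)

end

section
/-! ### The decomposition -/

variable {m : ℕ} {φ : ℂ → ℍ → ℂ}

/-- The residue of `f_v(z) φ(v)` at a translate `u` of `z`. -/
lemma hasRes_f_mul (hm : 0 < m) (hφ : ∀ τ : ℍ, IsMeromorphicFun (fun z => φ z τ)) (hE : IsElliptic m φ)
    {τ : ℍ} {z u : ℂ} (hz : z ∉ Sing φ τ) (hu : u - z ∈ lattice τ) :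
    HasRes (fun v => f m v z τ * φ v τ) u (φ z τ * (2 * Real.pi * I)⁻¹) := by
  have hus : u ∉ Sing φ τ := fun h => hz (mem_sing_of_sub_mem_lattice hφ hE (sub_mem_lattice_symm hu) h)
  have hzc : ContinuousAt (fun v => φ v τ) z := ((hφ τ).2 z hz).continuousAt
  have huc : ContinuousAt (fun v => φ v τ) u := ((hφ τ).2 u hus).continuousAt
  refine hasRes_of_tendsto ((meromorphicAt_f hm τ z u).mul ((hφ τ).1 u)) ?_
  -- The limit is computed for `f̃` in place of `f`: the product with `φ` is then periodic and the
  -- limit moves from `z` to its translate `u`. The `R`-terms are continuous and contribute 0.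
  have h1 : Tendsto (fun v => (v - u) * (fTilde m v z τ * φ v τ)) (𝓝[≠] u) (𝓝 (φ z τ * (2 * Real.pi * I)⁻¹)) := by
    obtain ⟨l, n, hln⟩ := hu
    have h2 : Tendsto (fun w => (w - z) * fTilde m w z τ * φ w τ) (𝓝[≠] z) (𝓝 ((2 * Real.pi * I)⁻¹ * φ z τ)) :=
      (tendsto_sub_mul_fTilde hm τ z).mul (hzc.tendsto.mono_left nhdsWithin_le_nhds)
    have h3 : Tendsto (fun v => v - (l * (τ : ℂ) + n)) (𝓝[≠] u) (𝓝[≠] z) := by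
      refine tendsto_nhdsWithin_iff.2 ⟨?_, ?_⟩
      · have : ContinuousAt (fun v : ℂ => v - (l * (τ : ℂ) + n)) u := by fun_prop
        have e : u - (l * (τ : ℂ) + n) = z := by linear_combination hln
        exact (e ▸ this.tendsto).mono_left nhdsWithin_le_nhds
      · filter_upwards [self_mem_nhdsWithin] with v hv h
        exact hv (by rw [Set.mem_singleton_iff] at h ⊢; linear_combination h - hln)
    rw [mul_comm]
    refine (h2.comp h3).congr' ?_
    have h4 := h3.eventually (order_add_lattice hφ hE τ l n z).2
    have h5 := h3.eventually (eventually_sub_notMem_lattice τ z z)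
    filter_upwards [h4, h5] with v h4 h5
    have h6 := fTilde_add_lattice hm h5 l n
    have e1 : v - (l * (τ : ℂ) + n) + l * τ + n = v := by ring
    have e2 : 1 * (v - (l * (τ : ℂ) + n)) + (l * τ + n) = v := by ring
    rw [e1] at h6
    rw [e2] at h4
    set w := v - (l * (τ : ℂ) + n) with hw
    have e3 : exp (2 * Real.pi * I * m * ((l : ℂ) ^ 2 * τ + 2 * l * w)) *
      exp (-2 * Real.pi * I * m * ((l : ℂ) ^ 2 * τ + 2 * l * w)) = 1 := by
      rw [← exp_add, ← exp_zero]; congr 1; ring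
    simp only [Function.comp_apply]
    rw [← hw, h4, h6]
    linear_combination (-(w - z) * fTilde m w z τ * φ w τ) * e3 +
      exp (2 * Real.pi * I * m * ((l : ℂ) ^ 2 * τ + 2 * l * w)) *
      exp (-2 * Real.pi * I * m * ((l : ℂ) ^ 2 * τ + 2 * l * w)) * fTilde m w z τ * φ w τ * (hln + hw)
  have h2 : Tendsto (fun v => (v - u) * (1 / 2 * ∑ l : Fin (2 * m), R m (l : ℕ) v τ * theta m (l : ℕ) z τ) * φ v τ)
      (𝓝[≠] u) (𝓝 0) := by
    have : ContinuousAt (fun v => (v - u) * (1 / 2 * ∑ l : Fin (2 * m), R m (l : ℕ) v τ * theta m (l : ℕ) z τ) *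
        φ v τ) u := by
      refine ContinuousAt.mul (ContinuousAt.mul (by fun_prop) (continuousAt_const.mul ?_)) huc
      exact tendsto_finsetSum _ fun l _ => ((analyticAt_R hm _ τ u).continuousAt.mul continuousAt_const)
    have := this.tendsto.mono_left (nhdsWithin_le_nhds (s := {u}ᶜ))
    simpa using this
  refine ((h1.add h2).congr fun v => ?_).trans (by rw [add_zero])
  rw [fTilde]
  ring

lemma continuousOn_segInt_add_one {G : ℂ → ℂ} {p : ℂ} (h : ∀ t ∈ Set.Icc (0 : ℝ) 1, ContinuousAt G (p + t)) :
    ContinuousOn (fun t : ℝ => G (p + t)) (Set.uIcc (0 : ℝ) 1) := by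
  intro t ht
  rw [Set.uIcc_of_le zero_le_one] at ht
  have := (h t ht).comp (f := fun t : ℝ => p + t) (by fun_prop)
  exact this.continuousWithinAt

/-- The boundary integral of `f_v(z) φ(v)`. -/
lemma paraInt_f_mul (hm : 0 < m) (hφ : ∀ τ : ℍ, IsMeromorphicFun (fun z => φ z τ)) (hE : IsElliptic m φ)
    {τ : ℍ} {z p : ℂ} (hp : IsGoodBase φ τ p) (hz : Disjoint (frontier (para τ p)) {v | v - z ∈ lattice τ}) :
    paraInt (fun v => f m v z τ * φ v τ) τ p = ∑ l : Fin (2 * m),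
      exp (-Real.pi * I * ((l : ℕ) : ℂ) ^ 2 * τ / (2 * m)) *
      (∫ t in (0 : ℝ)..1, φ (p + t) τ * exp (-2 * Real.pi * I * ((l : ℕ) : ℂ) * (p + t))) * theta m (l : ℕ) z τ := by
  have hfr : ∀ {s t : ℝ} {v : ℂ}, v = p + s * τ + t → ((s ∈ Set.Icc (0 : ℝ) 1 ∧ (t = 0 ∨ t = 1)) ∨
      ((s = 0 ∨ s = 1) ∧ t ∈ Set.Icc (0 : ℝ) 1)) → v ∉ Sing φ τ ∧ v - z ∉ lattice τ := by
    rintro s t v rfl h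
    have hf := mem_frontier_para_iff (τ := τ) (p := p).2 h
    exact ⟨Set.disjoint_left.1 hp hf, Set.disjoint_left.1 hz hf⟩
  have hb : ∀ t ∈ Set.Icc (0 : ℝ) 1, p + t ∉ Sing φ τ ∧ p + t - z ∉ lattice τ := fun t ht =>
    hfr (s := 0) (t := t) (by push_cast; ring) (Or.inr ⟨Or.inl rfl, ht⟩)
  have ht' : ∀ t ∈ Set.Icc (0 : ℝ) 1, p + t + τ ∉ Sing φ τ ∧ p + t + τ - z ∉ lattice τ := fun t ht =>
    hfr (s := 1) (t := t) (by push_cast; ring) (Or.inr ⟨Or.inr rfl, ht⟩)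
  have hφc : ∀ v ∉ Sing φ τ, ContinuousAt (fun v => φ v τ) v := fun v hv => ((hφ τ).2 v hv).continuousAt
  have hper : ∀ t ∈ Set.Icc (0 : ℝ) 1, f m (p + t * τ + 1) z τ * φ (p + t * τ + 1) τ =
      f m (p + t * τ) z τ * φ (p + t * τ) τ := by
    intro t ht
    have h1 := (hfr (s := t) (t := 0) (v := p + t * τ) (by push_cast; ring) (Or.inl ⟨ht, Or.inl rfl⟩)).1
    have h2 := (hfr (s := t) (t := 1) (v := p + t * τ + 1) (by push_cast; ring) (Or.inl ⟨ht, Or.inr rfl⟩)).1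
    have e : p + t * τ + ((0 : ℤ) : ℂ) * τ + ((1 : ℤ) : ℂ) = p + t * τ + 1 := by push_cast; ring
    have h3 := hE τ 0 1 (p + t * τ) h1 (by rwa [e])
    rw [e] at h3
    rw [f_add_one, h3]
    simp
  rw [paraInt_of_periodic hper]
  have e1 : segInt (fun v => f m v z τ * φ v τ) p (p + 1) =
      ∫ t in (0 : ℝ)..1, f m (p + t) z τ * φ (p + t) τ := by
    simp only [segInt, add_sub_cancel_left, mul_one, one_mul]
  have e2 : segInt (fun v => f m v z τ * φ v τ) (p + τ) (p + τ + 1) =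
      ∫ t in (0 : ℝ)..1, f m (p + t + τ) z τ * φ (p + t + τ) τ := by
    simp only [segInt, add_sub_cancel_left, mul_one, one_mul]
    simp only [add_right_comm p (τ : ℂ)]
  have i1 : IntervalIntegrable (fun t : ℝ => f m (p + t) z τ * φ (p + t) τ) MeasureTheory.volume 0 1 := by
    refine (continuousOn_segInt_add_one (G := fun v => f m v z τ * φ v τ) fun t ht => ?_).intervalIntegrable
    exact (analyticAt_f hm τ (hb t ht).2).continuousAt.mul (hφc _ (hb t ht).1)
  have i2 : IntervalIntegrable (fun t : ℝ => f m (p + t + τ) z τ * φ (p + t + τ) τ) MeasureTheory.volume 0 1 := by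
    refine (continuousOn_segInt_add_one (G := fun v => f m (v + τ) z τ * φ (v + τ) τ) fun t ht => ?_).intervalIntegrable
    exact ((analyticAt_f hm τ (ht' t ht).2).continuousAt.mul (hφc _ (ht' t ht).1)).comp
      (f := fun v : ℂ => v + τ) (by fun_prop)
  rw [e1, e2, ← intervalIntegral.integral_sub i1 i2]
  -- The multiplier of `φ` on the upper side is the exponential in `f_add_tau`, so the difference of
  -- the two horizontal sides is `φ` times the theta defect of `f`.
  have hI : ∀ t ∈ Set.uIcc (0 : ℝ) 1, f m (p + t) z τ * φ (p + t) τ - f m (p + t + τ) z τ * φ (p + t + τ) τ =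
      ∑ l : Fin (2 * m), (exp (-Real.pi * I * ((l : ℕ) : ℂ) ^ 2 * τ / (2 * m)) * theta m (l : ℕ) z τ) *
        (φ (p + t) τ * exp (-2 * Real.pi * I * ((l : ℕ) : ℂ) * (p + t))) := by
    intro t ht
    rw [Set.uIcc_of_le zero_le_one] at ht
    have e : p + t + ((1 : ℤ) : ℂ) * τ + ((0 : ℤ) : ℂ) = p + t + τ := by push_cast; ring
    have h3 := hE τ 1 0 (p + t) (hb t ht).1 (by rw [e]; exact (ht' t ht).1)
    rw [e] at h3
    have h4 := f_add_tau hm (hb t ht).2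
    have e' : -2 * Real.pi * I * m * (((1 : ℤ) : ℂ) ^ 2 * τ + 2 * ((1 : ℤ) : ℂ) * (p + t)) =
      -2 * Real.pi * I * m * τ - 4 * Real.pi * I * m * (p + t) := by push_cast; ring
    rw [e'] at h3
    rw [h3]
    have h5 : ∑ l : Fin (2 * m), (exp (-Real.pi * I * ((l : ℕ) : ℂ) ^ 2 * τ / (2 * m)) * theta m (l : ℕ) z τ) *
        (φ (p + t) τ * exp (-2 * Real.pi * I * ((l : ℕ) : ℂ) * (p + t))) =
        (∑ l : Fin (2 * m), exp (-Real.pi * I * ((l : ℕ) : ℂ) ^ 2 * τ / (2 * m)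
        - 2 * Real.pi * I * ((l : ℕ) : ℂ) * (p + t)) * theta m (l : ℕ) z τ) * φ (p + t) τ := by
      rw [Finset.sum_mul]
      refine Finset.sum_congr rfl fun l _ => ?_
      rw [sub_eq_add_neg, exp_add]
      have e : -(2 * Real.pi * I * ((l : ℕ) : ℂ) * (p + t)) = -2 * Real.pi * I * ((l : ℕ) : ℂ) * (p + t) := by ring
      rw [e]
      ring
    rw [h5, ← h4]
    ring
  rw [intervalIntegral.integral_congr hI, intervalIntegral.integral_finsetSum]
  · refine Finset.sum_congr rfl fun l _ => ?_
    rw [intervalIntegral.integral_const_mul]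
    ring
  · intro l _
    refine (continuousOn_segInt_add_one (G := fun v => (exp (-Real.pi * I * ((l : ℕ) : ℂ) ^ 2 * τ / (2 * m)) *
      theta m (l : ℕ) z τ) * (φ v τ * exp (-2 * Real.pi * I * ((l : ℕ) : ℂ) * v))) fun t ht => ?_).intervalIntegrable
    exact continuousAt_const.mul ((hφc _ (hb t ht).1).mul (by fun_prop))

/-- The decomposition for a base point `p` such that `P_p` has neither poles nor translates of `z` on
its boundary. -/
lemma decomposition_of_base (hm : 0 < m) (hφ : ∀ τ : ℍ, IsMeromorphicFun (fun z => φ z τ)) (hE : IsElliptic m φ)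
    {τ : ℍ} {z p : ℂ} (hp : IsGoodBase φ τ p) (hzs : z ∉ Sing φ τ)
    (hz : Disjoint (frontier (para τ p)) {v | v - z ∈ lattice τ}) :
    φ z τ = ∑ l : Fin (2 * m), coeff m φ (l : ℕ) τ p * theta m (l : ℕ) z τ - 2 * Real.pi * I *
      ∑ᶠ u ∈ Sing φ τ ∩ para τ p, res (fun v => fTilde m v z τ) (fun v => φ v τ) u := by
  classical
  set Z : Set ℂ := {v | v - z ∈ lattice τ} with hZ
  have hdisj : Disjoint (Sing φ τ) Z := Set.disjoint_left.2 fun v hv hvz =>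
    hzs (mem_sing_of_sub_mem_lattice hφ hE (sub_mem_lattice_symm hvz) hv)
  let C : ℂ → ℂ := fun u => if u ∈ Sing φ τ then res (fun v => f m v z τ) (fun v => φ v τ) u
    else φ z τ * (2 * Real.pi * I)⁻¹
  have h1 : paraInt (fun v => f m v z τ * φ v τ) τ p =
      2 * Real.pi * I * ∑ᶠ u ∈ (Sing φ τ ∪ Z) ∩ para τ p, C u := by
    refine paraInt_eq_sum_res ?_ (hp.union_right hz) ?_ ?_
    · intro c
      filter_upwards [eventually_notMem_sing hφ τ c, eventually_sub_notMem_lattice τ z c] with u hu hu'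
      exact fun h => h.elim hu hu'
    · intro v hv
      rw [Set.mem_union, not_or] at hv
      exact (analyticAt_f hm τ hv.2).differentiableAt.mul ((hφ τ).2 v hv.1).differentiableAt
    · rintro u (hu | hu)
      · simp only [C, if_pos hu]
        exact hasRes_mul (analyticAt_f hm τ fun h => Set.disjoint_left.1 hdisj hu h) hu
      · simp only [C, if_neg fun h => Set.disjoint_left.1 hdisj h hu]
        exact hasRes_f_mul hm hφ hE hzs hu
  obtain ⟨w, hw, hwz⟩ := exists_mem_para hz
  -- Exactly one translate of `z` lies in `P_p`; it contributes `φ(z)/(2πi)`.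
  have hZp : Z ∩ para τ p = {w} := by
    ext v
    refine ⟨fun hv => eq_of_mem_para hv.2 hw (sub_mem_lattice_trans hv.1 (sub_mem_lattice_symm hwz)), ?_⟩
    rintro rfl
    exact ⟨hwz, hw⟩
  have hfin := finite_sing_inter_para hφ τ p
  have h2 : ∑ᶠ u ∈ (Sing φ τ ∪ Z) ∩ para τ p, C u =
      ∑ᶠ u ∈ Sing φ τ ∩ para τ p, res (fun v => f m v z τ) (fun v => φ v τ) u + φ z τ * (2 * Real.pi * I)⁻¹ := by
    rw [Set.union_inter_distrib_right, finsum_mem_union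
      (hdisj.mono Set.inter_subset_left Set.inter_subset_left) hfin (by rw [hZp]; exact Set.finite_singleton w),
      hZp, finsum_mem_singleton]
    congr 1
    · exact finsum_mem_congr rfl fun u hu => if_pos hu.1
    · exact if_neg fun h => Set.disjoint_left.1 hdisj h hwz
  have h3 : ∀ u ∈ Sing φ τ, res (fun v => fTilde m v z τ) (fun v => φ v τ) u =
      res (fun v => f m v z τ) (fun v => φ v τ) u - ∑ l : Fin (2 * m), 1 / 2 * theta m (l : ℕ) z τ *
        res (fun v => R m (l : ℕ) v τ) (fun v => φ v τ) u := by
    intro u hu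
    have hR : ∀ l ∈ (Finset.univ : Finset (Fin (2 * m))), AnalyticAt ℝ (fun v => R m (l : ℕ) v τ) u :=
      fun l _ => analyticAt_R hm _ τ u
    have hR' : AnalyticAt ℝ (fun v => ∑ l : Fin (2 * m), 1 / 2 * theta m (l : ℕ) z τ * R m (l : ℕ) v τ) u :=
      Finset.analyticAt_fun_sum _ fun l hl => analyticAt_const.mul (hR l hl)
    rw [← res_sum hR hu, ← res_sub (analyticAt_f hm τ fun h => Set.disjoint_left.1 hdisj hu h).restrictScalars hR' hu]
    congr 1
    funext v
    rw [fTilde, Finset.mul_sum]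
    congr 1
    exact Finset.sum_congr rfl fun l _ => by ring
  rw [h2, paraInt_f_mul hm hφ hE hp hz] at h1
  have h4 : ∑ᶠ u ∈ Sing φ τ ∩ para τ p, res (fun v => fTilde m v z τ) (fun v => φ v τ) u =
      ∑ᶠ u ∈ Sing φ τ ∩ para τ p, res (fun v => f m v z τ) (fun v => φ v τ) u -
        ∑ l : Fin (2 * m), 1 / 2 * theta m (l : ℕ) z τ *
          ∑ᶠ u ∈ Sing φ τ ∩ para τ p, res (fun v => R m (l : ℕ) v τ) (fun v => φ v τ) u := by
    simp only [finsum_mem_eq_finite_toFinset_sum _ hfin, Finset.mul_sum]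
    rw [Finset.sum_comm, ← Finset.sum_sub_distrib]
    exact Finset.sum_congr rfl fun u hu => h3 u (hfin.mem_toFinset.1 hu).1
  rw [h4]
  simp only [coeff, sub_mul, Finset.sum_sub_distrib, Int.cast_natCast]
  rw [h1, mul_sub, mul_add, Finset.mul_sum]
  have hpi : (2 * Real.pi * I) * (2 * Real.pi * I)⁻¹ = 1 := mul_inv_cancel₀ two_pi_I_ne_zero
  have h5 : ∑ l : Fin (2 * m), 2 * Real.pi * I * (1 / 2 * theta m (l : ℕ) z τ *
      ∑ᶠ u ∈ Sing φ τ ∩ para τ p, res (fun v => R m (l : ℕ) v τ) (fun v => φ v τ) u) =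
      ∑ l : Fin (2 * m), Real.pi * I * (∑ᶠ u ∈ Sing φ τ ∩ para τ p,
        res (fun v => R m (l : ℕ) v τ) (fun v => φ v τ) u) * theta m (l : ℕ) z τ :=
    Finset.sum_congr rfl fun l _ => by ring
  rw [h5]
  linear_combination -φ z τ * hpi

lemma eq_zero_of_dense_sum_theta_eq_zero (hm : 0 < m) (τ : ℍ) {c : Fin (2 * m) → ℂ} {D : Set ℂ} (hD : Dense D)
    (h : ∀ z ∈ D, ∑ l, c l * theta m (l : ℕ) z τ = 0) : c = 0 := by
  have hc : Continuous fun z => ∑ l, c l * theta m (l : ℕ) z τ :=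
    continuous_finsetSum _ fun l _ => continuous_const.mul (differentiable_theta hm l τ).continuous
  have h0 := hc.ext_on hD continuous_const h
  exact theta_linearIndependent hm τ c fun x => congrFun h0 x

/-- The residue sums of `f̃φ` over the two parallelograms agree, as both run over representatives of
the poles. So the two theta parts agree on a dense set of `z`, and linear independence applies. -/
lemma coeff_eq_coeff (hm : 0 < m) (hφ : ∀ τ : ℍ, IsMeromorphicFun (fun z => φ z τ)) (hE : IsElliptic m φ)
    {τ : ℍ} {p p' : ℂ} (hp : IsGoodBase φ τ p) (hp' : IsGoodBase φ τ p') (l : Fin (2 * m)) :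
    coeff m φ (l : ℕ) τ p = coeff m φ (l : ℕ) τ p' := by
  have hD := dense_disjoint_frontier_para τ p p' (countable_of_discrete (eventually_notMem_sing hφ τ))
  have h := eq_zero_of_dense_sum_theta_eq_zero hm τ
    (c := fun l => coeff m φ (l : ℕ) τ p - coeff m φ (l : ℕ) τ p') hD ?_
  · exact sub_eq_zero.1 (congrFun h l)
  · rintro z ⟨hzs, hz, hz'⟩
    have h1 := decomposition_of_base hm hφ hE hp hzs hz
    have h2 := decomposition_of_base hm hφ hE hp' hzs hz'
    rw [(isPoleReps_inter_para hφ hE hp).finsum_res_eq hm hφ hE hzs (isPoleReps_inter_para hφ hE hp')] at h1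
    simp only [sub_mul, Finset.sum_sub_distrib]
    linear_combination h2 - h1

/-- A base point whose parallelogram boundary also avoids the translates of `z` gives the formula.
Both the coefficients and the residue sum are independent of the choices, which permits the passage
to `p` and `S`. -/
lemma decomposition (hm : 0 < m) (hφ : ∀ τ : ℍ, IsMeromorphicFun (fun z => φ z τ)) (hE : IsElliptic m φ)
    {τ : ℍ} {z p : ℂ} {S : Set ℂ} (hp : IsGoodBase φ τ p) (hS : IsPoleReps φ τ S) (hzs : z ∉ Sing φ τ) :
    φ z τ = ∑ l : Fin (2 * m), coeff m φ (l : ℕ) τ p * theta m (l : ℕ) z τ - 2 * Real.pi * I *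
      ∑ᶠ u ∈ S, res (fun v => fTilde m v z τ) (fun v => φ v τ) u := by
  have hL : ∀ c, ∀ᶠ u in 𝓝[≠] c, u ∉ Sing φ τ ∪ {v | v - z ∈ lattice τ} := fun c => by
    filter_upwards [eventually_notMem_sing hφ τ c, eventually_sub_notMem_lattice τ z c] with u hu hu'
    exact fun h => h.elim hu hu'
  obtain ⟨q, hq⟩ := exists_disjoint_frontier_para τ (countable_of_discrete hL)
  rw [Set.disjoint_union_right] at hq
  have h := decomposition_of_base hm hφ hE hq.1 hzs hq.2
  rw [(isPoleReps_inter_para hφ hE hq.1).finsum_res_eq hm hφ hE hzs hS] at h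
  simp only [coeff_eq_coeff hm hφ hE hp hq.1]
  exact h

end

/-! ### The modular laws -/

section
variable {m : ℕ} {φ : ℂ → ℍ → ℂ}

/-- The base point chosen for the definition of the coefficients. -/
def basePoint (hφ : ∀ τ : ℍ, IsMeromorphicFun (fun z => φ z τ)) (τ : ℍ) : ℂ :=
  (exists_isGoodBase hφ τ).choose

lemma isGoodBase_basePoint (hφ : ∀ τ : ℍ, IsMeromorphicFun (fun z => φ z τ)) (τ : ℍ) :
    IsGoodBase φ τ (basePoint hφ τ) :=
  (exists_isGoodBase hφ τ).choose_spec

/-- The theta coefficients of `φ`. -/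
def thetaCoeff (m : ℕ) (hφ : ∀ τ : ℍ, IsMeromorphicFun (fun z => φ z τ)) (l : Fin (2 * m)) (τ : ℍ) : ℂ :=
  coeff m φ (l : ℕ) τ (basePoint hφ τ)

/-- A transformation law of `φ` under `z ↦ az` passes to the theta part of `φ`. -/
lemma sum_thetaCoeff_comp_mul (hm : 0 < m) (hφ : ∀ τ : ℍ, IsMeromorphicFun (fun z => φ z τ))
    (hE : IsElliptic m φ) {τ τ' : ℍ} {a : ℂ} {c : ℂ → ℂ} (ha : a ≠ 0)
    (hlat : ∀ w, a * w ∈ lattice τ' ↔ w ∈ lattice τ) (hc : Differentiable ℂ c) (hc0 : ∀ v, c v ≠ 0)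
    (hφc : ∀ v ∉ Sing φ τ, a * v ∉ Sing φ τ' → φ (a * v) τ' = c v * φ v τ)
    (hf : ∀ z v, v - z ∉ lattice τ → a * (fTilde m (a * v) (a * z) τ' * c v) = c z * fTilde m v z τ)
    (z : ℂ) :
    ∑ l, thetaCoeff m hφ l τ' * theta m (l : ℕ) (a * z) τ' =
      c z * ∑ l, thetaCoeff m hφ l τ * theta m (l : ℕ) z τ := by
  have hord : ∀ u, meromorphicOrderAt (fun z => φ z τ') (a * u + 0) = meromorphicOrderAt (fun z => φ z τ) u ∧
      ∀ᶠ v in 𝓝[≠] u, φ (a * v + 0) τ' = c v * φ v τ := by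
    refine meromorphicOrderAt_comp_affine ha (hφ τ) (hφ τ') hc hc0 fun v h1 h2 => ?_
    rw [add_zero] at h2 ⊢
    exact hφc v h1 h2
  have hsing : ∀ u, a * u ∈ Sing φ τ' ↔ u ∈ Sing φ τ := by
    intro u
    have := (hord u).1
    rw [add_zero] at this
    rw [Sing, Sing, Set.mem_ofPred_eq, Set.mem_ofPred_eq, this]
  set S := Sing φ τ ∩ para τ (basePoint hφ τ)
  have hS : IsPoleReps φ τ S := isPoleReps_inter_para hφ hE (isGoodBase_basePoint hφ τ)
  have hS' : IsPoleReps φ τ' ((fun u => a * u) '' S) := by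
    constructor
    · rintro _ ⟨u, hu, rfl⟩
      exact (hsing u).2 (hS.1 hu)
    · intro u hu
      obtain ⟨u, rfl⟩ : ∃ v, u = a * v := ⟨a⁻¹ * u, (mul_inv_cancel_left₀ ha u).symm⟩
      obtain ⟨w, ⟨hw, huw⟩, hun⟩ := hS.2 u ((hsing u).1 hu)
      refine ⟨a * w, ⟨⟨w, hw, rfl⟩, by rwa [← mul_sub, hlat]⟩, ?_⟩
      rintro _ ⟨⟨w', hw', rfl⟩, h⟩
      simp only at h ⊢
      rw [← mul_sub, hlat] at h
      rw [hun w' ⟨hw', h⟩]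
  have hoff : ∀ z ∈ (Sing φ τ)ᶜ, ∑ l, thetaCoeff m hφ l τ' * theta m (l : ℕ) (a * z) τ' =
      c z * ∑ l, thetaCoeff m hφ l τ * theta m (l : ℕ) z τ := by
    intro z hz
    have hz' : a * z ∉ Sing φ τ' := fun h => hz ((hsing z).1 h)
    have h1 := decomposition hm hφ hE (isGoodBase_basePoint hφ τ) hS hz
    have h2 := decomposition hm hφ hE (isGoodBase_basePoint hφ τ') hS' hz'
    have h3 : ∑ᶠ u ∈ (fun u => a * u) '' S, res (fun v => fTilde m v (a * z) τ') (fun v => φ v τ') u =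
        c z * ∑ᶠ u ∈ S, res (fun v => fTilde m v z τ) (fun v => φ v τ) u := by
      have hfin := hS.finite hφ hE
      rw [finsum_mem_image (mul_right_injective₀ ha).injOn, ← smul_eq_mul (c z), smul_finsum_mem hfin]
      refine finsum_mem_congr rfl fun u hu => ?_
      have hu' := hS.1 hu
      have huz : u - z ∉ lattice τ := fun h => hz (mem_sing_of_sub_mem_lattice hφ hE (sub_mem_lattice_symm h) hu')
      have h4 := res_comp_affine (F₁ := fun v => fTilde m v z τ) (F₂ := fun v => fTilde m v (a * z) τ')
        -- The factor `a⁻¹` cancels the factor `a` that the change of variables produces in the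
        -- residue.
        (C := a⁻¹ * c z) ha hu' (hord u).1 (analyticAt_fTilde hm τ huz)
        (analyticAt_fTilde hm τ' (by rwa [add_zero, ← mul_sub, hlat])) (hord u).2 ?_
      · rw [add_zero] at h4
        rw [h4, mul_inv_cancel_left₀ ha, smul_eq_mul]
      · filter_upwards [eventually_sub_notMem_lattice τ z u] with v hv
        rw [add_zero, mul_assoc, ← hf z v hv, inv_mul_cancel_left₀ ha]
    rw [h3, hφc z hz hz'] at h2
    simp only [thetaCoeff]
    linear_combination c z * h1 - h2
  have hc1 : Continuous fun z => ∑ l, thetaCoeff m hφ l τ' * theta m (l : ℕ) (a * z) τ' :=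
    continuous_finsetSum _ fun l _ => continuous_const.mul
      ((differentiable_theta hm l τ').continuous.comp (by fun_prop))
  have hc2 : Continuous fun z => c z * ∑ l, thetaCoeff m hφ l τ * theta m (l : ℕ) z τ :=
    hc.continuous.mul (continuous_finsetSum _ fun l _ => continuous_const.mul (differentiable_theta hm l τ).continuous)
  exact congrFun (hc1.ext_on (dense_compl_of_eventually (eventually_notMem_sing hφ τ)) hc2 hoff) z

lemma coe_T_smul (τ : ℍ) : ((ModularGroup.T • τ : ℍ) : ℂ) = τ + 1 := by
  rw [UpperHalfPlane.modular_T_smul, UpperHalfPlane.coe_vadd, ofReal_one, add_comm]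

lemma coe_S_smul (τ : ℍ) : ((ModularGroup.S • τ : ℍ) : ℂ) = -1 / τ := by
  rw [UpperHalfPlane.modular_S_smul, UpperHalfPlane.coe_mk, inv_neg, neg_div, one_div]

/-- Here `f̃` is invariant (`fTilde_T`), so the theta part is unchanged, and comparing coefficients
gives the phase inverse to that of `theta_T`. -/
lemma thetaCoeff_T (hm : 0 < m) (hφ : ∀ τ : ℍ, IsMeromorphicFun (fun z => φ z τ))
    (hE : IsElliptic m φ) {k : ℤ} (hM : IsModular k m φ) (l : Fin (2 * m)) (τ : ℍ) :
    thetaCoeff m hφ l (ModularGroup.T • τ) =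
      exp (-Real.pi * I * ((l : ℕ) : ℂ) ^ 2 / (2 * m)) * thetaCoeff m hφ l τ := by
  have hT := coe_T_smul τ
  have hM' := hM ModularGroup.T τ
  set τ' := ModularGroup.T • τ with hτ'
  have h := sum_thetaCoeff_comp_mul hm hφ hE (τ := τ) (τ' := τ') (a := 1) (c := fun _ => 1) one_ne_zero ?_
    (differentiable_const _) (fun _ => one_ne_zero) ?_ ?_
  · have h0 := eq_zero_of_dense_sum_theta_eq_zero hm τ dense_univ (c := fun l => thetaCoeff m hφ l τ' *
      exp (Real.pi * I * ((l : ℕ) : ℂ) ^ 2 / (2 * m)) - thetaCoeff m hφ l τ) fun z _ => ?_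
    · have h1 : thetaCoeff m hφ l τ' * exp (Real.pi * I * ((l : ℕ) : ℂ) ^ 2 / (2 * m)) - thetaCoeff m hφ l τ = 0 :=
        congrFun h0 l
      rw [← sub_eq_zero.1 h1, mul_left_comm, ← exp_add]
      have e : -Real.pi * I * ((l : ℕ) : ℂ) ^ 2 / (2 * m) + Real.pi * I * ((l : ℕ) : ℂ) ^ 2 / (2 * m) = 0 := by ring
      rw [e, exp_zero, mul_one]
    · have h1 := h z
      simp only [one_mul, theta_T hm _ _ τ τ' hT, Int.cast_natCast] at h1
      simp only [sub_mul, Finset.sum_sub_distrib]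
      rw [sub_eq_zero, ← h1]
      exact Finset.sum_congr rfl fun j _ => mul_assoc _ _ _
  · intro w
    rw [one_mul]
    constructor
    · rintro ⟨a, b, hab⟩
      exact ⟨a, a + b, by rw [hab, hT]; push_cast; ring⟩
    · rintro ⟨a, b, hab⟩
      exact ⟨a, b - a, by rw [hab, hT]; push_cast; ring⟩
  · intro v h1 h2
    have h3 := hM' v
    simp only [ModularGroup.coe_T, Matrix.of_apply, Matrix.cons_val', Matrix.cons_val_zero, Matrix.cons_val_one,
      Matrix.cons_val_fin_one, Int.cast_zero, Int.cast_one, zero_mul, zero_add, div_one, one_zpow,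
      mul_zero, exp_zero, one_mul] at h3
    rw [one_mul] at h2 ⊢
    rw [one_mul]
    exact h3 h1 h2
  · intro z v _
    simp only [one_mul, mul_one]
    exact fTilde_T hm v z τ τ' hT

/-- The law for the theta part with `a = 1/τ` and `c(v) = τ^k e^{2πimv²/τ}` rests on `fTilde_S`.
Comparing coefficients through `theta_S` expresses the new coefficients by a finite Fourier
transform, which still has to be inverted. -/
lemma thetaCoeff_S (hm : 0 < m) (hφ : ∀ τ : ℍ, IsMeromorphicFun (fun z => φ z τ))
    (hE : IsElliptic m φ) {k : ℤ} (hM : IsModular k m φ) (l : Fin (2 * m)) (τ : ℍ) :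
    thetaCoeff m hφ l (ModularGroup.S • τ) =
      (τ : ℂ) ^ k / (-I * (τ : ℂ)) ^ (1 / 2 : ℂ) * (1 / (Real.sqrt (2 * m) : ℂ)) *
        ∑ n : Fin (2 * m), exp (Real.pi * I * ((l : ℕ) : ℂ) * ((n : ℕ) : ℂ) / m) * thetaCoeff m hφ n τ := by
  have hS := coe_S_smul τ
  have hM' := hM ModularGroup.S τ
  have hτ : (τ : ℂ) ≠ 0 := τ.ne_zero
  set τ' := ModularGroup.S • τ with hτ'
  have hdiv : ∀ w : ℂ, (τ : ℂ)⁻¹ * w = w / τ := fun w => by rw [div_eq_mul_inv, mul_comm]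
  have h := sum_thetaCoeff_comp_mul hm hφ hE (τ := τ) (τ' := τ') (a := (τ : ℂ)⁻¹)
    (c := fun v => (τ : ℂ) ^ k * exp (2 * Real.pi * I * m * v ^ 2 / τ)) (inv_ne_zero hτ) ?_
    (by fun_prop) (fun v => mul_ne_zero (zpow_ne_zero _ hτ) (exp_ne_zero _)) ?_ ?_
  · set κ : ℂ := (-I * (τ : ℂ)) ^ (1 / 2 : ℂ) with hκ
    set ρ : ℂ := (Real.sqrt (2 * m) : ℂ) with hρ
    have hm' : (0 : ℝ) < 2 * m := by
      have : (0 : ℝ) < m := by exact_mod_cast hm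
      positivity
    have hκ0 : κ ≠ 0 := by
      rw [hκ, Ne, cpow_eq_zero_iff]
      simp [hτ]
    have hρ2 : ρ * ρ = 2 * m := by
      rw [hρ, ← ofReal_mul, Real.mul_self_sqrt hm'.le]
      push_cast
      rfl
    have hρ0 : ρ ≠ 0 := by
      rw [hρ]
      exact ofReal_ne_zero.2 (Real.sqrt_pos.2 hm').ne'
    have h0 := eq_zero_of_dense_sum_theta_eq_zero hm τ dense_univ (c := fun n => κ / ρ * (∑ j : Fin (2 * m),
      thetaCoeff m hφ j τ' * exp (-Real.pi * I * ((j : ℕ) : ℂ) * ((n : ℕ) : ℂ) / m)) -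
        (τ : ℂ) ^ k * thetaCoeff m hφ n τ) fun z _ => ?_
    · have h1 : ∀ n : Fin (2 * m), κ / ρ * (∑ j : Fin (2 * m), thetaCoeff m hφ j τ' *
          exp (-Real.pi * I * ((j : ℕ) : ℂ) * ((n : ℕ) : ℂ) / m)) = (τ : ℂ) ^ k * thetaCoeff m hφ n τ := fun n =>
        sub_eq_zero.1 (congrFun h0 n)
      -- Inversion of the finite Fourier transform by the orthogonality relation `sum_exp_root`.
      have h2 : (τ : ℂ) ^ k * ∑ n : Fin (2 * m), exp (Real.pi * I * ((l : ℕ) : ℂ) * ((n : ℕ) : ℂ) / m) *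
          thetaCoeff m hφ n τ = κ / ρ * (2 * m * thetaCoeff m hφ l τ') := by
        calc _ = ∑ n : Fin (2 * m), exp (Real.pi * I * ((l : ℕ) : ℂ) * ((n : ℕ) : ℂ) / m) *
              (κ / ρ * (∑ j : Fin (2 * m), thetaCoeff m hφ j τ' *
                exp (-Real.pi * I * ((j : ℕ) : ℂ) * ((n : ℕ) : ℂ) / m))) := by
              rw [Finset.mul_sum]
              exact Finset.sum_congr rfl fun n _ => by rw [h1]; ring
          _ = κ / ρ * ∑ j : Fin (2 * m), thetaCoeff m hφ j τ' * ∑ n : Fin (2 * m),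
                exp (Real.pi * I * ((n : ℕ) : ℂ) * ((l : ℕ) : ℂ) / m) *
                exp (-Real.pi * I * ((n : ℕ) : ℂ) * ((j : ℕ) : ℂ) / m) := by
              simp only [Finset.mul_sum]
              rw [Finset.sum_comm]
              refine Finset.sum_congr rfl fun j _ => Finset.sum_congr rfl fun n _ => ?_
              rw [mul_right_comm (Real.pi * I) ((l : ℕ) : ℂ), mul_right_comm (-Real.pi * I) ((j : ℕ) : ℂ)]
              ring
          _ = _ := by
              simp only [sum_exp_root hm, mul_ite, mul_zero, Finset.sum_ite_eq, Finset.mem_univ, if_true]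
              ring
      have h3 : κ / ρ * (2 * m * thetaCoeff m hφ l τ') = κ * ρ * thetaCoeff m hφ l τ' := by
        rw [← hρ2]; field_simp
      rw [h3] at h2
      field_simp
      linear_combination -h2
    · have h1 := h z
      simp only [hdiv, theta_S hm _ _ τ τ' hS, Int.cast_natCast] at h1
      have he := exp_ne_zero (2 * Real.pi * I * m * z ^ 2 / τ)
      refine (mul_eq_zero.1 (?_ : exp (2 * Real.pi * I * m * z ^ 2 / τ) * _ = 0)).resolve_left he
      simp only [sub_mul, Finset.sum_sub_distrib, mul_sub]
      rw [sub_eq_zero]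
      refine Eq.trans ?_ (h1.trans ?_)
      · simp only [Finset.mul_sum, Finset.sum_mul]
        rw [Finset.sum_comm]
        refine Finset.sum_congr rfl fun j _ => Finset.sum_congr rfl fun n _ => ?_
        ring
      · simp only [Finset.mul_sum]
        exact Finset.sum_congr rfl fun n _ => by ring
  · intro w
    rw [hdiv]
    exact sub_mem_lattice_div_iff hS w
  · intro v h1 h2
    have h3 := hM' v
    simp only [ModularGroup.coe_S, Matrix.of_apply, Matrix.cons_val', Matrix.cons_val_zero, Matrix.cons_val_one,
      Matrix.cons_val_fin_one, Int.cast_zero, Int.cast_one, one_mul, add_zero, mul_one] at h3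
    rw [hdiv] at h2 ⊢
    exact h3 h1 h2
  · intro z v hv
    have h1 := fTilde_S hm hS hv
    rw [hdiv, hdiv]
    field_simp at h1 ⊢
    linear_combination h1

end

end MeroJacobi

end

theorem mainTheorem8 (m : ℕ) (hm : 0 < m) (φ : ℂ → ℍ → ℂ)
    (hφ : ∀ τ : ℍ, MeroJacobi.IsMeromorphicFun (fun z => φ z τ))
    (hE : MeroJacobi.IsElliptic m φ) :
    (∀ τ : ℍ, ∃ p : ℂ, MeroJacobi.IsGoodBase φ τ p) ∧
    ∃ h : Fin (2 * m) → ℍ → ℂ,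
      -- the coefficients are given by the explicit formula, for every admissible base point
      (∀ (τ : ℍ) (p : ℂ), MeroJacobi.IsGoodBase φ τ p →
        (MeroJacobi.Sing φ τ ∩ MeroJacobi.para τ p).Finite ∧
        ∀ l : Fin (2 * m),
          (∀ u ∈ MeroJacobi.Sing φ τ ∩ MeroJacobi.para τ p,
            AnalyticAt ℝ (fun v => MeroJacobi.R m (l : ℕ) v τ) u) ∧
          h l τ = MeroJacobi.coeff m φ (l : ℕ) τ p) ∧
      -- the decomposition, for every system of representatives of the poles modulo the lattice
      (∀ (τ : ℍ) (S : Set ℂ), MeroJacobi.IsPoleReps φ τ S →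
        S.Finite ∧
        ∀ z ∉ MeroJacobi.Sing φ τ,
          (∀ u ∈ S, AnalyticAt ℝ (fun v => MeroJacobi.fTilde m v z τ) u) ∧
          φ z τ = ∑ l : Fin (2 * m), h l τ * MeroJacobi.theta m (l : ℕ) z τ
            - 2 * Real.pi * Complex.I *
              ∑ᶠ u ∈ S, MeroJacobi.res (fun v => MeroJacobi.fTilde m v z τ) (fun v => φ v τ) u) ∧
      -- the modular transformation laws
      (∀ k : ℤ, MeroJacobi.IsModular k m φ →
        ∀ (l : Fin (2 * m)) (τ : ℍ),
          h l (ModularGroup.T • τ)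
            = Complex.exp (-Real.pi * Complex.I * ((l : ℕ) : ℂ) ^ 2 / (2 * m)) * h l τ ∧
          h l (ModularGroup.S • τ)
            = (τ : ℂ) ^ k / (-Complex.I * (τ : ℂ)) ^ (1 / 2 : ℂ) * (1 / (Real.sqrt (2 * m) : ℂ)) *
              ∑ n : Fin (2 * m),
                Complex.exp (Real.pi * Complex.I * ((l : ℕ) : ℂ) * ((n : ℕ) : ℂ) / m) * h n τ) := by

  refine ⟨MeroJacobi.exists_isGoodBase hφ, MeroJacobi.thetaCoeff m hφ, ?_, ?_, ?_⟩
  · exact fun τ p hp => ⟨MeroJacobi.finite_sing_inter_para hφ τ p, fun l =>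
      ⟨fun u _ => MeroJacobi.analyticAt_R hm _ τ u,
        MeroJacobi.coeff_eq_coeff hm hφ hE (MeroJacobi.isGoodBase_basePoint hφ τ) hp l⟩⟩
  · exact fun τ S hS => ⟨hS.finite hφ hE, fun z hz => ⟨fun u hu => MeroJacobi.analyticAt_fTilde hm τ fun h =>
      hz (MeroJacobi.mem_sing_of_sub_mem_lattice hφ hE (MeroJacobi.sub_mem_lattice_symm h) (hS.1 hu)),
      MeroJacobi.decomposition hm hφ hE (MeroJacobi.isGoodBase_basePoint hφ τ) hS hz⟩⟩
  · exact fun k hM l τ => ⟨MeroJacobi.thetaCoeff_T hm hφ hE hM l τ, MeroJacobi.thetaCoeff_S hm hφ hE hM l τ⟩
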